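/- Let $V$ be a finite-dimensional complex inner product space and let $G\subseteq \mathrm{GL}(V)$ be a closed connected subgroup that is stable under the Cartan involution $\theta(g)=(g^{-1})^{*}$ and whose Lie algebra $\mathfrak g=\{Y\in\mathrm{End}_{\mathbb C}(V): e^{\mathbb RY}\subseteq G\}$ is a complex subspace of $\mathrm{End}_{\mathbb C}(V)$. Let $\mathfrak p=\{Y\in\mathfrak g: Y^{*}=Y\}$ and let $\mathfrak a\subseteq\mathfrak p$ be a maximal abelian subspace. Let $\mathcal P\subseteq\mathfrak a^{*}$ be the set of weights of $\mathfrak a$ on $V$ (the functionals $\mu$ with $V^\mu=\{v\in V: Hv=\mu(H)v\ \forall H\in\mathfrak a\}\neq 0$), let $\Delta\subseteq\mathfrak a^{*}\setminus\{0\}$ be the set of restricted roots (the functionals $\alpha\ne0$ for which $\mathfrak g^\alpha=\{Y\in\mathfrak g:[H,Y]=\alpha(H)Y\ \forall H\in\mathfrak a\}\ne0$), let $X_o\in\mathfrak a$ satisfy $\alpha(X_o)\neq0$ for all $\alpha\in\Delta$, and put $\Delta^+=\{\alpha\in\Delta:\alpha(X_o)>0\}$. Let $\mathcal M=G\cdot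 x\subseteq\mathbb P(V)$ be a closed $G$-orbit (a complex flag manifold). Let $X\in\mathfrak a$ be special, i.e. $\alpha(X)<0$ for all $\alpha\in\Delta^+$, and $\mu(X)\neq\nu(X)$ for all distinct $\mu,\nu\in\mathcal P$. Write $\pi:V\setminus\{0\}\to\mathbb P(V)$, $v\mapsto[v]$, and consider on $\mathbb P(V)$ the vector field $[v]\mapsto d\pi_v(Xv)$, also denoted $X$, with flow $\Phi(t,[v])=[e^{tX}v]$. For $A\subseteq\mathcal M$ let $\mathcal W^{\pm}_{\mathcal M}(A)=\{y\in\mathcal M: d(\Phi(t,y),A)\to0 \text{ as } t\to\pm\infty\}$, where $d$ is a metric that defines the topology of $\mathbb P(V)$. Then the vector field $X$ on $\mathcal M$ is Morse–Smale. That is, $\mathcal M$ is a compact embedded submanifold of $\mathbb P(V)$ to which $X$ is tangent, $X$ has on $\mathcal M$ only finitely many critical elements (critical points and closed orbits), all of them are hyperbolic in $\mathcal M$, for any critical elements $A,B$ the submanifolds $\mathcal W^-_{\mathcal M}(A)$ and $\mathcal W^+_{\mathcal M}(B)$ of $\mathcal M$ intersect transversally in $\mathcal M$, and the nonwandering set of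 $\Phi$ on $\mathcal M$ is the union of the critical elements. In fact: (i) $[v]\mapsto -d\pi_v(Xv)$ is the gradient vector field of the function $f([v])=-\frac12\frac{(Xv|v)}{(v|v)}$ on $\mathbb P(V)$, where $(v|w)=\mathrm{Re}\langle v|w\rangle$ and the Riemannian metric on $\mathbb P(V)$ is the real part of the Fubini–Study metric, characterised by $\langle d\pi_v(u)|d\pi_v(w)\rangle_{FS}=\langle u|w\rangle/\langle v|v\rangle$ for $u,w\perp v$. (ii) $\mathcal W^-_{\mathcal M}(\{x\})$ and $\mathcal W^+_{\mathcal M}(\{y\})$ are embedded submanifolds that intersect transversally in $\mathcal M$ for all fixed points $x,y$ of $\Phi$ in $\mathcal M$. (iii) All critical points of $X$ on $\mathcal M$ are hyperbolic, i.e. at a zero $p\in\mathcal M$ of $X$ the linearization $DX_p:T_p\mathcal M\to T_p\mathcal M$ has no eigenvalue with real part zero. -/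

import Mathlib

open scoped Manifold ContDiff LinearAlgebra.Projectivization Topology InnerProductSpace
open scoped TensorProduct
open Set Filter Module

noncomputable section ProjectiveSpace

variable (V : Type*) [NormedAddCommGroup V] [InnerProductSpace ℂ V]

/-- The punctured space `V ∖ {0}`, an open submanifold of `V`. -/
abbrev PuncturedSpace : TopologicalSpace.Opens V := ⟨{0}ᶜ, isOpen_compl_singleton⟩

/-- The model space `ℂ^(dim V - 1)` of the projective space `ℙ(V)`. -/
abbrev ProjModel : Type := EuclideanSpace ℂ (Fin (finrank ℂ V - 1))

variable {V}

/-- The natural projection `π : V ∖ {0} → ℙ(V)`, `v ↦ [v]`. -/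
def projPi (v : PuncturedSpace V) : ℙ ℂ V := Projectivization.mk ℂ v.1 v.2

/-- `ℙ(V)` carries the quotient topology of `V ∖ {0}`. -/
instance projTopology : TopologicalSpace (ℙ ℂ V) :=
  TopologicalSpace.coinduced projPi inferInstance

theorem projPi_surjective : Function.Surjective (projPi (V := V)) := fun p =>
  ⟨⟨p.rep, p.rep_nonzero⟩, p.mk_rep⟩

theorem isQuotientMap_projPi : Topology.IsQuotientMap (projPi (V := V)) :=
  ⟨⟨rfl⟩, projPi_surjective⟩

theorem exists_smul_of_projPi_eq {v w : PuncturedSpace V} (h : projPi v = projPi w) :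
    ∃ c : ℂ, c ≠ 0 ∧ v.1 = c • w.1 := by
  obtain ⟨a, ha⟩ := (Projectivization.mk_eq_mk_iff ℂ v.1 w.1 v.2 w.2).1 h
  exact ⟨a, a.ne_zero, ha.symm⟩

theorem projPi_eq_of_smul {v w : PuncturedSpace V} {c : ℂ} (h : v.1 = c • w.1) :
    projPi v = projPi w :=
  (Projectivization.mk_eq_mk_iff' ℂ v.1 w.1 v.2 w.2).2 ⟨c, h.symm⟩

/-- Affine coordinates on `ℙ(V)` given by linear coordinates `T : V ≃ ℂ × ℂ^(dim V - 1)`: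
`[v] ↦ (T v).2 / (T v).1`, a well-defined function of the line `[v]`. -/
def affineCoord (T : V ≃L[ℂ] ℂ × ProjModel V) (p : ℙ ℂ V) : ProjModel V :=
  (T p.rep).1⁻¹ • (T p.rep).2

theorem affineCoord_projPi (T : V ≃L[ℂ] ℂ × ProjModel V) (v : PuncturedSpace V) :
    affineCoord T (projPi v) = (T v.1).1⁻¹ • (T v.1).2 := by
  obtain ⟨c, hc, h⟩ := exists_smul_of_projPi_eq
    (v := ⟨(projPi v).rep, (projPi v).rep_nonzero⟩) (w := v) (Projectivization.mk_rep _)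
  simp only at h
  rw [affineCoord, h, map_smul, Prod.smul_fst, Prod.smul_snd, smul_eq_mul, mul_inv, smul_smul]
  congr 1
  field_simp

/-- The inverse of affine coordinates, `e ↦ [T⁻¹ (1, e)]`. -/
def affineInv (T : V ≃L[ℂ] ℂ × ProjModel V) (e : ProjModel V) : ℙ ℂ V :=
  projPi ⟨T.symm (1, e), by
    simp only [TopologicalSpace.Opens.mem_mk, mem_compl_iff, mem_singleton_iff,
      EmbeddingLike.map_eq_zero_iff, Prod.mk_eq_zero, one_ne_zero, false_and, not_false_eq_true]⟩

theorem fst_rep_projPi_ne_zero_iff (T : V ≃L[ℂ] ℂ × ProjModel V) (v : PuncturedSpace V) :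
    (T (projPi v).rep).1 ≠ 0 ↔ (T v.1).1 ≠ 0 := by
  obtain ⟨c, hc, h⟩ := exists_smul_of_projPi_eq
    (v := ⟨(projPi v).rep, (projPi v).rep_nonzero⟩) (w := v) (Projectivization.mk_rep _)
  simp only at h
  rw [h, map_smul, Prod.smul_fst, smul_eq_mul, mul_ne_zero_iff]
  exact ⟨fun h => h.2, fun h => ⟨hc, h⟩⟩

theorem isOpen_affine_source (T : V ≃L[ℂ] ℂ × ProjModel V) :
    IsOpen {p : ℙ ℂ V | (T p.rep).1 ≠ 0} := by
  rw [← isQuotientMap_projPi.isOpen_preimage]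
  have : projPi ⁻¹' {p : ℙ ℂ V | (T p.rep).1 ≠ 0} =
      {v : PuncturedSpace V | (T v.1).1 ≠ 0} := by
    ext v
    exact fst_rep_projPi_ne_zero_iff T v
  rw [this]
  exact isOpen_ne_fun (by fun_prop) continuous_const

/-- The affine chart of `ℙ(V)` defined by the linear coordinates `T`. -/
def affineChart (T : V ≃L[ℂ] ℂ × ProjModel V) : OpenPartialHomeomorph (ℙ ℂ V) (ProjModel V) where
  toFun := affineCoord T
  invFun := affineInv T
  source := {p | (T p.rep).1 ≠ 0}
  target := univ
  map_source' _ _ := mem_univ _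
  map_target' e _ := by
    simp only [affineInv]
    rw [mem_ofPred_eq, fst_rep_projPi_ne_zero_iff]
    simp
  left_inv' p hp := by
    obtain ⟨v, rfl⟩ := projPi_surjective p
    rw [mem_ofPred_eq, fst_rep_projPi_ne_zero_iff] at hp
    rw [affineCoord_projPi]
    refine projPi_eq_of_smul (c := (T v.1).1⁻¹) ?_
    simp only
    apply T.injective
    rw [T.apply_symm_apply, map_smul]
    ext1
    · simp [hp]
    · simp
  right_inv' e _ := by
    rw [affineInv, affineCoord_projPi]
    simp
  open_source := isOpen_affine_source T
  open_target := isOpen_univ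
  continuousOn_toFun := by
    rw [isQuotientMap_projPi.continuousOn_isOpen_iff (isOpen_affine_source T)]
    have h : EqOn (affineCoord T ∘ projPi) (fun v : PuncturedSpace V => (T v.1).1⁻¹ • (T v.1).2)
        (projPi ⁻¹' {p | (T p.rep).1 ≠ 0}) := fun v _ => affineCoord_projPi T v
    refine ContinuousOn.congr ?_ h
    have hc : Continuous (fun v : PuncturedSpace V => T v.1) := by fun_prop
    refine ContinuousOn.smul (ContinuousOn.inv₀ hc.fst.continuousOn ?_) hc.snd.continuousOn
    intro v hv
    exact (fst_rep_projPi_ne_zero_iff T v).1 hv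
  continuousOn_invFun := by
    apply Continuous.continuousOn
    exact isQuotientMap_projPi.continuous.comp (Continuous.subtype_mk (by fun_prop) _)

variable [FiniteDimensional ℂ V]

/-- Linear coordinates adapted to a line `p` and its orthogonal complement. -/
theorem exists_adapted_coord (p : ℙ ℂ V) : ∃ T : V ≃L[ℂ] ℂ × ProjModel V,
    T p.rep = (1, 0) ∧ ∀ u : V, ⟪p.rep, u⟫_ℂ = 0 → (T u).1 = 0 := by
  have hne := p.rep_nonzero
  set v := p.rep
  let K := ℂ ∙ v
  have h1 : finrank ℂ K = 1 := finrank_span_singleton hne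
  have h2 := K.finrank_add_finrank_orthogonal
  have h3 : finrank ℂ Kᗮ = finrank ℂ (ProjModel V) := by
    rw [finrank_euclideanSpace_fin]; omega
  let L0 := LinearEquiv.ofFinrankEq Kᗮ (ProjModel V) h3
  let T0 : V ≃ₗ[ℂ] ℂ × ProjModel V :=
    (K.prodEquivOfIsCompl Kᗮ K.isCompl_orthogonal).symm.trans
      (LinearEquiv.prodCongr (LinearEquiv.toSpanNonzeroSingleton ℂ V v hne).symm L0)
  refine ⟨T0.toContinuousLinearEquiv, ?_, ?_⟩
  · change T0 v = (1, 0)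
    rw [← LinearEquiv.eq_symm_apply]
    simp only [T0, LinearEquiv.trans_symm, LinearEquiv.symm_symm, LinearEquiv.trans_apply]
    simp only [LinearEquiv.prodCongr_symm, LinearEquiv.symm_symm, LinearEquiv.prodCongr_apply, map_zero,
      Submodule.coe_prodEquivOfIsCompl', ZeroMemClass.coe_zero, add_zero]
    rw [LinearEquiv.toSpanNonzeroSingleton_one]
  · intro u hu
    have hu' : u ∈ Kᗮ := Submodule.mem_orthogonal_singleton_iff_inner_right.2 hu
    change (T0 u).1 = 0
    have : T0 u = (0, L0 ⟨u, hu'⟩) := by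
      rw [← LinearEquiv.eq_symm_apply]
      simp [T0]
    rw [this]

/-- A choice of linear coordinates adapted to the line `p`: `p.rep` goes to `(1, 0)` and its
orthogonal complement goes to `0 × ℂ^(dim V - 1)`. -/
def adaptedCoord (p : ℙ ℂ V) : V ≃L[ℂ] ℂ × ProjModel V := (exists_adapted_coord p).choose

theorem adaptedCoord_rep (p : ℙ ℂ V) : adaptedCoord p p.rep = (1, 0) :=
  (exists_adapted_coord p).choose_spec.1

theorem adaptedCoord_fst_of_orthogonal {p : ℙ ℂ V} {u : V} (hu : ⟪p.rep, u⟫_ℂ = 0) :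
    (adaptedCoord p u).1 = 0 :=
  (exists_adapted_coord p).choose_spec.2 u hu

/-- The standard atlas of `ℙ(V)`: all affine charts. -/
instance projChartedSpace : ChartedSpace (ProjModel V) (ℙ ℂ V) where
  atlas := range affineChart
  chartAt p := affineChart (adaptedCoord p)
  mem_chart_source p := by
    change (adaptedCoord p p.rep).1 ≠ 0
    rw [adaptedCoord_rep]
    exact one_ne_zero
  chart_mem_atlas p := mem_range_self _

/-- `ℙ(V)` is a smooth manifold. -/
instance projIsManifold : IsManifold 𝓘(ℝ, ProjModel V) ∞ (ℙ ℂ V) := by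
  apply isManifold_of_contDiffOn
  rintro _ _ ⟨T, rfl⟩ ⟨S, rfl⟩
  have h : ∀ e : ProjModel V, affineCoord S (affineInv T e) =
      (S (T.symm (1, e))).1⁻¹ • (S (T.symm (1, e))).2 := fun e => affineCoord_projPi S _
  have h' : ∀ e : ProjModel V, (S (affineInv T e).rep).1 ≠ 0 ↔ (S (T.symm (1, e))).1 ≠ 0 :=
    fun e => fst_rep_projPi_ne_zero_iff S _
  have hl : ContDiff ℝ ∞ (fun e : ProjModel V => S (T.symm (1, e))) :=
    ((S.toContinuousLinearMap.comp T.symm.toContinuousLinearMap).restrictScalars ℝ).contDiff.comp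
      (contDiff_const.prodMk contDiff_id)
  have : ContDiffOn ℝ ∞ (fun e : ProjModel V =>
      (S (T.symm (1, e))).1⁻¹ • (S (T.symm (1, e))).2) {e | (S (T.symm (1, e))).1 ≠ 0} := by
    refine ContDiffOn.smul (ContDiffOn.inv hl.fst.contDiffOn fun e he => he) hl.snd.contDiffOn
  refine (this.congr fun e _ => h e).mono ?_
  intro e he
  simp only [mfld_simps] at he
  exact (h' e).1 he.2

end ProjectiveSpace

noncomputable section ProjectiveDynamics

variable {V : Type*} [NormedAddCommGroup V] [InnerProductSpace ℂ V] [FiniteDimensional ℂ V]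

/-- The differential `dπ_v : V → T_[v] ℙ(V)` of the projection `π` at `v ≠ 0`. -/
def dProjPi (v : PuncturedSpace V) : V →L[ℝ] TangentSpace 𝓘(ℝ, ProjModel V) (projPi v) :=
  mfderiv 𝓘(ℝ, V) 𝓘(ℝ, ProjModel V) projPi v

theorem adaptedCoord_projPi (v : PuncturedSpace V) : ∃ c : ℂ, c ≠ 0 ∧
    v.1 = c • (projPi v).rep ∧ adaptedCoord (projPi v) v.1 = (c, 0) := by
  obtain ⟨c, hc, h⟩ := exists_smul_of_projPi_eq (v := v)
    (w := ⟨(projPi v).rep, (projPi v).rep_nonzero⟩) (Projectivization.mk_rep _).symm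
  refine ⟨c, hc, h, ?_⟩
  simp only at h
  conv_lhs => rw [h]
  rw [map_smul, adaptedCoord_rep]
  simp

theorem hasMFDerivAt_projPi (v : PuncturedSpace V) :
    HasMFDerivAt 𝓘(ℝ, V) 𝓘(ℝ, ProjModel V) projPi v
      ((adaptedCoord (projPi v) v.1).1⁻¹ • ((ContinuousLinearMap.snd ℂ ℂ (ProjModel V)).comp
        (adaptedCoord (projPi v)).toContinuousLinearMap).restrictScalars ℝ) := by
  set T := adaptedCoord (projPi v) with hT
  obtain ⟨c, hc, h1, h2⟩ := adaptedCoord_projPi v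
  rw [← hT] at h2
  refine ⟨isQuotientMap_projPi.continuous.continuousAt, ?_⟩
  apply HasFDerivAt.hasFDerivWithinAt
  have hx : (extChartAt 𝓘(ℝ, V) v) v = v.1 := rfl
  rw [hx]
  have hTf : HasFDerivAt (fun y : V => T y) (T.toContinuousLinearMap.restrictScalars ℝ) v.1 :=
    (T.toContinuousLinearMap.restrictScalars ℝ).hasFDerivAt
  have hd : HasFDerivAt (fun y : V => (T y).1⁻¹ • (T y).2)
      ((T v.1).1⁻¹ • ((ContinuousLinearMap.snd ℂ ℂ (ProjModel V)).comp
        T.toContinuousLinearMap).restrictScalars ℝ) v.1 := by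
    have h3 : (T v.1).1 ≠ 0 := by rw [h2]; exact hc
    have hinv := (hasFDerivAt_inv' (𝕜 := ℝ) h3).comp v.1 hTf.fst
    refine (hinv.smul hTf.snd).congr_fderiv ?_
    ext1 u
    simp [h2]
  refine hd.congr_of_eventuallyEq ?_
  have ho : (PuncturedSpace V : Set V) ∈ 𝓝 v.1 := (PuncturedSpace V).isOpen.mem_nhds v.2
  filter_upwards [ho] with y hy
  have hy2 : (extChartAt 𝓘(ℝ, V) v).symm y = ⟨y, hy⟩ := by
    have : (extChartAt 𝓘(ℝ, V) v).symm ((extChartAt 𝓘(ℝ, V) v) ⟨y, hy⟩) = ⟨y, hy⟩ := by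
      apply (extChartAt 𝓘(ℝ, V) v).left_inv
      simp [mfld_simps, TopologicalSpace.Opens.chartAt_eq, chartAt_self_eq]
    exact this
  change affineCoord T (projPi ((extChartAt 𝓘(ℝ, V) v).symm y)) = _
  rw [hy2, affineCoord_projPi]

theorem dProjPi_apply (v : PuncturedSpace V) (u : V) :
    (dProjPi v u : ProjModel V) =
      (adaptedCoord (projPi v) v.1).1⁻¹ • (adaptedCoord (projPi v) u).2 := by
  rw [dProjPi, (hasMFDerivAt_projPi v).mfderiv]
  rfl

/-- Horizontal lift: the vector `u` orthogonal to `p.rep` with `dπ(u) = ξ` at `p.rep`. -/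
def horizontalLift (p : ℙ ℂ V) (ξ : TangentSpace 𝓘(ℝ, ProjModel V) p) : V :=
  (adaptedCoord p).symm (0, ξ)

/-- The (Hermitian) Fubini–Study metric on `ℙ(V)`. Its real part is a Riemannian metric; see
`fubiniStudy_dProjPi` for the characterizing property
`⟨dπ_v u, dπ_v w⟩ = ⟨u, w⟩ / ⟨v, v⟩` for `u, w` orthogonal to `v`. -/
def fubiniStudy (p : ℙ ℂ V) (ξ η : TangentSpace 𝓘(ℝ, ProjModel V) p) : ℂ :=
  ⟪horizontalLift p ξ, horizontalLift p η⟫_ℂ / ⟪p.rep, p.rep⟫_ℂ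

theorem horizontalLift_dProjPi (v : PuncturedSpace V) {u : V} (hu : ⟪v.1, u⟫_ℂ = 0) :
    horizontalLift (projPi v) (dProjPi v u) = (adaptedCoord (projPi v) v.1).1⁻¹ • u := by
  obtain ⟨c, hc, h1, h2⟩ := adaptedCoord_projPi v
  have hu' : ⟪(projPi v).rep, u⟫_ℂ = 0 := by
    rw [h1, inner_smul_left] at hu
    exact (mul_eq_zero.1 hu).resolve_left (by simpa using hc)
  rw [horizontalLift, dProjPi_apply, ContinuousLinearEquiv.symm_apply_eq, map_smul]
  ext1
  · simp [adaptedCoord_fst_of_orthogonal hu']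
  · rfl

theorem fubiniStudy_dProjPi (v : PuncturedSpace V) {u w : V} (hu : ⟪v.1, u⟫_ℂ = 0)
    (hw : ⟪v.1, w⟫_ℂ = 0) :
    fubiniStudy (projPi v) (dProjPi v u) (dProjPi v w) = ⟪u, w⟫_ℂ / ⟪v.1, v.1⟫_ℂ := by
  obtain ⟨c, hc, h1, h2⟩ := adaptedCoord_projPi v
  rw [fubiniStudy, horizontalLift_dProjPi v hu, horizontalLift_dProjPi v hw, h2]
  conv_rhs => rw [h1]
  simp only [inner_smul_left, inner_smul_right]
  have : (starRingEnd ℂ) c ≠ 0 := by simpa using hc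
  simp only [map_inv₀]
  field_simp

theorem dProjPi_self_smul (v : PuncturedSpace V) (a : ℂ) : dProjPi v (a • v.1) = 0 := by
  obtain ⟨c, hc, h1, h2⟩ := adaptedCoord_projPi v
  refine (dProjPi_apply v _).trans ?_
  rw [map_smul, h2]
  simp
  rfl

theorem exists_dProjPi_eq (v : PuncturedSpace V)
    (ξ : TangentSpace 𝓘(ℝ, ProjModel V) (projPi v)) :
    ∃ u : V, ⟪v.1, u⟫_ℂ = 0 ∧ dProjPi v u = ξ := by
  obtain ⟨c, hc, h1, h2⟩ := adaptedCoord_projPi v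
  let u : V := c • (adaptedCoord (projPi v)).symm (0, ξ)
  have hu : dProjPi v u = ξ := by
    refine (dProjPi_apply v _).trans ?_
    rw [h2, map_smul, ContinuousLinearEquiv.apply_symm_apply]
    exact inv_smul_smul₀ (α := ℂ) (β := ProjModel V) hc ξ
  refine ⟨u - (⟪v.1, u⟫_ℂ / ⟪v.1, v.1⟫_ℂ) • v.1, ?_, ?_⟩
  · have : ⟪v.1, v.1⟫_ℂ ≠ 0 := inner_self_ne_zero.2 v.2
    rw [inner_sub_right, inner_smul_right _ v.1, div_mul_cancel₀ _ this, sub_self]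
  · rw [map_sub, hu, dProjPi_self_smul, sub_zero]

/-- The vector field `[v] ↦ dπ_v (A v)` on `ℙ(V)` defined by a linear map `A`. -/
def projField (A : V →L[ℂ] V) (p : ℙ ℂ V) : TangentSpace 𝓘(ℝ, ProjModel V) p :=
  dProjPi ⟨p.rep, p.rep_nonzero⟩ (A p.rep)

theorem projField_projPi (A : V →L[ℂ] V) (v : PuncturedSpace V) :
    projField A (projPi v) = dProjPi v (A v.1) := by
  obtain ⟨c, hc, h1, h2⟩ := adaptedCoord_projPi v
  have e : projPi ⟨(projPi v).rep, (projPi v).rep_nonzero⟩ = projPi v :=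
    Projectivization.mk_rep _
  have h3 := dProjPi_apply ⟨(projPi v).rep, (projPi v).rep_nonzero⟩ (A (projPi v).rep)
  rw [e] at h3
  have h4 := dProjPi_apply v (A v.1)
  refine h3.trans (Eq.trans ?_ h4.symm)
  simp only
  rw [h2, adaptedCoord_rep]
  conv_rhs => rw [h1]
  simp [smul_smul, hc]
  rfl

/-- The invertible operator `e^A`. -/
def expUnit (A : V →L[ℂ] V) : (V →L[ℂ] V)ˣ :=
  haveI : CompleteSpace V := FiniteDimensional.complete ℂ V
  letI : NormedAlgebra ℚ (V →L[ℂ] V) := NormedAlgebra.restrictScalars ℚ ℂ (V →L[ℂ] V)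
  (NormedSpace.isUnit_exp A).unit

theorem coe_expUnit (A : V →L[ℂ] V) : (expUnit A : V →L[ℂ] V) = NormedSpace.exp A := rfl

/-- The projective flow `Φ(t, [v]) = [e^{tA} v]`. -/
def projFlow (A : V →L[ℂ] V) (t : ℝ) (p : ℙ ℂ V) : ℙ ℂ V := expUnit (t • A) • p

/-- The height function `f([v]) = -(1/2) (A v | v) / (v | v)`, where `(v | w) = Re ⟨v | w⟩`. -/
def heightFunction (A : V →L[ℂ] V) (p : ℙ ℂ V) : ℝ :=
  -(1 / 2) * ((⟪A p.rep, p.rep⟫_ℂ).re / (⟪p.rep, p.rep⟫_ℂ).re)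

theorem heightFunction_projPi (A : V →L[ℂ] V) (v : PuncturedSpace V) :
    heightFunction A (projPi v) = -(1 / 2) * ((⟪A v.1, v.1⟫_ℂ).re / (⟪v.1, v.1⟫_ℂ).re) := by
  obtain ⟨c, hc, h1, h2⟩ := adaptedCoord_projPi v
  have h : ∀ z : ℂ, ((starRingEnd ℂ) c * (c * z)).re = Complex.normSq c * z.re := by
    intro z
    rw [← mul_assoc, ← Complex.normSq_eq_conj_mul_self, Complex.re_ofReal_mul]
  have hn : Complex.normSq c ≠ 0 := by simpa using hc
  rw [h1]
  simp only [map_smul, inner_smul_left, inner_smul_right, heightFunction]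
  rw [mul_left_comm c, mul_left_comm c, h, h, mul_div_mul_left _ _ hn]

/-- `ξ` is the gradient vector field of `f : ℙ(V) → ℝ` for the real part of the Fubini–Study
metric: `f` is smooth and `df_p(η) = Re ⟨ξ_p | η⟩` for all `p` and `η`. -/
def IsFubiniStudyGradient (f : ℙ ℂ V → ℝ) (ξ : ∀ p : ℙ ℂ V, TangentSpace 𝓘(ℝ, ProjModel V) p) :
    Prop :=
  ContMDiff 𝓘(ℝ, ProjModel V) 𝓘(ℝ, ℝ) ∞ f ∧
    ∀ (p : ℙ ℂ V) (η : TangentSpace 𝓘(ℝ, ProjModel V) p),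
      (mfderiv 𝓘(ℝ, ProjModel V) 𝓘(ℝ, ℝ) f p η : ℝ) = (fubiniStudy p (ξ p) η).re

end ProjectiveDynamics

noncomputable section MorseSmale

variable {E : Type*} [NormedAddCommGroup E] [NormedSpace ℝ E]
  {P : Type*} [TopologicalSpace P] [ChartedSpace E P]

/-- `S ⊆ P` is an embedded smooth submanifold: around each of its points there is a smooth chart
of `P` that maps `S` to a linear subspace. -/
def IsEmbeddedSubmanifold (E : Type*) [NormedAddCommGroup E] [NormedSpace ℝ E]
    {P : Type*} [TopologicalSpace P] [ChartedSpace E P] (S : Set P) : Prop :=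
  ∀ p ∈ S, ∃ e ∈ IsManifold.maximalAtlas 𝓘(ℝ, E) ∞ P, ∃ F : Submodule ℝ E,
    p ∈ e.source ∧ e '' (e.source ∩ S) = e.target ∩ F

/-- The tangent space `T_p S ⊆ T_p P` of a subset `S ⊆ P`: the span of the velocities at `p` of
the smooth curves through `p` that stay in `S`. (If `S` is an embedded submanifold, these
velocities already form the usual tangent space.) -/
def tangentSpaceOf (S : Set P) (p : P) : Submodule ℝ (TangentSpace 𝓘(ℝ, E) p) :=
  Submodule.span ℝ {ξ | ∃ γ : ℝ → P, γ 0 = p ∧ ContMDiffAt 𝓘(ℝ, ℝ) 𝓘(ℝ, E) ∞ γ 0 ∧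
    (∀ᶠ t in 𝓝 (0 : ℝ), γ t ∈ S) ∧ (mfderiv 𝓘(ℝ, ℝ) 𝓘(ℝ, E) γ 0 (1 : ℝ) : E) = ξ}

/-- The submanifolds `A` and `B` of the submanifold `S ⊆ P` intersect transversally in `S`:
both are embedded submanifolds, and `T_z A + T_z B = T_z S` for all `z ∈ A ∩ B`. -/
def IntersectTransversally (E : Type*) [NormedAddCommGroup E] [NormedSpace ℝ E]
    {P : Type*} [TopologicalSpace P] [ChartedSpace E P] (S A B : Set P) : Prop :=
  A ⊆ S ∧ B ⊆ S ∧ IsEmbeddedSubmanifold E A ∧ IsEmbeddedSubmanifold E B ∧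
    ∀ z ∈ A ∩ B, tangentSpaceOf (E := E) A z ⊔ tangentSpaceOf (E := E) B z =
      tangentSpaceOf (E := E) S z

/-- The stable manifold `W⁺(A)` of the flow `Φ`: the points `y` with `d(Φ(t, y), A) → 0` as
`t → ∞`. For compact `A` this convergence means that `Φ(t, y)` tends to the filter of
neighbourhoods of `A`, whichever metric `d` is used. -/
def stableManifold (Φ : ℝ → P → P) (A : Set P) : Set P :=
  {y | Tendsto (fun t => Φ t y) atTop (𝓝ˢ A)}

/-- The unstable manifold `W⁻(A)`: the points `y` with `d(Φ(t, y), A) → 0` as `t → -∞`. -/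
def unstableManifold (Φ : ℝ → P → P) (A : Set P) : Set P :=
  {y | Tendsto (fun t => Φ t y) atBot (𝓝ˢ A)}

/-- The fixed points of the flow in `S`. -/
def fixedPointsIn (Φ : ℝ → P → P) (S : Set P) : Set P := {p ∈ S | ∀ t, Φ t p = p}

/-- The vector field `X` is tangent to `S`. -/
def IsTangentTo (X : ∀ p : P, TangentSpace 𝓘(ℝ, E) p) (S : Set P) : Prop :=
  ∀ p ∈ S, X p ∈ tangentSpaceOf S p

/-- `Φ` is the (global) flow of the vector field `X`. -/
def IsFlowOf (X : ∀ p : P, TangentSpace 𝓘(ℝ, E) p) (Φ : ℝ → P → P) : Prop :=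
  ∀ p, Φ 0 p = p ∧ IsMIntegralCurve (I := 𝓘(ℝ, E)) (fun t => Φ t p) X

/-- `p` is a critical point (singularity) of `X`. -/
def IsCriticalPoint (X : ∀ p : P, TangentSpace 𝓘(ℝ, E) p) (p : P) : Prop := X p = 0

/-- `T > 0` is the minimal period of the non-constant closed orbit of `Φ` through `p`. -/
def HasClosedOrbit (Φ : ℝ → P → P) (p : P) (T : ℝ) : Prop :=
  0 < T ∧ Φ T p = p ∧ ∀ s, 0 < s → s < T → Φ s p ≠ p

/-- The nonwandering set of the flow `Φ` on the invariant set `S`. -/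
def nonwanderingSet (Φ : ℝ → P → P) (S : Set P) : Set P :=
  {p ∈ S | ∀ U ∈ 𝓝 p, ∀ T : ℝ, 0 < T → ∃ t ≥ T, (Φ t '' (U ∩ S) ∩ (U ∩ S)).Nonempty}

/-- The critical elements of `X` in `S`: critical points and closed orbits. -/
def criticalElements (X : ∀ p : P, TangentSpace 𝓘(ℝ, E) p) (Φ : ℝ → P → P) (S : Set P) :
    Set (Set P) :=
  {A | (∃ p ∈ S, IsCriticalPoint X p ∧ A = {p}) ∨
    ∃ p ∈ S, ∃ T, HasClosedOrbit Φ p T ∧ A = range fun t => Φ t p}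

variable [IsManifold 𝓘(ℝ, E) ∞ P]

/-- The derivative at `p` of the vector field `X`, read in a trivialization of the tangent bundle
around `p`. At a critical point `p` of `X` it is the linearization `DX_p : T_p P → T_p P`, which
does not depend on the trivialization. -/
def linearization (X : ∀ p : P, TangentSpace 𝓘(ℝ, E) p) (p : P) :
    TangentSpace 𝓘(ℝ, E) p →L[ℝ] TangentSpace 𝓘(ℝ, E) p :=
  mfderiv 𝓘(ℝ, E) 𝓘(ℝ, E)
    (fun q => (trivializationAt E (TangentSpace 𝓘(ℝ, E)) p ⟨q, X q⟩).2) p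

/-- The complexification `T_p S ⊗ ℂ`. -/
def complexTangentSpaceOf (S : Set P) (p : P) :
    Submodule ℂ (ℂ ⊗[ℝ] TangentSpace 𝓘(ℝ, E) p) :=
  (tangentSpaceOf S p).baseChange ℂ

/-- The critical point `p ∈ S` of a vector field `X` tangent to `S` is hyperbolic in `S`: the
linearization `DX_p : T_p S → T_p S` has no complex eigenvalue with real part zero. -/
def IsHyperbolicCriticalPoint (X : ∀ p : P, TangentSpace 𝓘(ℝ, E) p) (S : Set P) (p : P) : Prop :=
  ∀ (μ : ℂ) (ζ : ℂ ⊗[ℝ] TangentSpace 𝓘(ℝ, E) p), ζ ∈ complexTangentSpaceOf S p → ζ ≠ 0 →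
    (linearization X p).toLinearMap.baseChange ℂ ζ = μ • ζ → μ.re ≠ 0

/-- The derivative `T_p P → T_p P` at `p` of the time-`T` map, for `Φ T p = p`. -/
def monodromy (Φ : ℝ → P → P) (T : ℝ) (p : P) :
    TangentSpace 𝓘(ℝ, E) p →ₗ[ℝ] TangentSpace 𝓘(ℝ, E) p :=
  (mfderiv 𝓘(ℝ, E) 𝓘(ℝ, E) (Φ T) p : E →L[ℝ] E).toLinearMap

/-- The closed orbit of period `T` through `p ∈ S` is hyperbolic in `S`: apart from the simple
eigenvalue `1` in the flow direction `X p`, the monodromy on `T_p S` has no eigenvalue of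
modulus `1` (equivalently, the derivative of the Poincaré map has none). -/
def IsHyperbolicClosedOrbit (X : ∀ p : P, TangentSpace 𝓘(ℝ, E) p) (Φ : ℝ → P → P) (S : Set P)
    (p : P) (T : ℝ) : Prop :=
  ∀ μ : ℂ, ‖μ‖ = 1 → complexTangentSpaceOf S p ⊓
    Module.End.maxGenEigenspace ((monodromy (E := E) Φ T p).baseChange ℂ) μ ≤
      Submodule.span ℂ {(1 : ℂ) ⊗ₜ[ℝ] X p}

/-- The restriction of the smooth vector field `X`, with flow `Φ`, to the compact submanifold
`S ⊆ P` is a Morse–Smale vector field: there are only finitely many critical elements (critical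
points and closed orbits), they are hyperbolic, their unstable and stable manifolds intersect
transversally, and the nonwandering set is the union of the critical elements. -/
structure IsMorseSmaleOn (X : ∀ p : P, TangentSpace 𝓘(ℝ, E) p) (Φ : ℝ → P → P) (S : Set P) :
    Prop where
  smooth : ContMDiff 𝓘(ℝ, E) 𝓘(ℝ, E).tangent ∞
    (fun p => (⟨p, X p⟩ : TangentBundle 𝓘(ℝ, E) P))
  isFlow : IsFlowOf X Φ
  isCompact : IsCompact S
  isSubmanifold : IsEmbeddedSubmanifold E S
  tangent : IsTangentTo X S
  invariant : ∀ t, ∀ p ∈ S, Φ t p ∈ S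
  finite : (criticalElements X Φ S).Finite
  hyperbolicPoint : ∀ p ∈ S, IsCriticalPoint X p → IsHyperbolicCriticalPoint X S p
  hyperbolicOrbit : ∀ p ∈ S, ∀ T, HasClosedOrbit Φ p T → IsHyperbolicClosedOrbit X Φ S p T
  transversal : ∀ A ∈ criticalElements X Φ S, ∀ B ∈ criticalElements X Φ S,
    IntersectTransversally E S (unstableManifold Φ A ∩ S) (stableManifold Φ B ∩ S)
  nonwandering : nonwanderingSet Φ S = ⋃₀ criticalElements X Φ S

end MorseSmale

noncomputable section LieData

variable {V : Type*} [NormedAddCommGroup V] [InnerProductSpace ℂ V] [CompleteSpace V]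

/-- The Lie algebra `{Y | e^{ℝY} ⊆ G}` of a subgroup `G` of `GL(V)`. -/
def lieAlgebraOf (G : Subgroup (V →L[ℂ] V)ˣ) : Set (V →L[ℂ] V) :=
  {Y | ∀ t : ℝ, ∃ g ∈ G, (g : V →L[ℂ] V) = NormedSpace.exp (t • Y)}

/-- The Cartan involution `θ(g) = (g⁻¹)ᵗ` on `GL(V)`, where `ᵗ` is the adjoint with respect to
the inner product. -/
def cartanInvolution (g : (V →L[ℂ] V)ˣ) : (V →L[ℂ] V)ˣ := star g⁻¹

/-- The `-1`-eigenspace `𝔭` of the Cartan involution `Y ↦ -Yᵗ` on a Lie algebra `𝔤`. -/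
def cartanP (𝔤 : Submodule ℂ (V →L[ℂ] V)) : Set (V →L[ℂ] V) := {Y ∈ 𝔤 | star Y = Y}

/-- `𝔞` is a maximal abelian subspace of `𝔭`. -/
def IsMaximalAbelianIn (𝔭 : Set (V →L[ℂ] V)) (𝔞 : Submodule ℝ (V →L[ℂ] V)) : Prop :=
  Maximal (fun 𝔟 : Submodule ℝ (V →L[ℂ] V) =>
    (𝔟 : Set (V →L[ℂ] V)) ⊆ 𝔭 ∧ ∀ Y ∈ 𝔟, ∀ Z ∈ 𝔟, ⁅Y, Z⁆ = 0) 𝔞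

/-- The set `𝒫 ⊆ 𝔞*` of weights: functionals `μ` with `V^μ ≠ 0`. -/
def weights (𝔞 : Submodule ℝ (V →L[ℂ] V)) : Set (Module.Dual ℝ 𝔞) :=
  {μ | ∃ v : V, v ≠ 0 ∧ ∀ H : 𝔞, (H : V →L[ℂ] V) v = μ H • v}

/-- The set `Δ ⊆ 𝔞*` of restricted roots: functionals `α ≠ 0` with `𝔤^α ≠ 0`. -/
def restrictedRoots (𝔤 : Submodule ℂ (V →L[ℂ] V)) (𝔞 : Submodule ℝ (V →L[ℂ] V)) :
    Set (Module.Dual ℝ 𝔞) :=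
  {α | α ≠ 0 ∧ ∃ Y ∈ 𝔤, Y ≠ 0 ∧ ∀ H : 𝔞, ⁅(H : V →L[ℂ] V), Y⁆ = α H • Y}

/-- The positive roots `Δ⁺` with respect to a regular element `X₀ ∈ 𝔞`. -/
def positiveRoots (𝔤 : Submodule ℂ (V →L[ℂ] V)) (𝔞 : Submodule ℝ (V →L[ℂ] V)) (X₀ : 𝔞) :
    Set (Module.Dual ℝ 𝔞) :=
  {α ∈ restrictedRoots 𝔤 𝔞 | 0 < α X₀}

/-- The flow of `X ∈ 𝔞` is special: positive roots are negative on `X`, and `X` separates the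
weights. -/
def IsSpecial (𝔤 : Submodule ℂ (V →L[ℂ] V)) (𝔞 : Submodule ℝ (V →L[ℂ] V)) (X₀ X : 𝔞) : Prop :=
  (∀ α ∈ positiveRoots 𝔤 𝔞 X₀, α X < 0) ∧
    ∀ μ ∈ weights 𝔞, ∀ ν ∈ weights 𝔞, μ ≠ ν → μ X ≠ ν X

end LieData

/-! Everything is read off from the action of `X` on `V` and of `ad X` on `𝔤`. As `X` is
self-adjoint, `V` is the orthogonal sum of its real eigenspaces, and `𝔤 = 𝔤₀ + 𝔤₋ + 𝔤₊` according to
the sign of the eigenvalues of `ad X` (`adSubspace_decomposition`); `𝔤₋` lowers and `𝔤₊` raises the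
eigenvalues of `X` on `V`. The flow drives a line to its component of largest eigenvalue, so the
critical points are the eigenlines, and `W⁺([v])` consists of the lines through `v` plus lower terms
(`projPi_mem_stableManifold_iff`).

The special choice of `X` enters through one fact: `𝔤₀` acts by scalars on every eigenspace of `X`
(`exists_scalar_of_commute`). Since `X` separates the weights, `𝔞` acts by scalars there; a
self-adjoint element of `𝔤` that commutes with `X` therefore commutes with `𝔞` and lies in `𝔞` by
maximality; stability under the Cartan involution and the complex structure of `𝔤` write each
element of `𝔤₀` as a combination of two such elements. `IsFlagFlow` packages this fact. It is
symmetric under `X ↦ -X`, so unstable manifolds are treated as stable manifolds of `-X`.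

Hence `𝔤₀` fixes every eigenline `[v]`, and near a critical point the orbit consists of the points
`exp(Y) exp(Z) [v]` with `Y ∈ 𝔤₋`, `Z ∈ 𝔤₊`; the points `exp(Y) [v]` form the stable manifold
(`closedOrbit_local_structure`). The group moves every point of `ℳ` to a critical point and the flow
moves every point of a stable manifold close to its limit, so these charts spread everywhere, and
`T_z ℳ = 𝔤 · z`. Transversality needs no dimension count: at a common point `z`, `𝔤₀ + 𝔤₋` is
tangent to `W⁺` and `𝔤₊` to `W⁻` (`intersectTransversally`).

For hyperbolicity at `[v]` with `X v = a v`, the linearization has eigenvalue `b - a` on the image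
of the `b`-eigenvectors, and `T ℳ` comes from `𝔤₋ v` and `𝔤₊ v`, where `b ≠ a`. Finally `-X` is a
gradient, so the height strictly decreases off the critical points; this excludes closed orbits and
further nonwandering points. Critical points are isolated in the compact `ℳ`, hence finite in
number. -/

/-! ### Topology of `ℙ(V)`: continuous action, Hausdorff, compact. -/

section ProjectiveTopology

variable {V : Type*} [NormedAddCommGroup V] [InnerProductSpace ℂ V]

theorem smul_projPi (g : (V →L[ℂ] V)ˣ) (v : PuncturedSpace V) :
    g • projPi v = projPi ⟨(g : V →L[ℂ] V) v.1, (smul_ne_zero_iff_ne g).2 v.2⟩ := rfl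

theorem units_apply_ne_zero (g : (V →L[ℂ] V)ˣ) {v : V} (hv : v ≠ 0) :
    (g : V →L[ℂ] V) v ≠ 0 := (smul_ne_zero_iff_ne g).2 hv

theorem continuous_projPi : Continuous (projPi (V := V)) := isQuotientMap_projPi.continuous

/-- The saturation of an open set is the union of its translates by nonzero scalars. -/
theorem isOpenMap_projPi : IsOpenMap (projPi (V := V)) := by
  intro U hU
  rw [← isQuotientMap_projPi.isOpen_preimage]
  have hne (c : ℂˣ) (v : PuncturedSpace V) : c • v.1 ≠ 0 := (smul_ne_zero_iff_ne c).2 v.2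
  have : projPi ⁻¹' (projPi '' U) =
      ⋃ c : ℂˣ, (fun v : PuncturedSpace V => (⟨c • v.1, hne c v⟩ : PuncturedSpace V)) ⁻¹' U := by
    ext v
    simp only [mem_preimage, mem_image, mem_iUnion]
    constructor
    · rintro ⟨w, hw, h⟩
      obtain ⟨c, hc, h⟩ := exists_smul_of_projPi_eq h
      refine ⟨Units.mk0 c hc, ?_⟩
      convert hw using 1
      exact Subtype.ext h.symm
    · rintro ⟨c, hc⟩
      exact ⟨_, hc, projPi_eq_of_smul (c := c) rfl⟩
  rw [this]
  refine isOpen_iUnion fun c => hU.preimage ?_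
  exact Continuous.subtype_mk (by fun_prop) _

theorem isOpenQuotientMap_projPi : IsOpenQuotientMap (projPi (V := V)) :=
  ⟨projPi_surjective, continuous_projPi, isOpenMap_projPi⟩

/-- Continuity is checked upstairs on `GL(V) × (V ∖ {0})`. Openness of `π` matters: products of open
quotient maps are again quotient maps. -/
instance projContinuousSMul : ContinuousSMul (V →L[ℂ] V)ˣ (ℙ ℂ V) where
  continuous_smul := by
    have hq : IsOpenQuotientMap
        (Prod.map (id : (V →L[ℂ] V)ˣ → (V →L[ℂ] V)ˣ) (projPi (V := V))) :=
      IsOpenQuotientMap.id.prodMap isOpenQuotientMap_projPi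
    rw [← hq.isQuotientMap.continuous_iff.symm]
    have : (fun q : (V →L[ℂ] V)ˣ × ℙ ℂ V => q.1 • q.2) ∘ Prod.map id projPi =
        fun q : (V →L[ℂ] V)ˣ × PuncturedSpace V =>
          projPi ⟨(q.1 : V →L[ℂ] V) q.2.1, units_apply_ne_zero q.1 q.2.2⟩ := rfl
    rw [this]
    refine continuous_projPi.comp (Continuous.subtype_mk ?_ _)
    exact (Units.continuous_val.comp continuous_fst).clm_apply
      (continuous_subtype_val.comp continuous_snd)

/-- The Cauchy–Schwarz quotient `|⟨v, x⟩| / (‖v‖ ‖x‖)` is a continuous function of `[x]` that takes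
the value `1` only at `[v]`, so it separates `[v]` from every other point. -/
instance projT2Space : T2Space (ℙ ℂ V) := by
  refine ⟨fun p q hpq => ?_⟩
  obtain ⟨v, rfl⟩ := projPi_surjective p
  obtain ⟨w, rfl⟩ := projPi_surjective q
  have hF (x : PuncturedSpace V) : ‖x.1‖ ≠ 0 := norm_ne_zero_iff.2 x.2
  have hc : Continuous fun x : PuncturedSpace V => ‖⟪v.1, x.1⟫_ℂ‖ / (‖v.1‖ * ‖x.1‖) := by
    refine Continuous.div ?_ ?_ fun x => mul_ne_zero (hF v) (hF x)
    · fun_prop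
    · fun_prop
  let f : ℙ ℂ V → ℝ := fun p => ‖⟪v.1, p.rep⟫_ℂ‖ / (‖v.1‖ * ‖p.rep‖)
  have hf : ∀ x : PuncturedSpace V, f (projPi x) = ‖⟪v.1, x.1⟫_ℂ‖ / (‖v.1‖ * ‖x.1‖) := by
    intro x
    obtain ⟨c, hc, h⟩ := exists_smul_of_projPi_eq
      (v := ⟨(projPi x).rep, (projPi x).rep_nonzero⟩) (w := x) (Projectivization.mk_rep _)
    simp only at h
    simp only [f, h, inner_smul_right, norm_smul, norm_mul]
    rw [mul_left_comm, mul_div_mul_left _ _ (norm_ne_zero_iff.2 hc)]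
  have hfc : Continuous f := by
    rw [isQuotientMap_projPi.continuous_iff]
    exact hc.congr fun x => (hf x).symm
  refine separated_by_continuous hfc ?_
  rw [hf, hf]
  intro h
  apply hpq
  have hvv : ‖⟪v.1, v.1⟫_ℂ‖ = ‖v.1‖ * ‖v.1‖ := by
    rw [inner_self_eq_norm_sq_to_K]
    simp [sq]
  rw [hvv, div_self (mul_ne_zero (hF v) (hF v)), eq_comm,
    div_eq_one_iff_eq (mul_ne_zero (hF v) (hF w))] at h
  obtain ⟨r, hr, h⟩ := (norm_inner_eq_norm_iff v.2 w.2).1 h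
  exact (projPi_eq_of_smul h).symm

instance projCompactSpace [FiniteDimensional ℂ V] : CompactSpace (ℙ ℂ V) := by
  have : ProperSpace V := FiniteDimensional.proper ℂ V
  have hne (x : Metric.sphere (0 : V) 1) : x.1 ≠ 0 := by
    rintro h
    simpa [h] using x.2
  have hs : Function.Surjective
      fun x : Metric.sphere (0 : V) 1 => projPi (⟨x.1, hne x⟩ : PuncturedSpace V) := by
    intro p
    obtain ⟨v, rfl⟩ := projPi_surjective p
    have hv : (‖v.1‖ : ℂ) ≠ 0 := by exact_mod_cast norm_ne_zero_iff.2 v.2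
    refine ⟨⟨(‖v.1‖ : ℂ)⁻¹ • v.1, ?_⟩, projPi_eq_of_smul rfl⟩
    simp [norm_smul, norm_ne_zero_iff.2 v.2]
  exact hs.compactSpace (continuous_projPi.comp (Continuous.subtype_mk continuous_subtype_val _))

end ProjectiveTopology

/-! ### Calculus in affine charts; lifting curves from `ℙ(V)` to `V`. -/

noncomputable section AffineCoordinates

variable {V : Type*} [NormedAddCommGroup V] [InnerProductSpace ℂ V]

/-- Affine coordinates as a function on `V`: `v ↦ (T v).2 / (T v).1`. -/
def affineFun (T : V ≃L[ℂ] ℂ × ProjModel V) (v : V) : ProjModel V := (T v).1⁻¹ • (T v).2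

/-- The derivative of the affine coordinates at `v`. -/
def affineDeriv (T : V ≃L[ℂ] ℂ × ProjModel V) (v : V) : V →L[ℝ] ProjModel V :=
  ((T v).1⁻¹ • (((ContinuousLinearMap.snd ℂ ℂ (ProjModel V)).comp T.toContinuousLinearMap) -
    ((ContinuousLinearMap.fst ℂ ℂ (ProjModel V)).comp
      T.toContinuousLinearMap).smulRight (affineFun T v))).restrictScalars ℝ

theorem affineDeriv_apply (T : V ≃L[ℂ] ℂ × ProjModel V) (v u : V) :
    affineDeriv T v u = (T v).1⁻¹ • ((T u).2 - (T u).1 • affineFun T v) := rfl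

theorem contDiffAt_affineFun (T : V ≃L[ℂ] ℂ × ProjModel V) {v : V} (hv : (T v).1 ≠ 0)
    {n : WithTop ℕ∞} : ContDiffAt ℝ n (affineFun T) v := by
  have hT : ContDiff ℝ n T := (T.toContinuousLinearMap.restrictScalars ℝ).contDiff
  exact (hT.fst.contDiffAt.inv hv).smul hT.snd.contDiffAt

theorem hasFDerivAt_affineFun (T : V ≃L[ℂ] ℂ × ProjModel V) {v : V} (hv : (T v).1 ≠ 0) :
    HasFDerivAt (affineFun T) (affineDeriv T v) v := by
  have hT : HasFDerivAt (fun y : V => T y) (T.toContinuousLinearMap.restrictScalars ℝ) v :=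
    (T.toContinuousLinearMap.restrictScalars ℝ).hasFDerivAt
  have hinv := (hasFDerivAt_inv' (𝕜 := ℝ) hv).comp v hT.fst
  refine (hinv.smul hT.snd).congr_fderiv ?_
  ext1 u
  simp [affineDeriv_apply, affineFun, smul_smul, sub_eq_add_neg]
  ring_nf

theorem affineFun_symm (T : V ≃L[ℂ] ℂ × ProjModel V) (e : ProjModel V) :
    affineFun T (T.symm (1, e)) = e := by
  simp [affineFun]

theorem affineCoord_eq_affineFun (T : V ≃L[ℂ] ℂ × ProjModel V) {v : V} (hv : v ≠ 0) :
    affineCoord T (projPi ⟨v, hv⟩) = affineFun T v := affineCoord_projPi T ⟨v, hv⟩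

theorem mem_affineChart_source (T : V ≃L[ℂ] ℂ × ProjModel V) {v : V} (hv : v ≠ 0) :
    projPi ⟨v, hv⟩ ∈ (affineChart T).source ↔ (T v).1 ≠ 0 :=
  fst_rep_projPi_ne_zero_iff T ⟨v, hv⟩

theorem symm_one_ne_zero (T : V ≃L[ℂ] ℂ × ProjModel V) (e : ProjModel V) :
    T.symm (1, e) ≠ 0 := by simp

theorem affineInv_affineCoord (T : V ≃L[ℂ] ℂ × ProjModel V) {p : ℙ ℂ V}
    (hp : p ∈ (affineChart T).source) :
    projPi ⟨T.symm (1, affineCoord T p), symm_one_ne_zero T _⟩ = p :=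
  (affineChart T).left_inv hp

variable [FiniteDimensional ℂ V]

theorem chartAt_projPi_source (p : ℙ ℂ V) : p ∈ (affineChart (adaptedCoord p)).source :=
  mem_chart_source (ProjModel V) p

theorem adaptedCoord_fst_ne_zero (v : PuncturedSpace V) :
    (adaptedCoord (projPi v) v.1).1 ≠ 0 := by
  obtain ⟨c, hc, -, h⟩ := adaptedCoord_projPi v
  rw [h]
  exact hc

/-- The preferred chart at `[v]` is centred at `[v]`; this is why the correction term of the
quotient rule disappears from `dπ_v`. -/
theorem affineFun_adaptedCoord (v : PuncturedSpace V) :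
    affineFun (adaptedCoord (projPi v)) v.1 = 0 := by
  obtain ⟨c, hc, -, h⟩ := adaptedCoord_projPi v
  simp [affineFun, h]

theorem dProjPi_eq_affineDeriv (v : PuncturedSpace V) (u : V) :
    (dProjPi v u : ProjModel V) = affineDeriv (adaptedCoord (projPi v)) v.1 u := by
  rw [dProjPi_apply, affineDeriv_apply, affineFun_adaptedCoord, smul_zero, sub_zero]

theorem dProjPi_eq_zero_iff (v : PuncturedSpace V) (u : V) :
    dProjPi v u = 0 ↔ ∃ c : ℂ, u = c • v.1 := by
  constructor
  · intro h
    obtain ⟨c, hc, -, h2⟩ := adaptedCoord_projPi v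
    have h1 := (dProjPi_apply v u).symm.trans h
    have h0 : (adaptedCoord (projPi v) u).2 = 0 :=
      (smul_eq_zero.1 h1).resolve_left (inv_ne_zero (adaptedCoord_fst_ne_zero v))
    refine ⟨(adaptedCoord (projPi v) u).1 / c, ?_⟩
    apply (adaptedCoord (projPi v)).injective
    rw [map_smul, h2]
    ext1
    · simp [hc]
    · simp [h0]
  · rintro ⟨c, rfl⟩
    exact dProjPi_self_smul v c

theorem chart_mem_atlas_affine (T : V ≃L[ℂ] ℂ × ProjModel V) :
    affineChart T ∈ atlas (ProjModel V) (ℙ ℂ V) := mem_range_self T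

theorem affineChart_mem_maximalAtlas (T : V ≃L[ℂ] ℂ × ProjModel V) :
    affineChart T ∈ IsManifold.maximalAtlas 𝓘(ℝ, ProjModel V) ∞ (ℙ ℂ V) :=
  IsManifold.subset_maximalAtlas (chart_mem_atlas_affine T)

variable {E : Type*} [NormedAddCommGroup E] [NormedSpace ℝ E]

omit [FiniteDimensional ℂ V] [NormedSpace ℝ E] in
theorem continuousAt_projPi_comp {γ : E → V} (hne : ∀ x, γ x ≠ 0) {x : E}
    (h : ContinuousAt γ x) : ContinuousAt (fun x => projPi ⟨γ x, hne x⟩) x :=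
  continuous_projPi.continuousAt.comp
    (Topology.IsInducing.subtypeVal.continuousAt_iff.2 h)

theorem hasMFDerivAt_projPi_comp {γ : E → V} (hne : ∀ x, γ x ≠ 0) {x : E} {γ' : E →L[ℝ] V}
    (h : HasFDerivAt γ γ' x) :
    HasMFDerivAt 𝓘(ℝ, E) 𝓘(ℝ, ProjModel V) (fun x => projPi ⟨γ x, hne x⟩) x
      ((dProjPi ⟨γ x, hne x⟩).comp γ') := by
  refine ⟨continuousAt_projPi_comp hne h.continuousAt, ?_⟩
  apply HasFDerivAt.hasFDerivWithinAt
  change HasFDerivAt (fun y => affineCoord (adaptedCoord (projPi ⟨γ x, hne x⟩))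
    (projPi ⟨γ y, hne y⟩)) _ x
  simp only [affineCoord_eq_affineFun]
  refine ((hasFDerivAt_affineFun _
    (adaptedCoord_fst_ne_zero ⟨γ x, hne x⟩)).comp x h).congr_fderiv ?_
  ext1 u
  exact (dProjPi_eq_affineDeriv ⟨γ x, hne x⟩ (γ' u)).symm

theorem contMDiffAt_projPi_comp {γ : E → V} (hne : ∀ x, γ x ≠ 0) {x : E} {n : ℕ∞}
    (h : ContDiffAt ℝ n γ x) :
    ContMDiffAt 𝓘(ℝ, E) 𝓘(ℝ, ProjModel V) n (fun x => projPi ⟨γ x, hne x⟩) x := by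
  rw [contMDiffAt_iff]
  refine ⟨continuousAt_projPi_comp hne h.continuousAt, ?_⟩
  apply ContDiffAt.contDiffWithinAt
  change ContDiffAt ℝ n (fun y => affineCoord (adaptedCoord (projPi ⟨γ x, hne x⟩))
    (projPi ⟨γ y, hne y⟩)) x
  simp only [affineCoord_eq_affineFun]
  exact (contDiffAt_affineFun _ (adaptedCoord_fst_ne_zero ⟨γ x, hne x⟩)).comp x h

/-- A differentiable curve in `ℙ(V)` lifts locally to a differentiable curve in `V`. -/
theorem exists_lift_curve {γ : ℝ → ℙ ℂ V} {v : PuncturedSpace V} (h0 : γ 0 = projPi v)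
    (h : MDifferentiableAt 𝓘(ℝ, ℝ) 𝓘(ℝ, ProjModel V) γ 0) :
    ∃ (w : ℝ → V) (w' : V) (hne : ∀ t, w t ≠ 0), HasDerivAt w w' 0 ∧
      (∀ᶠ t in 𝓝 0, γ t = projPi ⟨w t, hne t⟩) ∧ w 0 = v.1 ∧
      (mfderiv 𝓘(ℝ, ℝ) 𝓘(ℝ, ProjModel V) γ 0 (1 : ℝ) : ProjModel V) = dProjPi v w' := by
  set T := adaptedCoord (γ 0) with hT
  have hTv : (T v.1).1 ≠ 0 := by
    have := adaptedCoord_fst_ne_zero v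
    rwa [← h0] at this
  let c := (T v.1).1
  have hκ : HasDerivAt (fun t => affineCoord T (γ t))
      (mfderiv 𝓘(ℝ, ℝ) 𝓘(ℝ, ProjModel V) γ 0 (1 : ℝ) : ProjModel V) 0 := by
    let D : ℝ →L[ℝ] ProjModel V := mfderiv 𝓘(ℝ, ℝ) 𝓘(ℝ, ProjModel V) γ 0
    have h1 : HasFDerivAt (fun t => affineCoord T (γ t)) D 0 :=
      h.hasMFDerivAt.2.hasFDerivAt (by simp)
    exact h1.hasDerivAt
  -- The affine chart provides the lift with first coordinate `1`; the factor `c` rescales it to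
  -- start at `v` itself and not at a multiple of `v`.
  let w : ℝ → V := fun t => c • T.symm (1, affineCoord T (γ t))
  have hne : ∀ t, w t ≠ 0 := fun t => smul_ne_zero hTv (symm_one_ne_zero T _)
  set ξ : ProjModel V := (mfderiv 𝓘(ℝ, ℝ) 𝓘(ℝ, ProjModel V) γ 0 (1 : ℝ) : ProjModel V)
  have hw : HasDerivAt w (c • T.symm (0, ξ)) 0 := by
    have h1 : HasDerivAt (fun t => ((1 : ℂ), affineCoord T (γ t))) (0, ξ) 0 :=
      (hasDerivAt_const _ _).prodMk hκ
    have h2 := (T.symm.toContinuousLinearMap.restrictScalars ℝ).hasFDerivAt.comp_hasDerivAt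
      (0 : ℝ) h1
    exact h2.const_smul c
  have hev : ∀ᶠ t in 𝓝 0, γ t = projPi ⟨w t, hne t⟩ := by
    have hs : ∀ᶠ t in 𝓝 0, γ t ∈ (affineChart T).source :=
      h.continuousAt.eventually ((affineChart T).open_source.mem_nhds (chartAt_projPi_source _))
    filter_upwards [hs] with t ht
    conv_lhs => rw [← affineInv_affineCoord T ht]
    exact (projPi_eq_of_smul (c := c) rfl).symm
  have hw0 : w 0 = v.1 := by
    simp only [w]
    have : affineCoord T (γ 0) = affineFun T v.1 := by rw [h0, affineCoord_projPi, affineFun]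
    rw [this, ← map_smul, ContinuousLinearEquiv.symm_apply_eq]
    ext1
    · simp [c]
    · simp [c, affineFun, hTv]
  refine ⟨w, _, hne, hw, hev, hw0, ?_⟩
  rw [dProjPi_apply]
  rw [← h0, ← hT]
  simp [c, hTv]
  rfl

end AffineCoordinates

/-! ### The vector field of a linear map in charts: smoothness, zeros, linearization. -/

noncomputable section ProjectiveField

variable {V : Type*} [NormedAddCommGroup V] [InnerProductSpace ℂ V]

theorem affineDeriv_smul_smul (T : V ≃L[ℂ] ℂ × ProjModel V) (v u : V) {c : ℂ} (hc : c ≠ 0) :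
    affineDeriv T (c • v) (c • u) = affineDeriv T v u := by
  have h : affineFun T (c • v) = affineFun T v := by
    simp only [affineFun, map_smul, Prod.smul_fst, Prod.smul_snd, smul_smul, smul_eq_mul, mul_inv]
    congr 1
    field_simp
  rw [affineDeriv_apply, affineDeriv_apply, h]
  simp only [map_smul, Prod.smul_fst, Prod.smul_snd, smul_eq_mul, mul_inv, mul_smul, ← smul_sub]
  rw [smul_comm, inv_smul_smul₀ hc]

theorem affineDeriv_self (T : V ≃L[ℂ] ℂ × ProjModel V) {v : V} (hv : (T v).1 ≠ 0) (c : ℂ) :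
    affineDeriv T v (c • v) = 0 := by
  rw [affineDeriv_apply]
  simp [affineFun, smul_smul, hv]

theorem hasFDerivAt_symm_one (T : V ≃L[ℂ] ℂ × ProjModel V) (e : ProjModel V) :
    HasFDerivAt (fun e : ProjModel V => T.symm (1, e))
      ((T.symm.toContinuousLinearMap.comp
        (ContinuousLinearMap.inr ℂ ℂ (ProjModel V))).restrictScalars ℝ) e := by
  let L := (T.symm.toContinuousLinearMap.comp
    (ContinuousLinearMap.inr ℂ ℂ (ProjModel V))).restrictScalars ℝ
  have h : (fun e : ProjModel V => T.symm (1, e)) = fun e => T.symm (1, 0) + L e := by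
    ext1 x
    change _ = T.symm (1, 0) + T.symm (0, x)
    rw [← map_add]
    simp
  rw [h]
  exact L.hasFDerivAt.const_add _

variable [FiniteDimensional ℂ V]

/-- Adapted coordinates send `v` to the first axis, so deleting the first coordinate of `u`
subtracts a multiple of `v`, which `dπ_v` does not see. -/
theorem adaptedCoord_symm_fst_zero (v : PuncturedSpace V) (u : V) :
    ∃ a : ℂ, (adaptedCoord (projPi v)).symm (0, (adaptedCoord (projPi v) u).2) = u - a • v.1 := by
  obtain ⟨c, hc, -, h2⟩ := adaptedCoord_projPi v
  refine ⟨(adaptedCoord (projPi v) u).1 / c, ?_⟩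
  rw [ContinuousLinearEquiv.symm_apply_eq, map_sub, map_smul, h2]
  ext1
  · simp [hc]
  · simp

/-- `dProjPi` is expressed in the chart adapted to `[v]`, the trivialization in the chart adapted to
`p`. The chain rule for the transition map compares them, and homogeneity of `affineDeriv` removes
the choice of representatives. -/
theorem trivializationAt_dProjPi (p : ℙ ℂ V) (v : PuncturedSpace V)
    (hv : (adaptedCoord p v.1).1 ≠ 0) (u : V) :
    (trivializationAt (ProjModel V) (TangentSpace 𝓘(ℝ, ProjModel V)) p
      ⟨projPi v, dProjPi v u⟩).2 = affineDeriv (adaptedCoord p) v.1 u := by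
  rw [TangentBundle.trivializationAt_apply]
  set T := adaptedCoord p
  obtain ⟨c, hc, h1, h2⟩ := adaptedCoord_projPi v
  obtain ⟨a, ha⟩ := adaptedCoord_symm_fst_zero v u
  set S := adaptedCoord (projPi v) with hS
  have hS0 : affineCoord S (projPi v) = 0 := by
    rw [affineCoord_projPi]; exact affineFun_adaptedCoord v
  have hb : S.symm (1, (0 : ProjModel V)) = c⁻¹ • v.1 := by
    rw [ContinuousLinearEquiv.symm_apply_eq, map_smul, h2]
    ext1 <;> simp [hc]
  change (fderivWithin ℝ (fun e => affineCoord T (projPi ⟨S.symm (1, e), symm_one_ne_zero S e⟩))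
    (range id) (affineCoord S (projPi v))) (dProjPi v u : ProjModel V) = _
  simp only [affineCoord_eq_affineFun]
  rw [range_id, fderivWithin_univ, hS0]
  have hd : HasFDerivAt (fun e => affineFun T (S.symm (1, e)))
      ((affineDeriv T (S.symm (1, (0 : ProjModel V)))).comp
        ((S.symm.toContinuousLinearMap.comp
          (ContinuousLinearMap.inr ℂ ℂ (ProjModel V))).restrictScalars ℝ)) (0 : ProjModel V) := by
    have hT : (T (S.symm (1, (0 : ProjModel V)))).1 ≠ 0 := by
      rw [hb, map_smul]
      simpa [hc] using hv
    exact (hasFDerivAt_affineFun T hT).comp (0 : ProjModel V) (hasFDerivAt_symm_one S 0)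
  rw [hd.fderiv]
  have h4 : (dProjPi v u : ProjModel V) = c⁻¹ • (S u).2 := by
    rw [dProjPi_apply, h2]
  change affineDeriv T (S.symm (1, (0 : ProjModel V))) (S.symm (0, dProjPi v u)) = _
  have h5 : S.symm (0, (dProjPi v u : ProjModel V)) = c⁻¹ • (u - a • v.1) := by
    rw [h4, ← ha, ← map_smul]
    simp
  rw [h5, hb, affineDeriv_smul_smul _ _ _ (inv_ne_zero hc), map_sub, affineDeriv_self T hv,
    sub_zero]

/-- The local expression of `projField A` in affine coordinates. -/
def affineField (A : V →L[ℂ] V) (T : V ≃L[ℂ] ℂ × ProjModel V) (e : ProjModel V) : ProjModel V :=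
  (T (A (T.symm (1, e)))).2 - (T (A (T.symm (1, e)))).1 • e

theorem trivializationAt_projField (A : V →L[ℂ] V) (p : ℙ ℂ V) {q : ℙ ℂ V}
    (hq : q ∈ (affineChart (adaptedCoord p)).source) :
    (trivializationAt (ProjModel V) (TangentSpace 𝓘(ℝ, ProjModel V)) p ⟨q, projField A q⟩).2 =
      affineField A (adaptedCoord p) (affineCoord (adaptedCoord p) q) := by
  set T := adaptedCoord p with hT
  obtain ⟨e, rfl⟩ : ∃ e, q = projPi ⟨T.symm (1, e), symm_one_ne_zero T e⟩ :=
    ⟨_, (affineInv_affineCoord T hq).symm⟩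
  rw [projField_projPi, trivializationAt_dProjPi, affineCoord_eq_affineFun, affineFun_symm,
    affineDeriv_apply, ← hT, affineFun_symm]
  · simp [affineField]
  · simp [← hT]

omit [FiniteDimensional ℂ V] in
theorem contDiff_affineField (A : V →L[ℂ] V) (T : V ≃L[ℂ] ℂ × ProjModel V) {n : WithTop ℕ∞} :
    ContDiff ℝ n (affineField A T) := by
  have h : ContDiff ℝ n (fun e : ProjModel V => T (A (T.symm (1, e)))) :=
    ((T.toContinuousLinearMap.comp (A.comp
      T.symm.toContinuousLinearMap)).restrictScalars ℝ).contDiff.comp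
      (contDiff_const.prodMk contDiff_id)
  exact h.snd.sub (h.fst.smul contDiff_id)

theorem affineCoord_self (p : ℙ ℂ V) : affineCoord (adaptedCoord p) p = 0 := by
  obtain ⟨v, rfl⟩ := projPi_surjective p
  rw [affineCoord_projPi]
  exact affineFun_adaptedCoord v

theorem contMDiffAt_of_affine {F : Type*} [NormedAddCommGroup F] [NormedSpace ℝ F]
    {f : ℙ ℂ V → F} {p : ℙ ℂ V} {n : ℕ∞} {g : ProjModel V → F} (hg : ContDiffAt ℝ n g 0)
    (h : ∀ q ∈ (affineChart (adaptedCoord p)).source, f q = g (affineCoord (adaptedCoord p) q)) :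
    ContMDiffAt 𝓘(ℝ, ProjModel V) 𝓘(ℝ, F) n f p := by
  have hp := (affineChart (adaptedCoord p)).open_source.mem_nhds (chartAt_projPi_source p)
  have hn : (n : WithTop ℕ∞) ≤ ∞ := by exact_mod_cast le_top
  have h1 : ContMDiffAt 𝓘(ℝ, ProjModel V) 𝓘(ℝ, ProjModel V) n (affineCoord (adaptedCoord p)) p :=
    (contMDiffAt_of_mem_maximalAtlas (affineChart_mem_maximalAtlas _)
      (chartAt_projPi_source p)).of_le hn
  have h2 : ContMDiffAt 𝓘(ℝ, ProjModel V) 𝓘(ℝ, F) n (g ∘ affineCoord (adaptedCoord p)) p := by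
    refine ContMDiffAt.comp p ?_ h1
    rw [affineCoord_self]
    exact hg.contMDiffAt
  exact h2.congr_of_eventuallyEq (eventually_of_mem hp h)

theorem contMDiff_projField (A : V →L[ℂ] V) :
    ContMDiff 𝓘(ℝ, ProjModel V) 𝓘(ℝ, ProjModel V).tangent ∞
      (fun p => (⟨p, projField A p⟩ : TangentBundle 𝓘(ℝ, ProjModel V) (ℙ ℂ V))) := by
  intro p
  rw [Bundle.contMDiffAt_section]
  exact contMDiffAt_of_affine (n := ⊤) (contDiff_affineField A _).contDiffAt
    fun q hq => trivializationAt_projField A p hq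

theorem isCriticalPoint_iff (A : V →L[ℂ] V) (v : PuncturedSpace V) :
    IsCriticalPoint (projField A) (projPi v) ↔ ∃ c : ℂ, A v.1 = c • v.1 := by
  rw [IsCriticalPoint, projField_projPi, dProjPi_eq_zero_iff]

/-- Up to the line of `v`, the linearization is `A - c` acting on `V / ℂv`. In the chart centred at
`[v]` the field is `e ↦ (T A T⁻¹ (1, e)).2 - (T A T⁻¹ (1, e)).1 • e`, and at `e = 0` the second term
contributes only `-c • e` to the derivative. -/
theorem linearization_dProjPi (A : V →L[ℂ] V) (v : PuncturedSpace V) {c : ℂ}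
    (hv : A v.1 = c • v.1) (u : V) :
    linearization (projField A) (projPi v) (dProjPi v u) = dProjPi v (A u - c • u) := by
  set p := projPi v with hp
  obtain ⟨b, hb, h1, h2⟩ := adaptedCoord_projPi v
  obtain ⟨a, ha⟩ := adaptedCoord_symm_fst_zero v u
  rw [← hp] at h1 h2 ha
  set T := adaptedCoord p with hT
  let D : ProjModel V →L[ℝ] ProjModel V := (((ContinuousLinearMap.snd ℂ ℂ (ProjModel V)).comp
    (T.toContinuousLinearMap.comp (A.comp (T.symm.toContinuousLinearMap.comp
      (ContinuousLinearMap.inr ℂ ℂ (ProjModel V)))))) -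
        c • ContinuousLinearMap.id ℂ (ProjModel V)).restrictScalars ℝ
  have hv0 : T.symm (1, 0) = b⁻¹ • v.1 := by
    rw [ContinuousLinearEquiv.symm_apply_eq, map_smul, h2]
    ext1 <;> simp [hb]
  have hA0 : T (A (T.symm (1, 0))) = (c, 0) := by
    rw [hv0, map_smul, hv, smul_comm, map_smul, map_smul, h2]
    ext1 <;> simp [hb]
  have hD : HasFDerivAt (affineField A T) D 0 := by
    have h4 := ((T.toContinuousLinearMap.comp A).restrictScalars ℝ).hasFDerivAt.comp
      (0 : ProjModel V) (hasFDerivAt_symm_one T 0)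
    have h5 := h4.snd.sub (h4.fst.smul (hasFDerivAt_id (𝕜 := ℝ) (0 : ProjModel V)))
    refine h5.congr_fderiv ?_
    ext1 e
    simp [D, hA0]
  have hL : HasMFDerivAt 𝓘(ℝ, ProjModel V) 𝓘(ℝ, ProjModel V)
      (fun q => (trivializationAt (ProjModel V) (TangentSpace 𝓘(ℝ, ProjModel V)) p
        ⟨q, projField A q⟩).2) p D := by
    have hc := contMDiffAt_of_affine (n := ⊤) (contDiff_affineField A _).contDiffAt
      fun q hq => trivializationAt_projField A p hq
    refine ⟨hc.continuousAt, ?_⟩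
    apply HasFDerivAt.hasFDerivWithinAt
    change HasFDerivAt (fun e => (trivializationAt (ProjModel V)
      (TangentSpace 𝓘(ℝ, ProjModel V)) p ⟨affineInv T e, projField A (affineInv T e)⟩).2) D
      (affineCoord T p)
    rw [hT, affineCoord_self, ← hT]
    refine hD.congr_of_eventuallyEq (Eventually.of_forall fun e => ?_)
    have hs : affineInv T e ∈ (affineChart T).source := (affineChart T).map_target (mem_univ e)
    refine (trivializationAt_projField A p hs).trans ?_
    congr 1
    exact (affineChart T).right_inv (mem_univ e)
  have hlin : linearization (projField A) p = D := hL.mfderiv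
  rw [hlin]
  have h6 : (dProjPi v u : ProjModel V) = b⁻¹ • (T u).2 := by
    rw [dProjPi_apply, ← hp, ← hT, h2]
  have h7 : (dProjPi v (A u - c • u) : ProjModel V) = b⁻¹ • (T (A u - c • u)).2 := by
    rw [dProjPi_apply, ← hp, ← hT, h2]
  refine Eq.trans ?_ h7.symm
  have h8 : D (dProjPi v u : ProjModel V) = b⁻¹ • D (T u).2 := by
    rw [h6]
    simp only [D, ContinuousLinearMap.coe_restrictScalars', map_smul]
  refine h8.trans ?_
  congr 1
  change (T (A (T.symm (0, (T u).2)))).2 - c • (T u).2 = _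
  rw [ha, map_sub, map_smul, hv, map_sub, map_smul, map_smul, h2, map_sub, map_smul]
  simp

end ProjectiveField

/-! ### The exponential map and the projective flow. -/

noncomputable section ExponentialFlow

variable {V : Type*} [NormedAddCommGroup V] [InnerProductSpace ℂ V] [FiniteDimensional ℂ V]

theorem expUnit_zero : expUnit (0 : V →L[ℂ] V) = 1 := by
  ext1
  rw [coe_expUnit]
  exact NormedSpace.exp_zero

theorem expUnit_add_of_commute {A B : V →L[ℂ] V} (h : Commute A B) :
    expUnit (A + B) = expUnit A * expUnit B := by
  have : CompleteSpace V := FiniteDimensional.complete ℂ V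
  let _ : NormedAlgebra ℚ (V →L[ℂ] V) := NormedAlgebra.restrictScalars ℚ ℂ (V →L[ℂ] V)
  ext1
  rw [Units.val_mul, coe_expUnit, coe_expUnit, coe_expUnit]
  exact NormedSpace.exp_add_of_commute h

theorem expUnit_neg (A : V →L[ℂ] V) : expUnit (-A) = (expUnit A)⁻¹ := by
  rw [eq_comm, inv_eq_iff_mul_eq_one, ← expUnit_add_of_commute (Commute.refl A).neg_right,
    add_neg_cancel, expUnit_zero]

theorem expUnit_add_smul (A : V →L[ℂ] V) (s t : ℝ) :
    expUnit ((s + t) • A) = expUnit (s • A) * expUnit (t • A) := by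
  rw [add_smul]
  exact expUnit_add_of_commute ((Commute.refl A).smul_left s |>.smul_right t)

theorem expUnit_conj (g : (V →L[ℂ] V)ˣ) (A : V →L[ℂ] V) :
    expUnit ((g : V →L[ℂ] V) * A * ((g⁻¹ : (V →L[ℂ] V)ˣ) : V →L[ℂ] V)) = g * expUnit A * g⁻¹ := by
  have : CompleteSpace V := FiniteDimensional.complete ℂ V
  let _ : NormedAlgebra ℚ (V →L[ℂ] V) := NormedAlgebra.restrictScalars ℚ ℂ (V →L[ℂ] V)
  ext1
  rw [Units.val_mul, Units.val_mul, coe_expUnit, coe_expUnit]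
  exact NormedSpace.exp_units_conj g A

theorem contDiff_exp_clm {n : WithTop ℕ∞} :
    ContDiff ℝ n (NormedSpace.exp : (V →L[ℂ] V) → (V →L[ℂ] V)) := by
  have : CompleteSpace V := FiniteDimensional.complete ℂ V
  have h : ∀ A : V →L[ℂ] V, AnalyticAt ℝ NormedSpace.exp A := fun A =>
    NormedSpace.exp_analytic A
  rw [contDiff_iff_contDiffAt]
  exact fun A => (h A).contDiffAt

theorem hasDerivAt_exp_smul (A : V →L[ℂ] V) (t : ℝ) :
    HasDerivAt (fun s : ℝ => NormedSpace.exp (s • A)) (A * NormedSpace.exp (t • A)) t := by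
  have : CompleteSpace V := FiniteDimensional.complete ℂ V
  exact hasDerivAt_exp_smul_const' A t

theorem hasDerivAt_exp_smul_apply (A : V →L[ℂ] V) (v : V) (t : ℝ) :
    HasDerivAt (fun s : ℝ => (expUnit (s • A) : V →L[ℂ] V) v)
      (A ((expUnit (t • A) : V →L[ℂ] V) v)) t := by
  exact ((ContinuousLinearMap.apply ℂ V v).restrictScalars ℝ).hasFDerivAt.comp_hasDerivAt t
    (hasDerivAt_exp_smul A t)

theorem expUnit_apply_eigenvector {A : V →L[ℂ] V} {v : V} {c : ℂ} (h : A v = c • v) :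
    (expUnit A : V →L[ℂ] V) v = Complex.exp c • v := by
  have : CompleteSpace V := FiniteDimensional.complete ℂ V
  have hA : HasSum (fun n : ℕ => ((n.factorial : ℂ)⁻¹) • A ^ n) (NormedSpace.exp A) :=
    NormedSpace.exp_series_hasSum_exp' A
  have h1 : HasSum (fun n : ℕ => (((n.factorial : ℂ)⁻¹) • A ^ n) v) (NormedSpace.exp A v) :=
    hA.mapL (ContinuousLinearMap.apply ℂ V v)
  have h2 : ∀ n : ℕ, (A ^ n) v = c ^ n • v := by
    intro n
    induction n with
    | zero => simp
    | succ n ih => rw [pow_succ', mul_apply_eq_comp, ih, map_smul, h, smul_smul,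
        pow_succ]
  have h3 : HasSum (fun n : ℕ => ((n.factorial : ℂ)⁻¹ • c ^ n) • v) (NormedSpace.exp c • v) :=
    (NormedSpace.exp_series_hasSum_exp' c).smul_const v
  rw [coe_expUnit, Complex.exp_eq_exp_ℂ]
  refine h1.unique ?_
  convert h3 using 2 with n
  simp [h2, smul_smul]

/-- All terms of positive degree in the exponential series lie in `P`, and a finite-dimensional
subspace is closed. Applied to raising and lowering operators, it says that their exponentials
change a vector only by higher or lower terms. -/
theorem exp_apply_sub_mem {A : V →L[ℂ] V} {P Q : Submodule ℝ V} (hQ : ∀ v ∈ Q, A v ∈ P)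
    (hPQ : P ≤ Q) {v : V} (hv : v ∈ Q) : (expUnit A : V →L[ℂ] V) v - v ∈ P := by
  have : CompleteSpace V := FiniteDimensional.complete ℂ V
  have : FiniteDimensional ℝ V := FiniteDimensional.complexToReal V
  have hA : HasSum (fun n : ℕ => ((n.factorial : ℝ)⁻¹) • A ^ n) (NormedSpace.exp A) :=
    NormedSpace.exp_series_hasSum_exp' A
  have h1 : HasSum (fun n : ℕ => (((n.factorial : ℝ)⁻¹) • A ^ n) v) (NormedSpace.exp A v) :=
    hA.mapL (ContinuousLinearMap.apply ℂ V v)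
  have h2 := (hasSum_nat_add_iff' 1).2 h1
  simp only [Finset.range_one, Finset.sum_singleton, Nat.factorial_zero, Nat.cast_one, inv_one,
    pow_zero, one_smul, one_apply_eq_self] at h2
  have h3 : ∀ n : ℕ, (A ^ (n + 1)) v ∈ P := by
    intro n
    induction n with
    | zero => simpa using hQ v hv
    | succ n ih =>
      rw [pow_succ', mul_apply_eq_comp]
      exact hQ _ (hPQ ih)
  rw [coe_expUnit]
  refine P.closed_of_finiteDimensional.mem_of_tendsto h2 (Eventually.of_forall fun s => ?_)
  exact P.sum_mem fun n _ => P.smul_mem _ (h3 n)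

theorem projFlow_projPi (A : V →L[ℂ] V) (t : ℝ) (v : PuncturedSpace V) :
    projFlow A t (projPi v) =
      projPi ⟨(expUnit (t • A) : V →L[ℂ] V) v.1, units_apply_ne_zero _ v.2⟩ := rfl

theorem projFlow_zero (A : V →L[ℂ] V) (p : ℙ ℂ V) : projFlow A 0 p = p := by
  rw [projFlow, zero_smul, expUnit_zero, one_smul]

theorem projFlow_add (A : V →L[ℂ] V) (s t : ℝ) (p : ℙ ℂ V) :
    projFlow A (s + t) p = projFlow A s (projFlow A t p) := by
  simp only [projFlow]
  rw [expUnit_add_smul, mul_smul]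

theorem projFlow_neg (A : V →L[ℂ] V) (t : ℝ) (p : ℙ ℂ V) :
    projFlow (-A) t p = projFlow A (-t) p := by
  simp only [projFlow, smul_neg, neg_smul]

theorem continuous_projFlow (A : V →L[ℂ] V) (t : ℝ) : Continuous (projFlow A t) :=
  continuous_const_smul _

theorem hasMFDerivAt_exp_curve (A : V →L[ℂ] V) (v : PuncturedSpace V) (t : ℝ) :
    HasMFDerivAt 𝓘(ℝ, ℝ) 𝓘(ℝ, ProjModel V) (fun t => expUnit (t • A) • projPi v) t
      ((1 : ℝ →L[ℝ] ℝ).smulRight (projField A (expUnit (t • A) • projPi v))) := by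
  have h := hasMFDerivAt_projPi_comp
    (γ := fun s : ℝ => (expUnit (s • A) : V →L[ℂ] V) v.1)
    (fun s => units_apply_ne_zero _ v.2) (hasDerivAt_exp_smul_apply A v.1 t).hasFDerivAt
  have h2 := projField_projPi A ⟨(expUnit (t • A) : V →L[ℂ] V) v.1, units_apply_ne_zero _ v.2⟩
  rw [smul_projPi, h2]
  refine h.congr_mfderiv ?_
  ext
  exact map_smul (dProjPi (⟨_, units_apply_ne_zero _ v.2⟩ : PuncturedSpace V)) (1 : ℝ) _

theorem isFlowOf_projFlow (A : V →L[ℂ] V) : IsFlowOf (projField A) (projFlow A) := by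
  intro p
  obtain ⟨v, rfl⟩ := projPi_surjective p
  exact ⟨projFlow_zero A _, fun t => hasMFDerivAt_exp_curve A v t⟩

theorem contMDiffAt_exp_curve (A : V →L[ℂ] V) (v : PuncturedSpace V) (t : ℝ) :
    ContMDiffAt 𝓘(ℝ, ℝ) 𝓘(ℝ, ProjModel V) ∞ (fun t : ℝ => expUnit (t • A) • projPi v) t := by
  refine contMDiffAt_projPi_comp (n := ⊤)
    (γ := fun s : ℝ => (expUnit (s • A) : V →L[ℂ] V) v.1)
    (fun s => units_apply_ne_zero _ v.2) ?_
  have h1 : ContDiff ℝ ∞ fun s : ℝ => NormedSpace.exp (s • A) :=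
    contDiff_exp_clm.comp (contDiff_id.smul contDiff_const)
  exact (((ContinuousLinearMap.apply ℂ V v.1).restrictScalars ℝ).contDiff.comp h1).contDiffAt

/-- The curve `t ↦ e^{tA} p` is an admissible curve in `S` with velocity `projField A p`. The
tangent vectors to `ℳ` and to the stable manifolds are exhibited in this way. -/
theorem projField_mem_tangentSpaceOf {A : V →L[ℂ] V} {S : Set (ℙ ℂ V)} {p : ℙ ℂ V}
    (h : ∀ t : ℝ, expUnit (t • A) • p ∈ S) : projField A p ∈ tangentSpaceOf S p := by
  obtain ⟨v, rfl⟩ := projPi_surjective p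
  have h0 : expUnit ((0 : ℝ) • A) • projPi v = projPi v := by
    rw [zero_smul, expUnit_zero, one_smul]
  refine Submodule.subset_span ⟨fun t => expUnit (t • A) • projPi v, h0,
    contMDiffAt_exp_curve A v 0, Eventually.of_forall h, ?_⟩
  have h1 := (hasMFDerivAt_exp_curve A v 0).mfderiv
  have h2 : (mfderiv 𝓘(ℝ, ℝ) 𝓘(ℝ, ProjModel V) (fun t : ℝ => expUnit (t • A) • projPi v) 0 (1 : ℝ)
      : ProjModel V) = projField A (expUnit ((0 : ℝ) • A) • projPi v) := by
    rw [h1]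
    exact one_smul ℝ (projField A (expUnit ((0 : ℝ) • A) • projPi v) : ProjModel V)
  rw [h2, h0]

end ExponentialFlow

/-! ### The gradient structure: no closed orbits, nonwandering set. -/

noncomputable section HeightFunction

variable {V : Type*} [NormedAddCommGroup V] [InnerProductSpace ℂ V] [FiniteDimensional ℂ V]

theorem hasDerivAt_of_hasMFDerivAt {g : ℝ → ℝ} {D : ℝ →L[ℝ] ℝ} {t : ℝ}
    (h : HasMFDerivAt 𝓘(ℝ, ℝ) 𝓘(ℝ, ℝ) g t D) : HasDerivAt g (D 1) t := by
  have h1 : HasFDerivAt g D t := h.hasFDerivAt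
  exact h1.hasDerivAt

theorem contMDiff_heightFunction (A : V →L[ℂ] V) :
    ContMDiff 𝓘(ℝ, ProjModel V) 𝓘(ℝ, ℝ) ∞ (heightFunction A) := by
  intro p
  set T := adaptedCoord p with hT
  have hl : ContDiff ℝ ∞ (fun e : ProjModel V => T.symm (1, e)) :=
    (T.symm.toContinuousLinearMap.restrictScalars ℝ).contDiff.comp
      (contDiff_const.prodMk contDiff_id)
  have hAl : ContDiff ℝ ∞ (fun e : ProjModel V => A (T.symm (1, e))) :=
    (A.restrictScalars ℝ).contDiff.comp hl
  have hg : ContDiff ℝ ∞ (fun e : ProjModel V => -(1 / 2) *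
      ((⟪A (T.symm (1, e)), T.symm (1, e)⟫_ℂ).re /
        (⟪T.symm (1, e), T.symm (1, e)⟫_ℂ).re)) := by
    refine contDiff_const.mul (ContDiff.div ?_ ?_ fun e => ?_)
    · exact Complex.reCLM.contDiff.comp (hAl.inner ℂ hl)
    · exact Complex.reCLM.contDiff.comp (hl.inner ℂ hl)
    · exact ((re_inner_self_pos (𝕜 := ℂ)).2 (symm_one_ne_zero T e)).ne'
  refine contMDiffAt_of_affine (n := ⊤) hg.contDiffAt fun q hq => ?_
  rw [← hT] at hq ⊢
  conv_lhs => rw [← affineInv_affineCoord T hq]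
  rw [heightFunction_projPi]

omit [FiniteDimensional ℂ V] in
theorem inner_self_adjoint_comm [CompleteSpace V] {A : V →L[ℂ] V} (hA : star A = A) (u w : V) :
    ⟪A u, w⟫_ℂ = ⟪u, A w⟫_ℂ := by
  rw [← ContinuousLinearMap.adjoint_inner_right, ← ContinuousLinearMap.star_eq_adjoint, hA]

omit [FiniteDimensional ℂ V] in
-- Because `u ⊥ v`, the denominator is constant to first order; self-adjointness makes the two terms
-- in the derivative of the numerator equal, which cancels the factor `1/2`.
theorem hasDerivAt_heightFunction_line [CompleteSpace V] {A : V →L[ℂ] V} (hA : star A = A)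
    {v u : V} (hu : ⟪v, u⟫_ℂ = 0) (hv : v ≠ 0) :
    HasDerivAt (fun t : ℝ => -(1 / 2) * ((⟪A (v + t • u), v + t • u⟫_ℂ).re /
      (⟪v + t • u, v + t • u⟫_ℂ).re)) (-(⟪A v, u⟫_ℂ).re / (⟪v, v⟫_ℂ).re) 0 := by
  have hγ : HasDerivAt (fun t : ℝ => v + t • u) u 0 := by
    simpa using ((hasDerivAt_id (0 : ℝ)).smul_const u).const_add v
  have hAγ : HasDerivAt (fun t : ℝ => A (v + t • u)) (A u) 0 :=
    (A.restrictScalars ℝ).hasFDerivAt.comp_hasDerivAt 0 hγ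
  have hN := Complex.reCLM.hasFDerivAt.comp_hasDerivAt (0 : ℝ) (hAγ.inner ℂ hγ)
  have hD := Complex.reCLM.hasFDerivAt.comp_hasDerivAt (0 : ℝ) (hγ.inner ℂ hγ)
  have hpos : (⟪v, v⟫_ℂ).re ≠ 0 := ((re_inner_self_pos (𝕜 := ℂ)).2 hv).ne'
  have h := (hN.div hD (by simpa using hpos)).const_mul (-(1 / 2))
  refine h.congr_deriv ?_
  have hu' : ⟪u, v⟫_ℂ = 0 := inner_eq_zero_symm.1 hu
  have hs : (⟪A u, v⟫_ℂ).re = (⟪A v, u⟫_ℂ).re := by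
    rw [inner_self_adjoint_comm hA, ← inner_conj_symm, Complex.conj_re]
  simp only [Function.comp_apply, zero_smul, add_zero, Complex.reCLM_apply, Complex.add_re, hs, hu,
    hu', Complex.zero_re, mul_zero, sub_zero]
  field_simp
  ring

/-- Every tangent vector is `dπ_v u` with `u ⊥ v`, so it suffices to differentiate along the lines
`v + t u`. -/
theorem isFubiniStudyGradient_heightFunction [CompleteSpace V] {A : V →L[ℂ] V}
    (hA : star A = A) : IsFubiniStudyGradient (heightFunction A) (fun p => -projField A p) := by
  refine ⟨contMDiff_heightFunction A, fun p η => ?_⟩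
  obtain ⟨v, rfl⟩ := projPi_surjective p
  obtain ⟨u, hu, rfl⟩ := exists_dProjPi_eq v η
  have hvv : ⟪v.1, v.1⟫_ℂ ≠ 0 := inner_self_ne_zero.2 v.2
  have hne : ∀ t : ℝ, v.1 + t • u ≠ 0 := by
    intro t ht
    have h1 : ⟪v.1, v.1 + t • u⟫_ℂ = ⟪v.1, v.1⟫_ℂ := by
      rw [inner_add_right, inner_smul_right_eq_smul, hu, smul_zero, add_zero]
    rw [ht, inner_zero_right] at h1
    exact hvv h1.symm
  have hγ : HasDerivAt (fun t : ℝ => v.1 + t • u) u 0 := by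
    simpa using ((hasDerivAt_id (0 : ℝ)).smul_const u).const_add v.1
  have hc := hasMFDerivAt_projPi_comp hne hγ.hasFDerivAt
  have h0 : (⟨v.1 + (0 : ℝ) • u, hne 0⟩ : PuncturedSpace V) = v := by
    ext1
    simp
  have hf : HasMFDerivAt 𝓘(ℝ, ProjModel V) 𝓘(ℝ, ℝ) (heightFunction A)
      (projPi ⟨v.1 + (0 : ℝ) • u, hne 0⟩)
      (mfderiv 𝓘(ℝ, ProjModel V) 𝓘(ℝ, ℝ) (heightFunction A)
        (projPi ⟨v.1 + (0 : ℝ) • u, hne 0⟩)) :=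
    ((contMDiff_heightFunction A).mdifferentiable (by simp) _).hasMFDerivAt
  have hcomp := hasDerivAt_of_hasMFDerivAt (hf.comp (0 : ℝ) hc)
  have hline := hasDerivAt_heightFunction_line hA hu v.2
  have heq : (heightFunction A ∘ fun t : ℝ => projPi ⟨v.1 + t • u, hne t⟩) =
      fun t : ℝ => -(1 / 2) * ((⟪A (v.1 + t • u), v.1 + t • u⟫_ℂ).re /
        (⟪v.1 + t • u, v.1 + t • u⟫_ℂ).re) := by
    ext t
    exact heightFunction_projPi A _
  rw [heq] at hcomp
  have hval := hcomp.unique hline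
  have hval' : (mfderiv 𝓘(ℝ, ProjModel V) 𝓘(ℝ, ℝ) (heightFunction A)
        (projPi ⟨v.1 + (0 : ℝ) • u, hne 0⟩) (dProjPi ⟨v.1 + (0 : ℝ) • u, hne 0⟩ ((1 : ℝ) • u)) : ℝ)
      = -(⟪A v.1, u⟫_ℂ).re / (⟪v.1, v.1⟫_ℂ).re := hval
  rw [h0, one_smul] at hval'
  refine Eq.trans (b := -(⟪A v.1, u⟫_ℂ).re / (⟪v.1, v.1⟫_ℂ).re) hval' ?_
  beta_reduce
  rw [projField_projPi]
  -- The metric formula requires horizontal vectors: `A v` is replaced by its component orthogonal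
  -- to `v`, which has the same image under `dπ_v`.
  set a := ⟪v.1, A v.1⟫_ℂ / ⟪v.1, v.1⟫_ℂ with ha
  have hh : ⟪v.1, -(A v.1 - a • v.1)⟫_ℂ = 0 := by
    rw [inner_neg_right, inner_sub_right, inner_smul_right, ha, div_mul_cancel₀ _ hvv, sub_self,
      neg_zero]
  have hd : -dProjPi v (A v.1) = dProjPi v (-(A v.1 - a • v.1)) := by
    rw [map_neg, map_sub, dProjPi_self_smul, sub_zero]
  rw [hd, fubiniStudy_dProjPi v hh hu, inner_neg_left, inner_sub_left, inner_smul_left, hu,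
    mul_zero, sub_zero]
  have hre : ⟪v.1, v.1⟫_ℂ = ((⟪v.1, v.1⟫_ℂ).re : ℂ) := (inner_self_ofReal_re v.1).symm
  rw [hre, Complex.div_ofReal_re, Complex.neg_re, Complex.ofReal_re]

theorem fubiniStudy_self_re_pos {p : ℙ ℂ V} {ξ : TangentSpace 𝓘(ℝ, ProjModel V) p}
    (h : ξ ≠ 0) : 0 < (fubiniStudy p ξ ξ).re := by
  have h1 : horizontalLift p ξ ≠ 0 := by
    rw [horizontalLift, ne_eq, EmbeddingLike.map_eq_zero_iff]
    exact fun h2 => h (congrArg Prod.snd h2)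
  rw [fubiniStudy]
  have hre : ⟪p.rep, p.rep⟫_ℂ = ((⟪p.rep, p.rep⟫_ℂ).re : ℂ) := (inner_self_ofReal_re p.rep).symm
  rw [hre, Complex.div_ofReal_re]
  exact div_pos ((re_inner_self_pos (𝕜 := ℂ)).2 h1) ((re_inner_self_pos (𝕜 := ℂ)).2 p.rep_nonzero)

theorem projFlow_eq_of_isCriticalPoint {A : V →L[ℂ] V} {p : ℙ ℂ V}
    (h : IsCriticalPoint (projField A) p) (t : ℝ) : projFlow A t p = p := by
  obtain ⟨v, rfl⟩ := projPi_surjective p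
  obtain ⟨c, hc⟩ := (isCriticalPoint_iff A v).1 h
  have h1 : (t • A) v.1 = ((t : ℂ) * c) • v.1 := by
    rw [smul_apply, hc, mul_smul, Complex.coe_smul]
  rw [projFlow_projPi]
  exact projPi_eq_of_smul (expUnit_apply_eigenvector h1)

theorem isCriticalPoint_projFlow_iff {A : V →L[ℂ] V} {p : ℙ ℂ V} (t : ℝ) :
    IsCriticalPoint (projField A) (projFlow A t p) ↔ IsCriticalPoint (projField A) p := by
  constructor
  · intro h
    have h1 := projFlow_eq_of_isCriticalPoint h (-t)
    rw [← projFlow_add, neg_add_cancel, projFlow_zero] at h1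
    rwa [h1]
  · intro h
    rwa [projFlow_eq_of_isCriticalPoint h]

/-- The derivative along the trajectory is minus the squared length of the field, and a trajectory
that starts off the critical set never enters it. -/
theorem strictAnti_heightFunction_projFlow [CompleteSpace V] {A : V →L[ℂ] V} (hA : star A = A)
    {p : ℙ ℂ V} (hp : ¬ IsCriticalPoint (projField A) p) :
    StrictAnti fun t => heightFunction A (projFlow A t p) := by
  refine strictAnti_of_hasDerivAt_neg (f' := fun t =>
    -(fubiniStudy (projFlow A t p) (projField A (projFlow A t p))
      (projField A (projFlow A t p))).re) (fun t => ?_) fun t => ?_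
  · obtain ⟨hs, hg⟩ := isFubiniStudyGradient_heightFunction hA
    have hf := ((hs.mdifferentiable (by simp)) (projFlow A t p)).hasMFDerivAt
    have hcomp := hasDerivAt_of_hasMFDerivAt (hf.comp t ((isFlowOf_projFlow A p).2 t))
    refine hcomp.congr_deriv ?_
    have h1 := hg (projFlow A t p) (projField A (projFlow A t p))
    have h2 : (fubiniStudy (projFlow A t p) (-projField A (projFlow A t p))
        (projField A (projFlow A t p))).re = -(fubiniStudy (projFlow A t p)
          (projField A (projFlow A t p)) (projField A (projFlow A t p))).re := by
      have h3 : horizontalLift (projFlow A t p) (-projField A (projFlow A t p)) =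
          -horizontalLift (projFlow A t p) (projField A (projFlow A t p)) := by
        simp only [horizontalLift, ← map_neg]
        congr 1
        ext1
        · simp
        · rfl
      rw [fubiniStudy, h3, inner_neg_left, neg_div, Complex.neg_re, fubiniStudy]
    rw [← h2, ← h1]
    change (mfderiv 𝓘(ℝ, ProjModel V) 𝓘(ℝ, ℝ) (heightFunction A) (projFlow A t p)
      ((1 : ℝ) • projField A (projFlow A t p)) : ℝ) = _
    rw [one_smul]
  · exact neg_neg_of_pos (fubiniStudy_self_re_pos fun h =>
      hp ((isCriticalPoint_projFlow_iff t).1 h))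

theorem isCriticalPoint_of_projFlow_eq [CompleteSpace V] {A : V →L[ℂ] V} (hA : star A = A)
    {p : ℙ ℂ V} {t : ℝ} (ht : 0 < t) (h : projFlow A t p = p) :
    IsCriticalPoint (projField A) p := by
  by_contra hp
  have h1 := strictAnti_heightFunction_projFlow hA hp ht
  simp only [h, projFlow_zero, lt_self_iff_false] at h1

theorem not_hasClosedOrbit_projFlow [CompleteSpace V] {A : V →L[ℂ] V} (hA : star A = A)
    (p : ℙ ℂ V) (T : ℝ) : ¬ HasClosedOrbit (projFlow A) p T := by
  rintro ⟨h0, hT, h⟩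
  -- A periodic point is critical, hence fixed at all times. Any time strictly between `0` and `T`
  -- contradicts minimality of the period.
  exact h (T / 2) (by linarith) (by linarith)
    (projFlow_eq_of_isCriticalPoint (isCriticalPoint_of_projFlow_eq hA h0 hT) _)

theorem criticalElements_projFlow [CompleteSpace V] {A : V →L[ℂ] V} (hA : star A = A)
    (S : Set (ℙ ℂ V)) : criticalElements (projField A) (projFlow A) S =
      (fun p => {p}) '' {p ∈ S | IsCriticalPoint (projField A) p} := by
  ext B
  constructor
  · rintro (⟨p, hp, hc, rfl⟩ | ⟨p, -, T, hT, -⟩)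
    · exact ⟨p, ⟨hp, hc⟩, rfl⟩
    · exact absurd hT (not_hasClosedOrbit_projFlow hA p T)
  · rintro ⟨p, ⟨hp, hc⟩, rfl⟩
    exact Or.inl ⟨p, hp, hc, rfl⟩

theorem nonwanderingSet_projFlow [CompleteSpace V] {A : V →L[ℂ] V} (hA : star A = A)
    (S : Set (ℙ ℂ V)) : nonwanderingSet (projFlow A) S =
      {p ∈ S | IsCriticalPoint (projField A) p} := by
  ext p
  constructor
  · rintro ⟨hpS, hp⟩
    refine ⟨hpS, ?_⟩
    by_contra hc
    have hcont : Continuous (heightFunction A) := (contMDiff_heightFunction A).continuous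
    have hlt : heightFunction A (projFlow A 1 p) < heightFunction A p := by
      have h := strictAnti_heightFunction_projFlow hA hc zero_lt_one
      simpa only [projFlow_zero] using h
    obtain ⟨m, h1, h2⟩ := exists_between hlt
    -- Points of `U` lie above level `m` but are below it at time `1`. As the height never
    -- increases, they cannot return to `U` after time `1`.
    let U := {q | heightFunction A (projFlow A 1 q) < m} ∩ {q | m < heightFunction A q}
    have hU : U ∈ 𝓝 p := inter_mem
      ((isOpen_lt (hcont.comp (continuous_projFlow A 1)) continuous_const).mem_nhds h1)
      ((isOpen_lt continuous_const hcont).mem_nhds h2)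
    obtain ⟨t, ht, _, ⟨q, ⟨hq, -⟩, rfl⟩, hq', -⟩ := hp U hU 1 zero_lt_one
    have hle : heightFunction A (projFlow A t q) ≤ heightFunction A (projFlow A 1 q) := by
      by_cases hqc : IsCriticalPoint (projField A) q
      · rw [projFlow_eq_of_isCriticalPoint hqc, projFlow_eq_of_isCriticalPoint hqc]
      · exact (strictAnti_heightFunction_projFlow hA hqc).antitone ht
    exact absurd (hq'.2.trans_le hle) (not_lt.2 hq.1.le)
  · rintro ⟨hpS, hc⟩
    refine ⟨hpS, fun U hU T hT => ⟨T, le_rfl, p, ⟨p, ⟨mem_of_mem_nhds hU, hpS⟩, ?_⟩,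
      mem_of_mem_nhds hU, hpS⟩⟩
    exact projFlow_eq_of_isCriticalPoint hc T

end HeightFunction

/-! ### Eigenspaces of `X` on `V` and stable manifolds in `ℙ(V)`. -/

noncomputable section SpectralSubspaces

variable {V : Type*} [NormedAddCommGroup V] [InnerProductSpace ℂ V]

/-- The eigenspace of `A` for the real eigenvalue `a`, as a real subspace. -/
def realEigenspace (A : V →L[ℂ] V) (a : ℝ) : Submodule ℝ V :=
  Module.End.eigenspace (A.restrictScalars ℝ).toLinearMap a

theorem mem_realEigenspace {A : V →L[ℂ] V} {a : ℝ} {v : V} :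
    v ∈ realEigenspace A a ↔ A v = a • v := Module.End.mem_eigenspace_iff

/-- The span of the eigenvectors of `A` with eigenvalues in `s`. -/
def spectralSubspace (A : V →L[ℂ] V) (s : Set ℝ) : Submodule ℝ V :=
  ⨆ a ∈ s, realEigenspace A a

theorem realEigenspace_le_spectralSubspace (A : V →L[ℂ] V) {s : Set ℝ} {a : ℝ} (ha : a ∈ s) :
    realEigenspace A a ≤ spectralSubspace A s := le_iSup₂_of_le a ha le_rfl

theorem spectralSubspace_mono (A : V →L[ℂ] V) {s t : Set ℝ} (h : s ⊆ t) :
    spectralSubspace A s ≤ spectralSubspace A t :=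
  iSup₂_le fun _ ha => realEigenspace_le_spectralSubspace A (h ha)

theorem spectralSubspace_induction {A : V →L[ℂ] V} {s : Set ℝ} {P : V → Prop}
    (hmem : ∀ a ∈ s, ∀ v, A v = a • v → P v) (h0 : P 0) (hadd : ∀ v w, P v → P w → P (v + w))
    {v : V} (hv : v ∈ spectralSubspace A s) : P v := by
  refine Submodule.iSup_induction _ (motive := P) hv (fun a w hw => ?_) h0 hadd
  refine Submodule.iSup_induction _ (motive := P) hw (fun ha u hu => ?_) h0 hadd
  exact hmem a ha u (mem_realEigenspace.1 hu)

/-- If `[A, B] = c B`, then `B` maps the `a`-eigenspace of `A` to the `(a + c)`-eigenspace. -/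
theorem map_mem_spectralSubspace {A B : V →L[ℂ] V} {s t : Set ℝ} {c : ℝ}
    (hB : A * B - B * A = c • B) (hst : ∀ a ∈ s, a + c ∈ t) {v : V}
    (hv : v ∈ spectralSubspace A s) : B v ∈ spectralSubspace A t := by
  refine spectralSubspace_induction (P := fun v => B v ∈ spectralSubspace A t)
    (fun a ha u hu => ?_) (by simp) (fun u w hu hw => ?_) hv
  · refine realEigenspace_le_spectralSubspace A (hst a ha) (mem_realEigenspace.2 ?_)
    have h := congrArg (fun C : V →L[ℂ] V => C u) hB
    simp only [sub_apply, mul_apply_eq_comp, smul_apply] at h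
    rw [hu, B.map_smul_of_tower, sub_eq_iff_eq_add] at h
    rw [h, add_smul, add_comm]
  · simp only [map_add]
    exact add_mem hu hw

theorem eigenvectors_orthogonal [CompleteSpace V] {A : V →L[ℂ] V} (hA : star A = A) {a b : ℝ}
    (hab : a ≠ b) {u w : V} (hu : A u = a • u) (hw : A w = b • w) : ⟪u, w⟫_ℂ = 0 := by
  have h := inner_self_adjoint_comm hA u w
  rw [hu, hw, ← Complex.coe_smul, ← Complex.coe_smul, inner_smul_left, inner_smul_right,
    Complex.conj_ofReal, ← sub_eq_zero, ← sub_mul, mul_eq_zero] at h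
  refine h.resolve_left fun h0 => hab ?_
  exact_mod_cast sub_eq_zero.1 h0

theorem spectralSubspace_orthogonal [CompleteSpace V] {A : V →L[ℂ] V} (hA : star A = A)
    {s t : Set ℝ} (hst : Disjoint s t) {u w : V} (hu : u ∈ spectralSubspace A s)
    (hw : w ∈ spectralSubspace A t) : ⟪u, w⟫_ℂ = 0 := by
  refine spectralSubspace_induction (P := fun u => ⟪u, w⟫_ℂ = 0) (fun a ha u hu => ?_)
    (inner_zero_left _) (fun u v hu hv => by rw [inner_add_left, hu, hv, add_zero]) hu
  refine spectralSubspace_induction (P := fun w => ⟪u, w⟫_ℂ = 0) (fun b hb w hw => ?_)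
    (inner_zero_right _) (fun u v hu hv => by rw [inner_add_right, hu, hv, add_zero]) hw
  exact eigenvectors_orthogonal hA (hst.ne_of_mem ha hb) hu hw

/-- Components below, at and above the eigenvalue `a` are uniquely determined. -/
theorem eq_zero_of_add_eq [CompleteSpace V] {A : V →L[ℂ] V} (hA : star A = A) {a : ℝ} {x l h : V}
    (hx : x ∈ realEigenspace A a) (hl : l ∈ spectralSubspace A (Iio a))
    (hh : h ∈ spectralSubspace A (Ioi a)) (he : x + l = h) : x = 0 ∧ l = 0 ∧ h = 0 := by
  have hx' : x ∈ spectralSubspace A {a} := realEigenspace_le_spectralSubspace A (mem_singleton a) hx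
  have h1 : ⟪x, l⟫_ℂ = 0 :=
    spectralSubspace_orthogonal hA (s := {a}) (t := Iio a) (by simp) hx' hl
  have h2 : ⟪x, h⟫_ℂ = 0 :=
    spectralSubspace_orthogonal hA (s := {a}) (t := Ioi a) (by simp) hx' hh
  have h3 : ⟪l, h⟫_ℂ = 0 := spectralSubspace_orthogonal hA (s := Iio a) (t := Ioi a)
    (Set.disjoint_left.2 fun _ hy hy' => lt_asymm (mem_Iio.1 hy) (mem_Ioi.1 hy')) hl hh
  have hx0 : x = 0 := by
    rw [← inner_self_eq_zero (𝕜 := ℂ)]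
    rwa [← he, inner_add_right, h1, add_zero] at h2
  subst hx0
  rw [zero_add] at he
  subst he
  exact ⟨rfl, inner_self_eq_zero.1 h3, inner_self_eq_zero.1 h3⟩

variable [FiniteDimensional ℂ V]

theorem exists_orthonormal_eigenbasis [CompleteSpace V] {A : V →L[ℂ] V} (hA : star A = A) :
    ∃ (b : OrthonormalBasis (Fin (finrank ℂ V)) ℂ V) (l : Fin (finrank ℂ V) → ℝ),
      ∀ i, A (b i) = l i • b i := by
  have hs : (A : V →ₗ[ℂ] V).IsSymmetric := fun u w => inner_self_adjoint_comm hA u w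
  refine ⟨hs.eigenvectorBasis rfl, hs.eigenvalues rfl, fun i => ?_⟩
  have h := hs.apply_eigenvectorBasis rfl i
  rw [ContinuousLinearMap.coe_coe] at h
  rw [h]
  exact Complex.coe_smul _ _

theorem spectralSubspace_univ [CompleteSpace V] {A : V →L[ℂ] V} (hA : star A = A) :
    spectralSubspace A univ = ⊤ := by
  obtain ⟨b, l, hb⟩ := exists_orthonormal_eigenbasis hA
  rw [eq_top_iff]
  intro v _
  rw [← b.sum_repr v]
  refine Submodule.sum_mem _ fun i _ => ?_
  refine realEigenspace_le_spectralSubspace A (mem_univ (l i)) (mem_realEigenspace.2 ?_)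
  rw [map_smul, hb, smul_comm]

/-- Each nonzero vector has a leading component for the largest occurring eigenvalue. -/
theorem exists_leading_component [CompleteSpace V] {A : V →L[ℂ] V} (hA : star A = A) {w : V}
    (hw : w ≠ 0) : ∃ (a : ℝ) (v : V), v ≠ 0 ∧ A v = a • v ∧
      w - v ∈ spectralSubspace A (Iio a) := by
  classical
  have h : w ∈ ⨆ a : ℝ, realEigenspace A a := by
    have h1 := spectralSubspace_univ hA
    simp only [spectralSubspace, mem_univ, iSup_pos] at h1
    rw [h1]
    trivial
  obtain ⟨f, hf, hsum⟩ := (Submodule.mem_iSup_iff_exists_finsupp _ _).1 h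
  have hne : f.support.Nonempty := by
    rw [Finsupp.support_nonempty_iff]
    rintro rfl
    exact hw (by simpa using hsum.symm)
  set a := f.support.max' hne with ha
  have ham : a ∈ f.support := Finset.max'_mem _ hne
  refine ⟨a, f a, Finsupp.mem_support_iff.1 ham, mem_realEigenspace.1 (hf a), ?_⟩
  have h2 : w - f a = ∑ b ∈ f.support.erase a, f b := by
    rw [← hsum, Finsupp.sum, ← Finset.add_sum_erase _ _ ham, add_sub_cancel_left]
  rw [h2]
  refine Submodule.sum_mem _ fun b hb => ?_
  rw [Finset.mem_erase] at hb
  have hlt : b < a := lt_of_le_of_ne (Finset.le_max' _ _ hb.2) hb.1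
  exact realEigenspace_le_spectralSubspace A (s := Iio a) hlt (hf b)

theorem expUnit_smul_apply_eigenvector {A : V →L[ℂ] V} {v : V} {a : ℝ} (h : A v = a • v)
    (t : ℝ) : (expUnit (t • A) : V →L[ℂ] V) v = Real.exp (t * a) • v := by
  have h1 : (t • A) v = ((t * a : ℝ) : ℂ) • v := by
    rw [smul_apply, h, smul_smul, Complex.coe_smul]
  rw [expUnit_apply_eigenvector h1, ← Complex.ofReal_exp, Complex.coe_smul]

theorem tendsto_exp_smul_lower {A : V →L[ℂ] V} {a : ℝ} {u : V}
    (hu : u ∈ spectralSubspace A (Iio a)) :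
    Tendsto (fun t : ℝ => Real.exp (-(t * a)) • (expUnit (t • A) : V →L[ℂ] V) u) atTop (𝓝 0) := by
  refine spectralSubspace_induction (P := fun u => Tendsto (fun t : ℝ =>
    Real.exp (-(t * a)) • (expUnit (t • A) : V →L[ℂ] V) u) atTop (𝓝 0))
    (fun b hb u hu => ?_) (by simp) (fun u w hu hw => ?_) hu
  · simp only [expUnit_smul_apply_eigenvector hu, smul_smul, ← Real.exp_add]
    have h : Tendsto (fun t : ℝ => Real.exp (-(t * a) + t * b)) atTop (𝓝 0) := by
      have h1 : (fun t : ℝ => Real.exp (-(t * a) + t * b)) =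
          fun t : ℝ => Real.exp (-(t * (a - b))) := by
        ext t
        ring_nf
      rw [h1]
      exact Real.tendsto_exp_neg_atTop_nhds_zero.comp
        (tendsto_id.atTop_mul_const (sub_pos.2 hb))
    simpa using h.smul_const u
  · simpa [smul_add] using hu.add hw

/-- Rescaling `e^{tA} w` by `e^{-ta}` does not change its line. The rescaled vector keeps the
component `v` fixed, while the lower components decay. -/
theorem tendsto_projFlow_leading {A : V →L[ℂ] V} {a : ℝ} {v w : PuncturedSpace V}
    (hv : A v.1 = a • v.1) (hw : w.1 - v.1 ∈ spectralSubspace A (Iio a)) :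
    Tendsto (fun t => projFlow A t (projPi w)) atTop (𝓝 (projPi v)) := by
  have hne : ∀ t : ℝ, Real.exp (-(t * a)) • (expUnit (t • A) : V →L[ℂ] V) w.1 ≠ 0 := fun t =>
    smul_ne_zero (Real.exp_pos _).ne' (units_apply_ne_zero _ w.2)
  have h1 : ∀ t, projFlow A t (projPi w) = projPi ⟨_, hne t⟩ := by
    intro t
    rw [projFlow_projPi]
    refine (projPi_eq_of_smul (c := (Real.exp (-(t * a)) : ℂ)) ?_).symm
    exact (Complex.coe_smul _ _).symm
  simp only [h1]
  refine (continuous_projPi.tendsto v).comp ?_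
  rw [tendsto_subtype_rng]
  have h2 := (tendsto_exp_smul_lower hw).add_const v.1
  rw [zero_add] at h2
  refine h2.congr fun t => ?_
  rw [map_sub, expUnit_smul_apply_eigenvector hv, smul_sub, smul_smul, ← Real.exp_add]
  simp

theorem exists_tendsto_projFlow [CompleteSpace V] {A : V →L[ℂ] V} (hA : star A = A) (p : ℙ ℂ V) :
    ∃ (a : ℝ) (v : PuncturedSpace V), A v.1 = a • v.1 ∧
      Tendsto (fun t => projFlow A t p) atTop (𝓝 (projPi v)) := by
  obtain ⟨w, rfl⟩ := projPi_surjective p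
  obtain ⟨a, v, hv0, hv, h⟩ := exists_leading_component hA w.2
  exact ⟨a, ⟨v, hv0⟩, hv, tendsto_projFlow_leading (v := ⟨v, hv0⟩) hv h⟩

theorem mem_stableManifold_singleton {P : Type*} [TopologicalSpace P] {Φ : ℝ → P → P} {p y : P} :
    y ∈ stableManifold Φ {p} ↔ Tendsto (fun t => Φ t y) atTop (𝓝 p) := by
  rw [stableManifold, mem_ofPred_eq, nhdsSet_singleton]

theorem mem_unstableManifold_singleton {P : Type*} [TopologicalSpace P] {Φ : ℝ → P → P}
    {p y : P} : y ∈ unstableManifold Φ {p} ↔ Tendsto (fun t => Φ t y) atBot (𝓝 p) := by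
  rw [unstableManifold, mem_ofPred_eq, nhdsSet_singleton]

/-- Time reversal: unstable manifolds need no separate treatment once stable manifolds of `-A` are
understood. -/
theorem unstableManifold_projFlow (A : V →L[ℂ] V) (p : ℙ ℂ V) :
    unstableManifold (projFlow A) {p} = stableManifold (projFlow (-A)) {p} := by
  ext y
  rw [mem_stableManifold_singleton, mem_unstableManifold_singleton]
  simp only [projFlow_neg]
  constructor
  · intro h
    exact h.comp tendsto_neg_atTop_atBot
  · intro h
    simpa [Function.comp_def] using h.comp tendsto_neg_atBot_atTop

omit [FiniteDimensional ℂ V] in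
theorem smul_eigenvector {A : V →L[ℂ] V} {v : V} {a : ℝ} (hv : A v = a • v) (c : ℂ) :
    A (c • v) = a • c • v := by
  rw [map_smul, hv, smul_comm]

/-- The stable manifold of the fixed point `[v]` in `ℙ(V)`. -/
theorem projPi_mem_stableManifold_iff [CompleteSpace V] {A : V →L[ℂ] V} (hA : star A = A) {a : ℝ}
    {v w : PuncturedSpace V} (hv : A v.1 = a • v.1) :
    projPi w ∈ stableManifold (projFlow A) {projPi v} ↔
      ∃ c : ℂ, c ≠ 0 ∧ w.1 - c • v.1 ∈ spectralSubspace A (Iio a) := by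
  rw [mem_stableManifold_singleton]
  constructor
  · intro h
    -- The flow carries `[w]` to the line of its leading component; uniqueness of limits makes that
    -- component a multiple of `v`.
    obtain ⟨b, u, hu0, hu, hwu⟩ := exists_leading_component hA w.2
    have h1 := tendsto_projFlow_leading (v := ⟨u, hu0⟩) hu hwu
    obtain ⟨c, hc, huv⟩ := exists_smul_of_projPi_eq (tendsto_nhds_unique h1 h)
    refine ⟨c, hc, ?_⟩
    simp only at huv
    have hab : a = b := by
      have h2 := smul_eigenvector hv c
      rw [← huv, hu] at h2
      exact (smul_left_injective ℝ hu0 h2).symm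
    rwa [hab, ← huv]
  · rintro ⟨c, hc, h⟩
    have hne : c • v.1 ≠ 0 := smul_ne_zero hc v.2
    have h1 := tendsto_projFlow_leading (v := ⟨c • v.1, hne⟩) (smul_eigenvector hv c) h
    rwa [projPi_eq_of_smul (v := ⟨c • v.1, hne⟩) (w := v) rfl] at h1

end SpectralSubspaces

/-! ### The Lie algebra of a closed subgroup, its `ad X`-decomposition, and openness of orbit maps.
-/

noncomputable section LieAlgebraOfClosedSubgroup

variable {V : Type*} [NormedAddCommGroup V] [InnerProductSpace ℂ V] [FiniteDimensional ℂ V]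

theorem finiteDimensional_real_clm : FiniteDimensional ℝ (V →L[ℂ] V) := by
  have : FiniteDimensional ℂ (V →L[ℂ] V) := inferInstance
  exact FiniteDimensional.complexToReal _

theorem properSpace_clm : ProperSpace (V →L[ℂ] V) :=
  have := finiteDimensional_real_clm (V := V)
  FiniteDimensional.proper ℝ (V →L[ℂ] V)

theorem continuous_expUnit : Continuous (expUnit : (V →L[ℂ] V) → (V →L[ℂ] V)ˣ) := by
  have h : Continuous (NormedSpace.exp : (V →L[ℂ] V) → (V →L[ℂ] V)) :=
    (contDiff_exp_clm (n := 0)).continuous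
  rw [Units.continuous_iff]
  refine ⟨h, ?_⟩
  simp only [← expUnit_neg]
  exact h.comp continuous_neg

theorem expUnit_nsmul (n : ℕ) (A : V →L[ℂ] V) : expUnit (n • A) = expUnit A ^ n := by
  induction n with
  | zero => rw [zero_smul, expUnit_zero, pow_zero]
  | succ n ih =>
    rw [succ_nsmul, pow_succ, ← ih]
    exact expUnit_add_of_commute ((Commute.refl A).smul_left n)

theorem expUnit_zsmul (n : ℤ) (A : V →L[ℂ] V) : expUnit (n • A) = expUnit A ^ n := by
  cases n with
  | ofNat n => simpa using expUnit_nsmul n A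
  | negSucc n =>
    rw [negSucc_zsmul, zpow_negSucc, expUnit_neg, expUnit_nsmul]

theorem mem_lieAlgebraOf_iff [CompleteSpace V] {G : Subgroup (V →L[ℂ] V)ˣ} {Y : V →L[ℂ] V} :
    Y ∈ lieAlgebraOf G ↔ ∀ t : ℝ, expUnit (t • Y) ∈ G := by
  refine forall_congr' fun t => ⟨?_, fun h => ⟨_, h, rfl⟩⟩
  rintro ⟨g, hg, h⟩
  rwa [show expUnit (t • Y) = g from Units.ext h.symm]

variable [CompleteSpace V] {G : Subgroup (V →L[ℂ] V)ˣ} {𝔤 : Submodule ℝ (V →L[ℂ] V)}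

theorem expUnit_mem (h𝔤 : (𝔤 : Set (V →L[ℂ] V)) = lieAlgebraOf G) {Y : V →L[ℂ] V} (hY : Y ∈ 𝔤) :
    expUnit Y ∈ G := by
  rw [← SetLike.mem_coe, h𝔤, mem_lieAlgebraOf_iff] at hY
  simpa using hY 1

theorem conj_mem_lieAlgebra (h𝔤 : (𝔤 : Set (V →L[ℂ] V)) = lieAlgebraOf G)
    {g : (V →L[ℂ] V)ˣ} (hg : g ∈ G) {Y : V →L[ℂ] V} (hY : Y ∈ 𝔤) :
    (g : V →L[ℂ] V) * Y * ((g⁻¹ : (V →L[ℂ] V)ˣ) : V →L[ℂ] V) ∈ 𝔤 := by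
  rw [← SetLike.mem_coe, h𝔤, mem_lieAlgebraOf_iff]
  intro t
  have h : t • ((g : V →L[ℂ] V) * Y * ((g⁻¹ : (V →L[ℂ] V)ˣ) : V →L[ℂ] V)) =
      (g : V →L[ℂ] V) * (t • Y) * ((g⁻¹ : (V →L[ℂ] V)ˣ) : V →L[ℂ] V) := by
    rw [mul_smul_comm, smul_mul_assoc]
  rw [h, expUnit_conj]
  exact G.mul_mem (G.mul_mem hg (expUnit_mem h𝔤 (𝔤.smul_mem t hY))) (G.inv_mem hg)

/-- The commutator is the derivative at `0` of `e^{tX} Y e^{-tX}`, a curve in the closed subspace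
`𝔤`. -/
theorem commutator_mem_lieAlgebra (h𝔤 : (𝔤 : Set (V →L[ℂ] V)) = lieAlgebraOf G)
    {X Y : V →L[ℂ] V} (hX : X ∈ 𝔤) (hY : Y ∈ 𝔤) : X * Y - Y * X ∈ 𝔤 := by
  have := finiteDimensional_real_clm (V := V)
  have h1 : HasDerivAt (fun t : ℝ => NormedSpace.exp (t • X) * Y * NormedSpace.exp (t • (-X)))
      (X * Y - Y * X) 0 := by
    have h := ((hasDerivAt_exp_smul X 0).mul_const Y).mul (hasDerivAt_exp_smul (-X) 0)
    refine h.congr_deriv ?_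
    simp [sub_eq_add_neg]
  have h2 := hasDerivAt_iff_tendsto_slope.1 h1
  refine 𝔤.closed_of_finiteDimensional.mem_of_tendsto h2 (Eventually.of_forall fun t => ?_)
  have h3 : ∀ t : ℝ, NormedSpace.exp (t • X) * Y * NormedSpace.exp (t • (-X)) ∈ 𝔤 := by
    intro t
    have h := conj_mem_lieAlgebra h𝔤 (expUnit_mem h𝔤 (𝔤.smul_mem t hX)) hY
    rwa [← expUnit_neg, ← smul_neg] at h
  exact 𝔤.smul_mem _ (𝔤.sub_mem (h3 t) (h3 0))

/-- The commutator with `X` as a real-linear operator on `End(V)`. -/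
def adReal (X : V →L[ℂ] V) : Module.End ℝ (V →L[ℂ] V) :=
  LinearMap.mulLeft ℝ X - LinearMap.mulRight ℝ X

omit [FiniteDimensional ℂ V] [CompleteSpace V] in
theorem adReal_apply (X Y : V →L[ℂ] V) : adReal X Y = X * Y - Y * X := rfl

/-- For an orthonormal eigenbasis `b` and an eigenvector `u` with eigenvalue `a`, the rank-one
operator `⟨b j, ·⟩ u` is an eigenvector of `ad X` with eigenvalue `a - l j`. Such operators span
`End(V)`. -/
theorem iSup_eigenspace_adReal {X : V →L[ℂ] V} (hX : star X = X) :
    ⨆ c : ℝ, (adReal X).eigenspace c = ⊤ := by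
  obtain ⟨b, l, hb⟩ := exists_orthonormal_eigenbasis hX
  have h : ∀ (j) (u : V), InnerProductSpace.rankOne ℂ u (b j) ∈
      ⨆ c : ℝ, (adReal X).eigenspace c := by
    intro j u
    have hu : u ∈ spectralSubspace X univ := by
      rw [spectralSubspace_univ hX]
      trivial
    refine spectralSubspace_induction (P := fun u => InnerProductSpace.rankOne ℂ u (b j) ∈
      ⨆ c : ℝ, (adReal X).eigenspace c) (fun a _ u hu => ?_) (by simp)
      (fun u w hu hw => by simpa using add_mem hu hw) hu
    refine Submodule.mem_iSup_of_mem (a - l j) ?_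
    rw [Module.End.mem_eigenspace_iff, adReal_apply]
    ext v
    have h1 : ⟪b j, X v⟫_ℂ = l j • ⟪b j, v⟫_ℂ := by
      rw [← inner_self_adjoint_comm hX, hb, ← Complex.coe_smul, inner_smul_left,
        Complex.conj_ofReal, Complex.real_smul]
    simp only [sub_apply, mul_apply_eq_comp, smul_apply, InnerProductSpace.rankOne_apply,
      map_smul, hu, h1]
    rw [smul_comm, sub_smul, smul_assoc]
  rw [eq_top_iff]
  intro Y _
  have hY : Y = ∑ j, InnerProductSpace.rankOne ℂ (Y (b j)) (b j) := by
    ext v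
    conv_lhs => rw [← b.sum_repr v, map_sum]
    simp [b.repr_apply_apply]
  rw [hY]
  exact Submodule.sum_mem _ fun j _ => h j _

/-- The sum of the eigenspaces of `ad X` on `𝔤` with eigenvalues in `s`. -/
def adSubspace (X : V →L[ℂ] V) (𝔤 : Submodule ℝ (V →L[ℂ] V)) (s : Set ℝ) :
    Submodule ℝ (V →L[ℂ] V) :=
  ⨆ c ∈ s, 𝔤 ⊓ (adReal X).eigenspace c

omit [FiniteDimensional ℂ V] [CompleteSpace V] in
theorem adSubspace_le (X : V →L[ℂ] V) (𝔤 : Submodule ℝ (V →L[ℂ] V)) (s : Set ℝ) :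
    adSubspace X 𝔤 s ≤ 𝔤 := iSup₂_le fun _ _ => inf_le_left

omit [FiniteDimensional ℂ V] [CompleteSpace V] in
theorem adSubspace_induction {X : V →L[ℂ] V} {s : Set ℝ} {P : (V →L[ℂ] V) → Prop}
    (hmem : ∀ c ∈ s, ∀ Y ∈ 𝔤, X * Y - Y * X = c • Y → P Y) (h0 : P 0)
    (hadd : ∀ Y Z, P Y → P Z → P (Y + Z)) {Y : V →L[ℂ] V} (hY : Y ∈ adSubspace X 𝔤 s) : P Y := by
  refine Submodule.iSup_induction _ (motive := P) hY (fun c Z hZ => ?_) h0 hadd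
  refine Submodule.iSup_induction _ (motive := P) hZ (fun hc Z hZ => ?_) h0 hadd
  exact hmem c hc Z hZ.1 (Module.End.mem_eigenspace_iff.1 hZ.2)

/-- A subspace invariant under a diagonalizable operator is the sum of its intersections with the
eigenspaces. Here they are grouped by the sign of the eigenvalue. -/
theorem adSubspace_decomposition (h𝔤 : (𝔤 : Set (V →L[ℂ] V)) = lieAlgebraOf G) {X : V →L[ℂ] V}
    (hX : star X = X) (hX𝔤 : X ∈ 𝔤) {Y : V →L[ℂ] V} (hY : Y ∈ 𝔤) :
    ∃ Y₀ ∈ 𝔤, ∃ Y₁ ∈ adSubspace X 𝔤 (Iio 0), ∃ Y₂ ∈ adSubspace X 𝔤 (Ioi 0),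
      X * Y₀ = Y₀ * X ∧ Y = Y₀ + Y₁ + Y₂ := by
  have := finiteDimensional_real_clm (V := V)
  -- The final argument `1` selects ordinary eigenspaces among the generalized ones.
  have h := Submodule.inf_iSup_genEigenspace (f := adReal X) (p := 𝔤)
    (fun Z hZ => commutator_mem_lieAlgebra h𝔤 hX𝔤 hZ) 1
  have h1 : Y ∈ ⨆ c : ℝ, 𝔤 ⊓ (adReal X).eigenspace c := by
    have h2 : 𝔤 ⊓ ⨆ c : ℝ, (adReal X).eigenspace c =
      ⨆ c : ℝ, 𝔤 ⊓ (adReal X).eigenspace c := h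
    rw [← h2, iSup_eigenspace_adReal hX]
    exact ⟨hY, trivial⟩
  refine Submodule.iSup_induction _ (motive := fun Y => ∃ Y₀ ∈ 𝔤,
    ∃ Y₁ ∈ adSubspace X 𝔤 (Iio 0), ∃ Y₂ ∈ adSubspace X 𝔤 (Ioi 0),
      X * Y₀ = Y₀ * X ∧ Y = Y₀ + Y₁ + Y₂) h1 (fun c Z hZ => ?_)
    ⟨0, 𝔤.zero_mem, 0, zero_mem _, 0, zero_mem _, by simp⟩ ?_
  · have hle : ∀ s : Set ℝ, c ∈ s → Z ∈ adSubspace X 𝔤 s := fun s hc =>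
      (le_iSup₂_of_le (f := fun c (_ : c ∈ s) => 𝔤 ⊓ (adReal X).eigenspace c) c hc le_rfl) hZ
    rcases lt_trichotomy c 0 with hc | hc | hc
    · exact ⟨0, 𝔤.zero_mem, Z, hle _ hc, 0, zero_mem _, by simp⟩
    · refine ⟨Z, hZ.1, 0, zero_mem _, 0, zero_mem _, ?_, by simp⟩
      have h3 := Module.End.mem_eigenspace_iff.1 hZ.2
      rwa [hc, zero_smul, adReal_apply, sub_eq_zero] at h3
    · exact ⟨0, 𝔤.zero_mem, 0, zero_mem _, Z, hle _ hc, by simp⟩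
  · rintro Y Z ⟨Y₀, hY₀, Y₁, hY₁, Y₂, hY₂, hc, rfl⟩ ⟨Z₀, hZ₀, Z₁, hZ₁, Z₂, hZ₂, hc', rfl⟩
    refine ⟨Y₀ + Z₀, add_mem hY₀ hZ₀, Y₁ + Z₁, add_mem hY₁ hZ₁, Y₂ + Z₂, add_mem hY₂ hZ₂, ?_, ?_⟩
    · rw [mul_add, add_mul, hc, hc']
    · abel

omit [FiniteDimensional ℂ V] [CompleteSpace V] in
theorem adReal_neg (X Y : V →L[ℂ] V) : adReal (-X) Y = -adReal X Y := by
  simp only [adReal_apply, neg_mul, mul_neg]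
  abel

omit [FiniteDimensional ℂ V] [CompleteSpace V] in
-- Under `X ↦ -X` raising and lowering operators exchange roles, as the stable and unstable
-- manifolds do.
theorem adSubspace_neg_Iio (X : V →L[ℂ] V) (𝔤 : Submodule ℝ (V →L[ℂ] V)) :
    adSubspace (-X) 𝔤 (Iio 0) = adSubspace X 𝔤 (Ioi 0) := by
  have h : ∀ c : ℝ, (adReal (-X)).eigenspace c = (adReal X).eigenspace (-c) := by
    intro c
    ext Y
    rw [Module.End.mem_eigenspace_iff, Module.End.mem_eigenspace_iff, adReal_neg, neg_smul,
      neg_eq_iff_eq_neg]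
  apply le_antisymm
  · refine iSup₂_le fun c hc => ?_
    rw [h]
    exact le_iSup₂_of_le (f := fun c (_ : c ∈ Ioi (0 : ℝ)) => 𝔤 ⊓ (adReal X).eigenspace c) (-c)
      (by simpa using hc) le_rfl
  · refine iSup₂_le fun c hc => ?_
    have h' := h (-c)
    rw [neg_neg] at h'
    rw [← h']
    exact le_iSup₂_of_le (f := fun c (_ : c ∈ Iio (0 : ℝ)) => 𝔤 ⊓ (adReal (-X)).eigenspace c) (-c)
      (by simpa using hc) le_rfl

omit [FiniteDimensional ℂ V] [CompleteSpace V] in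
theorem lowering_apply_mem {X Y : V →L[ℂ] V} (hY : Y ∈ adSubspace X 𝔤 (Iio 0)) {a : ℝ} {v : V}
    (hv : v ∈ spectralSubspace X (Iic a)) : Y v ∈ spectralSubspace X (Iio a) := by
  refine adSubspace_induction (P := fun Y => Y v ∈ spectralSubspace X (Iio a))
    (fun c hc Y _ h => ?_) (by simp) (fun Y Z hY hZ => by simpa using add_mem hY hZ) hY
  refine map_mem_spectralSubspace h (fun b hb => ?_) hv
  exact mem_Iio.2 (by linarith [mem_Iio.1 hc, mem_Iic.1 hb])

omit [FiniteDimensional ℂ V] [CompleteSpace V] in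
theorem raising_apply_mem {X Y : V →L[ℂ] V} (hY : Y ∈ adSubspace X 𝔤 (Ioi 0)) {a : ℝ} {v : V}
    (hv : v ∈ spectralSubspace X (Ici a)) : Y v ∈ spectralSubspace X (Ioi a) := by
  refine adSubspace_induction (P := fun Y => Y v ∈ spectralSubspace X (Ioi a))
    (fun c hc Y _ h => ?_) (by simp) (fun Y Z hY hZ => by simpa using add_mem hY hZ) hY
  refine map_mem_spectralSubspace h (fun b hb => ?_) hv
  exact mem_Ioi.2 (by linarith [mem_Ioi.1 hc, mem_Ici.1 hb])

omit [CompleteSpace V] in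
theorem exp_lowering_sub_mem {X Y : V →L[ℂ] V} (hY : Y ∈ adSubspace X 𝔤 (Iio 0)) {a : ℝ} {v : V}
    (hv : v ∈ spectralSubspace X (Iic a)) :
    (expUnit Y : V →L[ℂ] V) v - v ∈ spectralSubspace X (Iio a) :=
  exp_apply_sub_mem (fun _ => lowering_apply_mem hY)
    (spectralSubspace_mono X Iio_subset_Iic_self) hv

omit [CompleteSpace V] in
theorem exp_raising_sub_mem {X Y : V →L[ℂ] V} (hY : Y ∈ adSubspace X 𝔤 (Ioi 0)) {a : ℝ} {v : V}
    (hv : v ∈ spectralSubspace X (Ici a)) :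
    (expUnit Y : V →L[ℂ] V) v - v ∈ spectralSubspace X (Ioi a) :=
  exp_apply_sub_mem (fun _ => raising_apply_mem hY)
    (spectralSubspace_mono X Ioi_subset_Ici_self) hv

/-- A subspace transverse to the Lie algebra of a closed subgroup meets the subgroup, through the
exponential map, only in the identity near zero. -/
theorem eventually_eq_zero_of_expUnit_mem (hG : IsClosed (G : Set (V →L[ℂ] V)ˣ))
    (h𝔤 : (𝔤 : Set (V →L[ℂ] V)) = lieAlgebraOf G) {𝔠 : Submodule ℝ (V →L[ℂ] V)}
    (hd : Disjoint 𝔤 𝔠) : ∀ᶠ C in 𝓝 (0 : V →L[ℂ] V), C ∈ 𝔠 → expUnit C ∈ G → C = 0 := by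
  have := finiteDimensional_real_clm (V := V)
  have := properSpace_clm (V := V)
  by_contra hcon
  obtain ⟨C, hC0, hC⟩ := exists_seq_forall_of_frequently (not_eventually.1 hcon)
  push Not at hC
  have hnorm : ∀ n, 0 < ‖C n‖ := fun n => norm_pos_iff.2 (hC n).2.2
  -- A sequence of counterexamples tending to `0` has directions that accumulate at a unit vector `u
  -- ∈ 𝔠`. The contradiction comes from `u ∈ 𝔤`.
  obtain ⟨u, hu, φ, hφ, hlim⟩ := (isCompact_sphere (0 : V →L[ℂ] V) 1).tendsto_subseq
    (x := fun n => ‖C n‖⁻¹ • C n) fun n => by simp [norm_smul, (hnorm n).ne']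
  have hu𝔠 : u ∈ 𝔠 := 𝔠.closed_of_finiteDimensional.mem_of_tendsto hlim
    (Eventually.of_forall fun n => 𝔠.smul_mem _ (hC _).1)
  have hu𝔤 : u ∈ 𝔤 := by
    rw [← SetLike.mem_coe, h𝔤, mem_lieAlgebraOf_iff]
    intro t
    have hn0 : Tendsto (fun n => ‖C (φ n)‖) atTop (𝓝 0) := by
      simpa using (hC0.comp hφ.tendsto_atTop).norm
    -- Integer multiples of `C (φ n)` approximate `t • u` because the step size tends to `0`. Their
    -- exponentials are powers of elements of `G`, so the closed group contains `e^{tu}`.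
    have hr : Tendsto (fun n => (⌊t / ‖C (φ n)‖⌋ : ℝ) * ‖C (φ n)‖) atTop (𝓝 t) := by
      rw [tendsto_iff_norm_sub_tendsto_zero]
      refine squeeze_zero (fun n => norm_nonneg _) (fun n => ?_) hn0
      have hp := hnorm (φ n)
      have h1 := Int.floor_le (t / ‖C (φ n)‖)
      have h2 := Int.lt_floor_add_one (t / ‖C (φ n)‖)
      rw [le_div_iff₀ hp] at h1
      rw [div_lt_iff₀ hp] at h2
      rw [Real.norm_eq_abs, abs_le]
      constructor <;> nlinarith
    have h3 : Tendsto (fun n => (⌊t / ‖C (φ n)‖⌋ : ℤ) • C (φ n)) atTop (𝓝 (t • u)) := by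
      refine (hr.smul hlim).congr fun n => ?_
      simp only [Function.comp_apply]
      rw [smul_smul, mul_assoc, mul_inv_cancel₀ (hnorm _).ne', mul_one, Int.cast_smul_eq_zsmul]
    refine hG.mem_of_tendsto ((continuous_expUnit.tendsto _).comp h3)
      (Eventually.of_forall fun n => ?_)
    simp only [Function.comp_apply, expUnit_zsmul]
    exact G.zpow_mem (hC _).2.1 _
  have h0 : u = 0 := by
    have := hd.le_bot (show u ∈ 𝔤 ⊓ 𝔠 from ⟨hu𝔤, hu𝔠⟩)
    simpa using this
  rw [h0] at hu
  simp at hu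

/-- `GL(V)` is closed in `End(V) × End(V)ᵒᵖ` through `g ↦ (g, g⁻¹)`. This supplies the countability
needed for the open mapping argument on orbits. -/
theorem sigmaCompactSpace_of_isClosed (hG : IsClosed (G : Set (V →L[ℂ] V)ˣ)) :
    SigmaCompactSpace G := by
  have := properSpace_clm (V := V)
  have h2 : SigmaCompactSpace (V →L[ℂ] V)ᵐᵒᵖ :=
    MulOpposite.opHomeomorph.symm.isClosedEmbedding.sigmaCompactSpace
  have h3 : SigmaCompactSpace (V →L[ℂ] V)ˣ := Units.isClosedEmbedding_embedProduct.sigmaCompactSpace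
  exact hG.isClosedEmbedding_subtypeVal.sigmaCompactSpace

/-- The orbit map onto a closed orbit is open. -/
theorem exists_nhds_inter_orbit_subset (hG : IsClosed (G : Set (V →L[ℂ] V)ˣ)) {x : ℙ ℂ V}
    (hx : IsClosed (MulAction.orbit G x)) {N : Set (V →L[ℂ] V)ˣ} (hN : N ∈ 𝓝 1) :
    ∃ O ∈ 𝓝 x, ∀ y ∈ O, y ∈ MulAction.orbit G x → ∃ g ∈ G, g ∈ N ∧ y = g • x := by
  have := sigmaCompactSpace_of_isClosed hG
  have : CompactSpace (MulAction.orbit G x) := isCompact_iff_compactSpace.1 hx.isCompact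
  have : ContinuousSMul G (MulAction.orbit G x) := by
    refine ⟨Continuous.subtype_mk ?_ _⟩
    exact (continuous_subtype_val.comp continuous_fst).smul
      (continuous_subtype_val.comp continuous_snd)
  have hU : (Subtype.val ⁻¹' N : Set G) ∈ 𝓝 1 := continuous_subtype_val.continuousAt hN
  -- Open mapping theorem by Baire category: a σ-compact group acts transitively on a compact
  -- Hausdorff space. This is where closedness of the orbit is used.
  have h := smul_singleton_mem_nhds_of_sigmaCompact hU
    (⟨x, MulAction.mem_orbit_self x⟩ : MulAction.orbit G x)
  obtain ⟨O, hO, hsub⟩ := mem_nhds_subtype _ _ _ |>.1 h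
  refine ⟨O, hO, fun y hy hyo => ?_⟩
  have h1 : (⟨y, hyo⟩ : MulAction.orbit G x) ∈ _ := hsub hy
  obtain ⟨g, hg, z, hz, h2⟩ := h1
  rw [mem_singleton_iff] at hz
  subst hz
  exact ⟨g, g.2, hg, (congrArg Subtype.val h2).symm⟩

end LieAlgebraOfClosedSubgroup

/-! ### Slice charts built from parametrizations, and their transport by `GL(V)`. -/

noncomputable section Slices

/-- Inverse function theorem with a smooth inverse on a ball. -/
theorem exists_smooth_inverse_on_ball {E F : Type*} [NormedAddCommGroup E] [NormedSpace ℝ E]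
    [CompleteSpace E] [NormedAddCommGroup F] [NormedSpace ℝ F] {f : E → F} {Ω : Set E}
    (hΩ : IsOpen Ω) (h0 : (0 : E) ∈ Ω) (hf : ContDiffOn ℝ ∞ f Ω) {A : E ≃L[ℝ] F}
    (hA : HasFDerivAt f (A : E →L[ℝ] F) 0) :
    ∃ r > 0, ∃ h : OpenPartialHomeomorph E F, h.source = Metric.ball 0 r ∧
      Metric.ball 0 r ⊆ Ω ∧ (∀ x, h x = f x) ∧ ContDiffOn ℝ ∞ h h.source ∧
        ContDiffOn ℝ ∞ h.symm h.target := by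
  have hfx : ∀ x ∈ Ω, ContDiffAt ℝ ∞ f x := fun x hx => hf.contDiffAt (hΩ.mem_nhds hx)
  have hs : HasStrictFDerivAt f (A : E →L[ℝ] F) 0 := (hfx 0 h0).hasStrictFDerivAt' hA (by simp)
  let h₁ := hs.toOpenPartialHomeomorph f
  have hcoe : ∀ x, h₁ x = f x := fun x => rfl
  have hcont : ContinuousAt (fderiv ℝ f) 0 :=
    ((hfx 0 h0).fderiv_right (m := 0) (by simp)).continuousAt
  -- The derivative stays invertible near `0`. On a ball where it does, the local inverse is smooth
  -- on its whole domain and not only at one point.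
  have hev : ∀ᶠ x in 𝓝 (0 : E), x ∈ h₁.source ∩ Ω ∧
      fderiv ℝ f x ∈ range ((↑) : (E ≃L[ℝ] F) → E →L[ℝ] F) := by
    refine Filter.Eventually.and (inter_mem (h₁.open_source.mem_nhds
      hs.mem_toOpenPartialHomeomorph_source) (hΩ.mem_nhds h0)) (hcont ?_)
    rw [hA.fderiv]
    exact ContinuousLinearEquiv.nhds A
  obtain ⟨r, hr, hball⟩ := Metric.eventually_nhds_iff_ball.1 hev
  have hsrc : (h₁.restr (Metric.ball 0 r)).source = Metric.ball 0 r := by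
    rw [OpenPartialHomeomorph.restr_source, Metric.isOpen_ball.interior_eq]
    exact inter_eq_right.2 fun x hx => (hball x hx).1.1
  refine ⟨r, hr, h₁.restr (Metric.ball 0 r), hsrc, fun x hx => (hball x hx).1.2,
    fun x => rfl, ?_, ?_⟩
  · rw [hsrc]
    exact hf.mono fun x hx => (hball x hx).1.2
  · intro y hy
    have hx : (h₁.restr (Metric.ball 0 r)).symm y ∈ Metric.ball 0 r := by
      rw [← hsrc]
      exact (h₁.restr (Metric.ball 0 r)).map_target hy
    obtain ⟨⟨-, hxΩ⟩, B, hB⟩ := hball _ hx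
    have hd : HasFDerivAt (h₁.restr (Metric.ball 0 r)) (B : E →L[ℝ] F)
        ((h₁.restr (Metric.ball 0 r)).symm y) := by
      rw [hB]
      exact ((hfx _ hxΩ).differentiableAt (by simp)).hasFDerivAt
    exact ((h₁.restr (Metric.ball 0 r)).contDiffAt_symm hy hd (hfx _ hxΩ)).contDiffWithinAt

/-- Near `p`, some smooth chart maps `S` to a linear subspace. -/
def IsSliceAt (E : Type*) [NormedAddCommGroup E] [NormedSpace ℝ E]
    {P : Type*} [TopologicalSpace P] [ChartedSpace E P] (S : Set P) (p : P) : Prop :=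
  ∃ e ∈ IsManifold.maximalAtlas 𝓘(ℝ, E) ∞ P, ∃ F : Submodule ℝ E,
    p ∈ e.source ∧ e '' (e.source ∩ S) = e.target ∩ F

theorem trans_mem_maximalAtlas {H M : Type*} [TopologicalSpace H] [TopologicalSpace M]
    [ChartedSpace H M] {G : StructureGroupoid H} {e : OpenPartialHomeomorph M H}
    (he : e ∈ G.maximalAtlas M) {k : OpenPartialHomeomorph H H} (hk : k ∈ G) :
    e.trans k ∈ G.maximalAtlas M := by
  rw [mem_maximalAtlas_iff] at he ⊢
  intro e' he'
  obtain ⟨h1, h2⟩ := he e' he'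
  constructor
  · rw [OpenPartialHomeomorph.trans_symm_eq_symm_trans_symm, OpenPartialHomeomorph.trans_assoc]
    exact G.trans (G.symm hk) h1
  · rw [← OpenPartialHomeomorph.trans_assoc]
    exact G.trans h2 hk

/-- Charts must take values in the model space `E`; the linear isomorphism carries the parameter
space `E'` there. -/
theorem trans_mem_contDiffGroupoid {E E' : Type*} [NormedAddCommGroup E] [NormedSpace ℝ E]
    [NormedAddCommGroup E'] [NormedSpace ℝ E'] {h : OpenPartialHomeomorph E' E}
    (h1 : ContDiffOn ℝ ∞ h h.source) (h2 : ContDiffOn ℝ ∞ h.symm h.target) (A : E' ≃L[ℝ] E) :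
    h.symm.trans A.toHomeomorph.toOpenPartialHomeomorph ∈ contDiffGroupoid ∞ 𝓘(ℝ, E) := by
  rw [contDiffGroupoid, mem_groupoid_of_pregroupoid]
  constructor
  · simp only [contDiffPregroupoid, mfld_simps]
    exact A.contDiff.comp_contDiffOn (h2.mono fun x hx => by simpa using hx)
  · simp only [contDiffPregroupoid, mfld_simps]
    refine h1.comp A.symm.contDiff.contDiffOn fun x hx => ?_
    simpa using hx

variable {V : Type*} [NormedAddCommGroup V] [InnerProductSpace ℂ V] [FiniteDimensional ℂ V]

/-- A parametrization `x ↦ [γ x]` of a neighbourhood of `[γ 0]` is inverse to a smooth chart, up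
to a linear isomorphism. -/
theorem exists_chart_of_parametrization {E : Type*} [NormedAddCommGroup E] [NormedSpace ℝ E]
    [FiniteDimensional ℝ E] {γ : E → V} (hγ : ContDiff ℝ ∞ γ) (hne : ∀ x, γ x ≠ 0)
    {L : E →L[ℝ] V} (hL : HasFDerivAt γ L 0)
    (hbij : Function.Bijective fun x => affineDeriv (adaptedCoord (projPi ⟨γ 0, hne 0⟩)) (γ 0)
      (L x)) :
    ∃ r > 0, ∃ e ∈ IsManifold.maximalAtlas 𝓘(ℝ, ProjModel V) ∞ (ℙ ℂ V),
      ∃ A : E ≃L[ℝ] ProjModel V,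
      (∀ x, A x = affineDeriv (adaptedCoord (projPi ⟨γ 0, hne 0⟩)) (γ 0) (L x)) ∧
      (∀ x ∈ Metric.ball (0 : E) r, projPi ⟨γ x, hne x⟩ ∈ e.source ∧
        e (projPi ⟨γ x, hne x⟩) = A x) ∧
      (∀ y ∈ e.source, A.symm (e y) ∈ Metric.ball (0 : E) r ∧
        projPi ⟨γ (A.symm (e y)), hne _⟩ = y) ∧
      ∀ (w : ℝ → V) (w' : V) (hw : ∀ t, w t ≠ 0), w 0 = γ 0 → HasDerivAt w w' 0 →
        HasDerivAt (fun t => A.symm (e (projPi ⟨w t, hw t⟩)))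
          (A.symm (affineDeriv (adaptedCoord (projPi ⟨γ 0, hne 0⟩)) (γ 0) w')) 0 := by
  have hcE : CompleteSpace E := FiniteDimensional.complete ℝ E
  set T := adaptedCoord (projPi ⟨γ 0, hne 0⟩) with hT
  have hTv : (T (γ 0)).1 ≠ 0 := adaptedCoord_fst_ne_zero ⟨γ 0, hne 0⟩
  let Alin : E ≃ₗ[ℝ] ProjModel V := LinearEquiv.ofBijective
    ((affineDeriv T (γ 0)).comp L).toLinearMap hbij
  let A : E ≃L[ℝ] ProjModel V := Alin.toContinuousLinearEquiv
  have hA : ∀ x, A x = affineDeriv T (γ 0) (L x) := fun x => rfl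
  clear_value A
  let Ω : Set E := {x | (T (γ x)).1 ≠ 0}
  have hΩ : IsOpen Ω := isOpen_ne_fun
    (continuous_fst.comp (T.continuous.comp hγ.continuous)) continuous_const
  have hfsmooth : ContDiffOn ℝ ∞ (fun x => affineFun T (γ x)) Ω := fun x hx =>
    ((contDiffAt_affineFun T hx).comp x hγ.contDiffAt).contDiffWithinAt
  have hfd : HasFDerivAt (fun x => affineFun T (γ x)) (A : E →L[ℝ] ProjModel V) 0 := by
    refine ((hasFDerivAt_affineFun T hTv).comp 0 hL).congr_fderiv ?_
    ext1 x
    exact (hA x).symm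
  obtain ⟨r, hr, h, hsrc, hball, hcoe, hsm, hsms⟩ :=
    exists_smooth_inverse_on_ball hΩ hTv hfsmooth hfd
  have h0 : (0 : E) ∈ Metric.ball (0 : E) r := Metric.mem_ball_self hr
  have hκsrc : ∀ x ∈ Metric.ball (0 : E) r, projPi ⟨γ x, hne x⟩ ∈ (affineChart T).source :=
    fun x hx => (mem_affineChart_source T (hne x)).2 (hball hx)
  have hκγ : ∀ x, affineChart T (projPi ⟨γ x, hne x⟩) = h x := fun x =>
    (affineCoord_eq_affineFun T (hne x)).trans (hcoe x).symm
  -- The new chart is the affine chart followed by the inverse of the parametrization in that chart,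
  -- so that `[γ x]` has coordinate `A x`.
  let k := h.symm.trans A.toHomeomorph.toOpenPartialHomeomorph
  have hk : k ∈ contDiffGroupoid ∞ 𝓘(ℝ, ProjModel V) := trans_mem_contDiffGroupoid hsm hsms A
  have hesrc : ∀ y, y ∈ ((affineChart T).trans k).source ↔
      y ∈ (affineChart T).source ∧ affineChart T y ∈ h.target := by
    intro y
    simp only [k, OpenPartialHomeomorph.trans_source, OpenPartialHomeomorph.symm_source,
      Homeomorph.toOpenPartialHomeomorph_source, preimage_univ, inter_univ, mem_inter_iff,
      mem_preimage]
  have hee : ∀ y, ((affineChart T).trans k) y = A (h.symm (affineChart T y)) := fun y => rfl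
  refine ⟨r, hr, (affineChart T).trans k,
    trans_mem_maximalAtlas (affineChart_mem_maximalAtlas T) hk, A, hA, ?_, ?_, ?_⟩
  · intro x hx
    have hx' : x ∈ h.source := hsrc ▸ hx
    rw [hesrc, hee, hκγ]
    exact ⟨⟨hκsrc x hx, h.map_source hx'⟩, by rw [h.left_inv hx']⟩
  · intro y hy
    rw [hee, A.symm_apply_apply]
    have hy' := (hesrc y).1 hy
    have hb : h.symm (affineChart T y) ∈ Metric.ball (0 : E) r := by
      rw [← hsrc]
      exact h.map_target hy'.2
    refine ⟨hb, (affineChart T).injOn (hκsrc _ hb) hy'.1 ?_⟩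
    rw [hκγ, h.right_inv hy'.2]
  · intro w w' hw hw0 hwd
    have hh0 : h 0 = affineFun T (γ 0) := hcoe 0
    have hht : h 0 ∈ h.target := h.map_source (hsrc ▸ h0)
    have hd1 : HasDerivAt (fun t => affineFun T (w t)) (affineDeriv T (γ 0) w') 0 := by
      have hTw : HasFDerivAt (affineFun T) (affineDeriv T (γ 0)) (w 0) := by
        rw [hw0]
        exact hasFDerivAt_affineFun T hTv
      exact hTw.comp_hasDerivAt 0 hwd
    have hd2 : HasFDerivAt h.symm (A.symm : ProjModel V →L[ℝ] E) (affineFun T (w 0)) := by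
      rw [hw0, ← hh0]
      refine h.hasFDerivAt_symm hht ?_
      rw [h.left_inv (hsrc ▸ h0)]
      exact hfd.congr_of_eventuallyEq (Eventually.of_forall hcoe)
    have hd3 := hd2.comp_hasDerivAt (0 : ℝ) hd1
    refine hd3.congr_of_eventuallyEq (Eventually.of_forall fun t => ?_)
    simp only [hee, A.symm_apply_apply, Function.comp_apply]
    congr 1
    exact affineCoord_eq_affineFun T (hw t)

/-- A parametrized neighbourhood `x ↦ [γ x]` of `[γ 0]` turns subspaces of the parameter space into
slices, and computes the velocities of curves in them. -/
theorem exists_radius_slice {E : Type*} [NormedAddCommGroup E] [NormedSpace ℝ E]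
    [FiniteDimensional ℝ E] {γ : E → V} (hγ : ContDiff ℝ ∞ γ) (hne : ∀ x, γ x ≠ 0)
    {L : E →L[ℝ] V} (hL : HasFDerivAt γ L 0)
    (hbij : Function.Bijective fun x => affineDeriv (adaptedCoord (projPi ⟨γ 0, hne 0⟩)) (γ 0)
      (L x)) :
    ∃ r > 0, InjOn (fun x => projPi ⟨γ x, hne x⟩) (Metric.ball 0 r) ∧
      (fun x => projPi ⟨γ x, hne x⟩) '' Metric.ball 0 r ∈ 𝓝 (projPi ⟨γ 0, hne 0⟩) ∧
      ∀ (S : Set (ℙ ℂ V)) (F : Submodule ℝ E), ∀ O ∈ 𝓝 (projPi ⟨γ 0, hne 0⟩),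
        (∀ x ∈ Metric.ball 0 r, projPi ⟨γ x, hne x⟩ ∈ O → (projPi ⟨γ x, hne x⟩ ∈ S ↔ x ∈ F)) →
        IsSliceAt (ProjModel V) S (projPi ⟨γ 0, hne 0⟩) ∧
        ∀ (w : ℝ → V) (w' : V) (hw : ∀ t, w t ≠ 0), w 0 = γ 0 → HasDerivAt w w' 0 →
          (∀ᶠ t in 𝓝 0, projPi ⟨w t, hw t⟩ ∈ S) → ∃ x ∈ F, ∃ c : ℂ, w' = L x + c • γ 0 := by
  obtain ⟨r, hr, e, he, A, hA, hmem, hinv, hcurve⟩ :=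
    exists_chart_of_parametrization hγ hne hL hbij
  have hpe : projPi ⟨γ 0, hne 0⟩ ∈ e.source := (hmem 0 (Metric.mem_ball_self hr)).1
  refine ⟨r, hr, fun x hx y hy hxy => ?_, ?_, ?_⟩
  · simp only at hxy
    apply A.injective
    rw [← (hmem x hx).2, ← (hmem y hy).2, hxy]
  · refine mem_of_superset (e.open_source.mem_nhds hpe) fun y hy => ?_
    exact ⟨A.symm (e y), (hinv y hy).1, (hinv y hy).2⟩
  intro S F O hO hSF
  obtain ⟨O', hO'O, hO', hpO'⟩ := mem_nhds_iff.1 hO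
  have hkey : ∀ y ∈ e.source, y ∈ O → (y ∈ S ↔ A.symm (e y) ∈ F) := by
    intro y hy hyO
    obtain ⟨hb, hγy⟩ := hinv y hy
    have hk := hSF _ hb
    rw [hγy] at hk
    exact hk hyO
  constructor
  · have hsrc : (e.restr O').source = e.source ∩ O' := by
      rw [OpenPartialHomeomorph.restr_source, hO'.interior_eq]
    have hee : ∀ y, e.restr O' y = e y := fun y => rfl
    have key : ∀ y ∈ (e.restr O').source,
        (y ∈ S ↔ e y ∈ F.map A.toLinearEquiv.toLinearMap) := by
      intro y hy
      rw [hsrc] at hy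
      rw [hkey y hy.1 (hO'O hy.2)]
      constructor
      · exact fun hF => ⟨_, hF, A.apply_symm_apply _⟩
      · rintro ⟨x, hx, hxe⟩
        have : A x = e y := hxe
        rwa [← this, A.symm_apply_apply]
    refine ⟨e.restr O', restr_mem_maximalAtlas _ he hO', F.map A.toLinearEquiv.toLinearMap, ?_, ?_⟩
    · rw [hsrc]
      exact ⟨hpe, hpO'⟩
    · ext z
      constructor
      · rintro ⟨y, ⟨hy, hyS⟩, rfl⟩
        exact ⟨(e.restr O').map_source hy, (key y hy).1 hyS⟩
      · rintro ⟨hz, hzF⟩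
        have hz' := (e.restr O').map_target hz
        refine ⟨(e.restr O').symm z, ⟨hz', (key _ hz').2 ?_⟩, (e.restr O').right_inv hz⟩
        rw [← hee, (e.restr O').right_inv hz]
        exact hzF
  · intro w w' hw hw0 hwd hwS
    have hd := hcurve w w' hw hw0 hwd
    have hcw : Tendsto (fun t => projPi ⟨w t, hw t⟩) (𝓝 0) (𝓝 (projPi ⟨γ 0, hne 0⟩)) := by
      have hc : Tendsto (fun t => projPi ⟨w t, hw t⟩) (𝓝 0) (𝓝 (projPi ⟨w 0, hw 0⟩)) :=
        continuousAt_projPi_comp hw hwd.continuousAt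
      simpa only [hw0] using hc
    -- In the slice chart the curve runs in the closed subspace `F`, and hence so does its velocity.
    have hxev : ∀ᶠ t in 𝓝 (0 : ℝ), A.symm (e (projPi ⟨w t, hw t⟩)) ∈ F := by
      have h1 : ∀ᶠ t in 𝓝 (0 : ℝ), projPi ⟨w t, hw t⟩ ∈ e.source :=
        hcw.eventually (e.open_source.mem_nhds hpe)
      have h2 : ∀ᶠ t in 𝓝 (0 : ℝ), projPi ⟨w t, hw t⟩ ∈ O :=
        hcw.eventually hO
      filter_upwards [h1, h2, hwS] with t ht1 ht2 ht3
      exact (hkey _ ht1 ht2).1 ht3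
    set x' := A.symm (affineDeriv (adaptedCoord (projPi ⟨γ 0, hne 0⟩)) (γ 0) w') with hx'
    have hxF : x' ∈ F := by
      refine F.closed_of_finiteDimensional.mem_of_tendsto (hasDerivAt_iff_tendsto_slope.1 hd) ?_
      filter_upwards [nhdsWithin_le_nhds hxev] with t ht
      exact F.smul_mem _ (F.sub_mem ht hxev.self_of_nhds)
    refine ⟨x', hxF, ?_⟩
    -- `w'` and `L x'` represent the same tangent vector of `ℙ(V)`, so they differ by a multiple of
    -- `γ 0`.
    have h6 : dProjPi ⟨γ 0, hne 0⟩ (w' - L x') = 0 := by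
      refine (dProjPi_eq_affineDeriv ⟨γ 0, hne 0⟩ (w' - L x')).trans ?_
      rw [map_sub, ← hA, hx', A.apply_symm_apply]
      exact sub_self _
    obtain ⟨c, hc⟩ := (dProjPi_eq_zero_iff ⟨γ 0, hne 0⟩ _).1 h6
    exact ⟨c, by rw [← hc]; abel⟩

/-- The homeomorphism of `ℙ(V)` defined by an invertible operator. -/
def projHomeomorph (g : (V →L[ℂ] V)ˣ) : ℙ ℂ V ≃ₜ ℙ ℂ V := Homeomorph.smul g

omit [FiniteDimensional ℂ V] in
-- As `g` is linear, `T ∘ g` is again a system of linear coordinates. The action thus permutes the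
-- affine charts and preserves the smooth structure.
theorem projHomeomorph_trans_affineChart (g : (V →L[ℂ] V)ˣ) (T : V ≃L[ℂ] ℂ × ProjModel V) :
    (projHomeomorph g).toOpenPartialHomeomorph.trans (affineChart T) =
      affineChart ((ContinuousLinearEquiv.unitsEquiv ℂ V g).trans T) := by
  set T' := (ContinuousLinearEquiv.unitsEquiv ℂ V g).trans T with hT'
  have hT : ∀ v, T' v = T ((g : V →L[ℂ] V) v) := fun v => rfl
  refine OpenPartialHomeomorph.ext _ _ (fun p => ?_) (fun z => ?_) ?_
  · obtain ⟨v, rfl⟩ := projPi_surjective p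
    change affineCoord T (g • projPi v) = affineCoord T' (projPi v)
    rw [smul_projPi, affineCoord_projPi, affineCoord_projPi, hT]
  · change g⁻¹ • affineInv T z = affineInv T' z
    rw [inv_smul_eq_iff, affineInv, affineInv, smul_projPi]
    congr 2
    apply T.injective
    rw [T.apply_symm_apply, ← hT, T'.apply_symm_apply]
  · ext p
    obtain ⟨v, rfl⟩ := projPi_surjective p
    simp only [OpenPartialHomeomorph.trans_source, Homeomorph.toOpenPartialHomeomorph_source,
      univ_inter, mem_preimage]
    change g • projPi v ∈ (affineChart T).source ↔ _
    rw [smul_projPi]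
    exact (mem_affineChart_source T _).trans (mem_affineChart_source T' v.2).symm

theorem projHomeomorph_trans_mem_maximalAtlas (g : (V →L[ℂ] V)ˣ)
    {e : OpenPartialHomeomorph (ℙ ℂ V) (ProjModel V)}
    (he : e ∈ IsManifold.maximalAtlas 𝓘(ℝ, ProjModel V) ∞ (ℙ ℂ V)) :
    (projHomeomorph g).toOpenPartialHomeomorph.trans e ∈
      IsManifold.maximalAtlas 𝓘(ℝ, ProjModel V) ∞ (ℙ ℂ V) := by
  unfold IsManifold.maximalAtlas at he ⊢
  rw [mem_maximalAtlas_iff] at he ⊢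
  rintro _ ⟨S, rfl⟩
  have hS := projHomeomorph_trans_affineChart g⁻¹ S
  obtain ⟨h1, h2⟩ := he _ (chart_mem_atlas_affine
    ((ContinuousLinearEquiv.unitsEquiv ℂ V g⁻¹).trans S))
  have hsymm : (projHomeomorph g⁻¹).toOpenPartialHomeomorph =
      (projHomeomorph g).toOpenPartialHomeomorph.symm := by
    refine OpenPartialHomeomorph.ext _ _ (fun p => rfl) (fun p => ?_) rfl
    change g⁻¹⁻¹ • p = g • p
    rw [inv_inv]
  rw [← hS, hsymm] at h1 h2
  constructor
  · rw [OpenPartialHomeomorph.trans_symm_eq_symm_trans_symm, OpenPartialHomeomorph.trans_assoc]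
    exact h1
  · rw [OpenPartialHomeomorph.trans_symm_eq_symm_trans_symm, OpenPartialHomeomorph.symm_symm,
      OpenPartialHomeomorph.trans_assoc] at h2
    exact h2

/-- A slice found at one convenient point is pulled back by a group element that preserves `S`;
hence slices have to be built only at or near critical points. -/
theorem IsSliceAt.of_smul {g : (V →L[ℂ] V)ˣ} {S : Set (ℙ ℂ V)} {p : ℙ ℂ V}
    (hS : ∀ q, g • q ∈ S ↔ q ∈ S) (h : IsSliceAt (ProjModel V) S (g • p)) :
    IsSliceAt (ProjModel V) S p := by
  obtain ⟨e, he, F, hp, heq⟩ := h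
  refine ⟨_, projHomeomorph_trans_mem_maximalAtlas g he, F, ?_, ?_⟩
  · rw [OpenPartialHomeomorph.trans_source]
    exact ⟨mem_univ p, hp⟩
  · have hsrc : ∀ q, q ∈ ((projHomeomorph g).toOpenPartialHomeomorph.trans e).source ↔
        g • q ∈ e.source := by
      intro q
      simp only [OpenPartialHomeomorph.trans_source, Homeomorph.toOpenPartialHomeomorph_source,
        univ_inter, mem_preimage]
      rfl
    have htgt : ((projHomeomorph g).toOpenPartialHomeomorph.trans e).target = e.target := by
      simp
    rw [htgt, ← heq]
    ext z
    constructor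
    · rintro ⟨q, ⟨hq, hqS⟩, rfl⟩
      exact ⟨g • q, ⟨(hsrc q).1 hq, (hS q).2 hqS⟩, rfl⟩
    · rintro ⟨y, ⟨hy, hyS⟩, rfl⟩
      refine ⟨g⁻¹ • y, ⟨(hsrc _).2 ?_, (hS _).1 ?_⟩, ?_⟩
      · rwa [smul_inv_smul]
      · rwa [smul_inv_smul]
      · change e (g • g⁻¹ • y) = e y
        rw [smul_inv_smul]

end Slices

/-! ### Factorization of group elements near the identity. -/

noncomputable section OrbitLocalStructure

variable {V : Type*} [NormedAddCommGroup V] [InnerProductSpace ℂ V] [FiniteDimensional ℂ V]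

/-- Evaluation of operators at `v`. -/
def evalAt (v : V) : (V →L[ℂ] V) →L[ℝ] V := (ContinuousLinearMap.apply ℂ V v).restrictScalars ℝ

/-- The complex line through `v`, as a real subspace. -/
def complexLine (v : V) : Submodule ℝ V := (ℂ ∙ v).restrictScalars ℝ

omit [FiniteDimensional ℂ V] in
theorem mem_complexLine {v u : V} : u ∈ complexLine v ↔ ∃ c : ℂ, c • v = u :=
  Submodule.mem_span_singleton

/-- Evaluation may have a kernel on `M`. A linear right inverse selects one operator for each vector
of `M v`, so that the parametrizations below are not redundant. -/
theorem exists_section_evalAt (M : Submodule ℝ (V →L[ℂ] V)) (v : V) :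
    ∃ σ : (M.map (evalAt v : (V →L[ℂ] V) →ₗ[ℝ] V)) →L[ℝ] (V →L[ℂ] V),
      ∀ n, σ n ∈ M ∧ σ n v = n := by
  have : FiniteDimensional ℝ V := FiniteDimensional.complexToReal V
  let f : M →ₗ[ℝ] M.map (evalAt v : (V →L[ℂ] V) →ₗ[ℝ] V) :=
    (evalAt v : (V →L[ℂ] V) →ₗ[ℝ] V).submoduleMap M
  obtain ⟨g, hg⟩ := f.exists_rightInverse_of_surjective
    (LinearMap.range_eq_top.2 (LinearMap.submoduleMap_surjective _ _))
  refine ⟨(M.subtype.comp g).toContinuousLinearMap, fun n => ⟨(g n).2, ?_⟩⟩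
  have h := congrArg Subtype.val (LinearMap.congr_fun hg n)
  exact h

theorem hasStrictFDerivAt_exp_comp {E : Type*} [NormedAddCommGroup E] [NormedSpace ℝ E]
    (l : E →L[ℝ] (V →L[ℂ] V)) :
    HasStrictFDerivAt (fun x => NormedSpace.exp (l x)) l (0 : E) := by
  have : CompleteSpace V := FiniteDimensional.complete ℂ V
  have h : HasStrictFDerivAt NormedSpace.exp (1 : (V →L[ℂ] V) →L[ℝ] (V →L[ℂ] V)) (l 0) := by
    rw [map_zero]
    exact hasStrictFDerivAt_exp_zero
  exact h.comp 0 l.hasStrictFDerivAt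

theorem hasStrictFDerivAt_mul_of_eq_one {E : Type*} [NormedAddCommGroup E] [NormedSpace ℝ E]
    {f g : E → (V →L[ℂ] V)} {f' g' : E →L[ℝ] (V →L[ℂ] V)} {x : E} (hf : HasStrictFDerivAt f f' x)
    (hg : HasStrictFDerivAt g g' x) (hf1 : f x = 1) (hg1 : g x = 1) :
    HasStrictFDerivAt (fun y => f y * g y) (f' + g') x := by
  refine (hf.mul' hg).congr_fderiv ?_
  refine ContinuousLinearMap.ext fun y => ?_
  change f x * g' y + f' y * g x = f' y + g' y
  rw [hf1, hg1, one_mul, mul_one, add_comm]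

variable [CompleteSpace V] {G : Subgroup (V →L[ℂ] V)ˣ} {𝔤 : Submodule ℝ (V →L[ℂ] V)}

/-- The part of `Y` that commutes with `X` only rescales `v`, so in `ℙ(V)` only the lowering and
raising parts move `[v]`. -/
theorem eigenvector_decomposition (h𝔤 : (𝔤 : Set (V →L[ℂ] V)) = lieAlgebraOf G) {X : V →L[ℂ] V}
    (hX : star X = X) (hX𝔤 : X ∈ 𝔤)
    (hZ : ∀ Y ∈ 𝔤, X * Y = Y * X → ∀ (u : V) (a : ℝ), X u = a • u → ∃ c : ℂ, Y u = c • u)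
    {v : V} {a : ℝ} (hv : X v = a • v) {Y : V →L[ℂ] V} (hY : Y ∈ 𝔤) :
    ∃ Y₀ ∈ 𝔤, ∃ Y₁ ∈ adSubspace X 𝔤 (Iio 0), ∃ Y₂ ∈ adSubspace X 𝔤 (Ioi 0),
      Y = Y₀ + Y₁ + Y₂ ∧ Y₀ v ∈ complexLine v := by
  obtain ⟨Y₀, h0, Y₁, h1, Y₂, h2, hc, h⟩ := adSubspace_decomposition h𝔤 hX hX𝔤 hY
  obtain ⟨c, hc'⟩ := hZ Y₀ h0 hc v a hv
  exact ⟨Y₀, h0, Y₁, h1, Y₂, h2, h, mem_complexLine.2 ⟨c, hc'.symm⟩⟩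

/-- Elements of a closed subgroup near `1` move the line of an eigenvector `v` by
`exp (σ n) exp (τ m)`, where `σ n` lowers and `τ m` raises eigenvalues. -/
theorem exists_nhds_one_factorization (hG : IsClosed (G : Set (V →L[ℂ] V)ˣ))
    (h𝔤 : (𝔤 : Set (V →L[ℂ] V)) = lieAlgebraOf G) {X : V →L[ℂ] V}
    (hX : star X = X) (hX𝔤 : X ∈ 𝔤)
    (hZ : ∀ Y ∈ 𝔤, X * Y = Y * X → ∀ (u : V) (a : ℝ), X u = a • u → ∃ c : ℂ, Y u = c • u)
    (v : PuncturedSpace V) {a : ℝ} (hv : X v.1 = a • v.1)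
    {σ : ((adSubspace X 𝔤 (Iio 0)).map (evalAt v.1 : (V →L[ℂ] V) →ₗ[ℝ] V)) →L[ℝ] (V →L[ℂ] V)}
    (hσ : ∀ n, σ n ∈ adSubspace X 𝔤 (Iio 0) ∧ σ n v.1 = n)
    {τ : ((adSubspace X 𝔤 (Ioi 0)).map (evalAt v.1 : (V →L[ℂ] V) →ₗ[ℝ] V)) →L[ℝ] (V →L[ℂ] V)}
    (hτ : ∀ n, τ n ∈ adSubspace X 𝔤 (Ioi 0) ∧ τ n v.1 = n) {ε : ℝ} (hε : 0 < ε) :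
    ∃ N ∈ 𝓝 (1 : (V →L[ℂ] V)ˣ), ∀ g ∈ N, g ∈ G → ∃ n m, ‖n‖ < ε ∧ ‖m‖ < ε ∧
      g • projPi v = (expUnit (σ n) * expUnit (τ m)) • projPi v := by
  have := finiteDimensional_real_clm (V := V)
  have hcomp : CompleteSpace (V →L[ℂ] V) := inferInstance
  -- A complement of `𝔤` is added so that the product of exponentials covers a neighbourhood of `1`
  -- in all of `End(V)`, without using a manifold structure on `G`.
  obtain ⟨𝔠, h𝔠⟩ := 𝔤.exists_isCompl
  -- The isotropy algebra of the line `[v]` in `𝔤`.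
  let 𝔮 : Submodule ℝ (V →L[ℂ] V) :=
    𝔤 ⊓ (complexLine v.1).comap (evalAt v.1 : (V →L[ℂ] V) →ₗ[ℝ] V)
  let N₁ := (adSubspace X 𝔤 (Iio 0)).map (evalAt v.1 : (V →L[ℂ] V) →ₗ[ℝ] V)
  let N₂ := (adSubspace X 𝔤 (Ioi 0)).map (evalAt v.1 : (V →L[ℂ] V) →ₗ[ℝ] V)
  have hfdV : FiniteDimensional ℝ V := FiniteDimensional.complexToReal V
  let E := N₁ × N₂ × 𝔮 × 𝔠
  let l₁ : E →L[ℝ] (V →L[ℂ] V) := σ.comp (ContinuousLinearMap.fst ℝ _ _)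
  let l₂ : E →L[ℝ] (V →L[ℂ] V) := τ.comp ((ContinuousLinearMap.fst ℝ _ _).comp
    (ContinuousLinearMap.snd ℝ _ _))
  let l₃ : E →L[ℝ] (V →L[ℂ] V) := 𝔮.subtypeL.comp ((ContinuousLinearMap.fst ℝ _ _).comp
    ((ContinuousLinearMap.snd ℝ _ _).comp (ContinuousLinearMap.snd ℝ _ _)))
  let l₄ : E →L[ℝ] (V →L[ℂ] V) := 𝔠.subtypeL.comp ((ContinuousLinearMap.snd ℝ _ _).comp
    ((ContinuousLinearMap.snd ℝ _ _).comp (ContinuousLinearMap.snd ℝ _ _)))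
  have he : ∀ l : E →L[ℝ] (V →L[ℂ] V), NormedSpace.exp (l 0) = 1 := fun l => by
    rw [map_zero, NormedSpace.exp_zero]
  have hd : HasStrictFDerivAt (fun x : E => NormedSpace.exp (l₁ x) * NormedSpace.exp (l₂ x) *
      (NormedSpace.exp (l₃ x) * NormedSpace.exp (l₄ x))) (l₁ + l₂ + (l₃ + l₄)) (0 : E) := by
    refine hasStrictFDerivAt_mul_of_eq_one (hasStrictFDerivAt_mul_of_eq_one
      (hasStrictFDerivAt_exp_comp l₁) (hasStrictFDerivAt_exp_comp l₂) (he _) (he _))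
      (hasStrictFDerivAt_mul_of_eq_one
      (hasStrictFDerivAt_exp_comp l₃) (hasStrictFDerivAt_exp_comp l₄) (he _) (he _)) ?_ ?_
    · rw [he, he, one_mul]
    · rw [he, he, one_mul]
  have hsurj : (l₁ + l₂ + (l₃ + l₄)).range = ⊤ := by
    rw [eq_top_iff]
    intro Z _
    obtain ⟨Y, hY, C, hC, hYC⟩ := Submodule.mem_sup.1
      (show Z ∈ 𝔤 ⊔ 𝔠 by rw [h𝔠.sup_eq_top]; trivial)
    obtain ⟨Y₀, h0, Y₁, h1, Y₂, h2, hYsum, hY0⟩ := eigenvector_decomposition h𝔤 hX hX𝔤 hZ hv hY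
    let n : N₁ := ⟨Y₁ v.1, Y₁, h1, rfl⟩
    let m : N₂ := ⟨Y₂ v.1, Y₂, h2, rfl⟩
    -- The sections reproduce only the values of `Y₁` and `Y₂` at `v`; the discrepancy leaves the
    -- line of `v` invariant and is absorbed in `𝔮`.
    have hq : Y - σ n - τ m ∈ 𝔮 := by
      refine ⟨𝔤.sub_mem (𝔤.sub_mem hY (adSubspace_le _ _ _ (hσ n).1))
        (adSubspace_le _ _ _ (hτ m).1), ?_⟩
      have h3 : (Y - σ n - τ m) v.1 = Y₀ v.1 := by
        simp only [hYsum, sub_apply, add_apply, (hσ n).2, (hτ m).2, n, m]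
        abel
      change (Y - σ n - τ m) v.1 ∈ complexLine v.1
      rwa [h3]
    refine ⟨(n, m, ⟨_, hq⟩, ⟨C, hC⟩), ?_⟩
    change σ n + τ m + ((Y - σ n - τ m) + C) = Z
    rw [← hYC]
    abel
  have hmap := hd.map_nhds_eq_of_surj hsurj
  simp only [he, one_mul] at hmap
  have hsmall : ∀ᶠ x : E in 𝓝 0, ‖x.1‖ < ε ∧ ‖x.2.1‖ < ε ∧
      ((x.2.2.2 : V →L[ℂ] V) ∈ 𝔠 → expUnit (x.2.2.2 : V →L[ℂ] V) ∈ G →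
        (x.2.2.2 : V →L[ℂ] V) = 0) := by
    have h1 : ∀ᶠ x : E in 𝓝 0, ‖x‖ < ε := by
      exact (continuous_norm.tendsto' (0 : E) 0 norm_zero).eventually (gt_mem_nhds hε)
    have h2 : ∀ᶠ x : E in 𝓝 0, (l₄ x ∈ 𝔠 → expUnit (l₄ x) ∈ G → l₄ x = 0) := by
      have h3 := l₄.continuous.tendsto 0
      rw [map_zero] at h3
      exact h3.eventually (eventually_eq_zero_of_expUnit_mem hG h𝔤 h𝔠.disjoint)
    filter_upwards [h1, h2] with x hx1 hx2
    refine ⟨(norm_fst_le x).trans_lt hx1,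
      ((norm_fst_le x.2).trans (norm_snd_le x)).trans_lt hx1, hx2⟩
  have himg' : (fun x : E => NormedSpace.exp (l₁ x) * NormedSpace.exp (l₂ x) *
      (NormedSpace.exp (l₃ x) * NormedSpace.exp (l₄ x))) '' _ ∈ 𝓝 (1 : V →L[ℂ] V) :=
    hmap ▸ image_mem_map hsmall
  refine ⟨_, Units.continuous_val.continuousAt.preimage_mem_nhds himg', ?_⟩
  rintro g ⟨⟨n, m, q, C⟩, ⟨hn, hm, hC⟩, hg⟩ hgG
  have hg' : g = expUnit (σ n) * expUnit (τ m) * (expUnit (q : V →L[ℂ] V) *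
      expUnit (C : V →L[ℂ] V)) := Units.ext hg.symm
  have hσG : expUnit (σ n) * expUnit (τ m) ∈ G := G.mul_mem
    (expUnit_mem h𝔤 (adSubspace_le _ _ _ (hσ n).1)) (expUnit_mem h𝔤 (adSubspace_le _ _ _ (hτ m).1))
  have hqG : expUnit (q : V →L[ℂ] V) ∈ G := expUnit_mem h𝔤 q.2.1
  -- The other three factors belong to `G`, so the last one does too. Near `0`, an element of the
  -- complement whose exponential lies in `G` vanishes.
  have hCG : expUnit (C : V →L[ℂ] V) ∈ G := by
    rw [hg'] at hgG
    exact (G.mul_mem_cancel_left hqG).1 ((G.mul_mem_cancel_left hσG).1 hgG)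
  have hC0 : (C : V →L[ℂ] V) = 0 := hC C.2 hCG
  refine ⟨n, m, hn, hm, ?_⟩
  rw [hg', hC0, expUnit_zero, mul_one, mul_smul]
  congr 1
  obtain ⟨c, hc⟩ := mem_complexLine.1 q.2.2
  rw [smul_projPi]
  exact projPi_eq_of_smul (expUnit_apply_eigenvector (c := c) hc.symm)

end OrbitLocalStructure

/-! ### The closed orbit and the stable manifold near a critical point. -/

noncomputable section FixedPointStructure

variable {V : Type*} [NormedAddCommGroup V] [InnerProductSpace ℂ V] [FiniteDimensional ℂ V]
  [CompleteSpace V] {G : Subgroup (V →L[ℂ] V)ˣ} {𝔤 : Submodule ℝ (V →L[ℂ] V)}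

omit [CompleteSpace V] in
theorem expUnit_lowering_apply_mem {X Y : V →L[ℂ] V} (hY : Y ∈ adSubspace X 𝔤 (Iio 0)) {a : ℝ}
    {u : V} (hu : u ∈ spectralSubspace X (Iio a)) :
    (expUnit Y : V →L[ℂ] V) u ∈ spectralSubspace X (Iio a) := by
  have h := exp_lowering_sub_mem hY (spectralSubspace_mono X Iio_subset_Iic_self hu)
  simpa using add_mem h hu

omit [CompleteSpace V] in
theorem expUnit_neg_apply_expUnit_apply (Y : V →L[ℂ] V) (u : V) :
    (expUnit (-Y) : V →L[ℂ] V) ((expUnit Y : V →L[ℂ] V) u) = u := by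
  rw [expUnit_neg, ← mul_apply_eq_comp, Units.inv_mul, one_apply_eq_self]

/-- If `exp Y exp Z v`, with `Y` lowering and `Z` raising, is a multiple of the eigenvector `v` up
to lower terms, then `exp Z` fixes `v`. -/
theorem exp_raising_apply_eq {X Y Z : V →L[ℂ] V} (hX : star X = X)
    (hY : Y ∈ adSubspace X 𝔤 (Iio 0)) (hZ : Z ∈ adSubspace X 𝔤 (Ioi 0)) {v x : V} {a : ℝ}
    (hv : X v = a • v) (hx : X x = a • x)
    (h : (expUnit Y : V →L[ℂ] V) ((expUnit Z : V →L[ℂ] V) v) - x ∈ spectralSubspace X (Iio a)) :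
    (expUnit Z : V →L[ℂ] V) v = v ∧ x = v := by
  have hxs : x ∈ spectralSubspace X (Iic a) :=
    realEigenspace_le_spectralSubspace X self_mem_Iic (mem_realEigenspace.2 hx)
  have hvs : v ∈ spectralSubspace X (Ici a) :=
    realEigenspace_le_spectralSubspace X self_mem_Ici (mem_realEigenspace.2 hv)
  -- Applying `exp(-Y)` gives `exp(Z) v = x` plus lower terms, whereas `exp(Z) v = v` plus higher
  -- terms. Comparing components forces `x = v` and no further terms.
  have hY' := neg_mem hY
  have h1 := expUnit_lowering_apply_mem hY' h
  rw [map_sub, expUnit_neg_apply_expUnit_apply] at h1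
  have h2 := add_mem h1 (exp_lowering_sub_mem hY' hxs)
  have h3 := exp_raising_sub_mem hZ hvs
  obtain ⟨h4, -, h5⟩ := eq_zero_of_add_eq hX
    (sub_mem (mem_realEigenspace.2 hx) (mem_realEigenspace.2 hv)) h2 h3 (by abel)
  exact ⟨sub_eq_zero.1 h5, sub_eq_zero.1 h4⟩

omit [FiniteDimensional ℂ V] [CompleteSpace V] in
-- Eigenvectors for different eigenvalues are orthogonal, so a critical line in this neighbourhood
-- has the same eigenvalue as `v`.
theorem setOf_inner_ne_zero_mem_nhds (v : PuncturedSpace V) :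
    projPi '' {w : PuncturedSpace V | ⟪v.1, w.1⟫_ℂ ≠ 0} ∈ 𝓝 (projPi v) := by
  refine (isOpenMap_projPi _ ?_).mem_nhds ⟨v, inner_self_ne_zero.2 v.2, rfl⟩
  exact isOpen_ne_fun (by fun_prop) continuous_const

variable (hG : IsClosed (G : Set (V →L[ℂ] V)ˣ)) (h𝔤 : (𝔤 : Set (V →L[ℂ] V)) = lieAlgebraOf G)
  {X : V →L[ℂ] V} (hX : star X = X) (hX𝔤 : X ∈ 𝔤)
  (hZ : ∀ Y ∈ 𝔤, X * Y = Y * X → ∀ (u : V) (a : ℝ), X u = a • u → ∃ c : ℂ, Y u = c • u)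
  (v : PuncturedSpace V) {a : ℝ} (hv : X v.1 = a • v.1)
  (hcl : IsClosed (MulAction.orbit G (projPi v)))

include hG h𝔤 hX hX𝔤 hZ hv hcl in
/-- A fixed point is isolated among the critical points in its closed orbit. -/
theorem exists_nhds_isCriticalPoint_eq : ∃ O ∈ 𝓝 (projPi v), ∀ y ∈ O,
    y ∈ MulAction.orbit G (projPi v) → IsCriticalPoint (projField X) y → y = projPi v := by
  obtain ⟨σ, hσ⟩ := exists_section_evalAt (adSubspace X 𝔤 (Iio 0)) v.1
  obtain ⟨τ, hτ⟩ := exists_section_evalAt (adSubspace X 𝔤 (Ioi 0)) v.1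
  obtain ⟨N, hN, hfac⟩ := exists_nhds_one_factorization hG h𝔤 hX hX𝔤 hZ v hv hσ hτ one_pos
  obtain ⟨O, hO, hON⟩ := exists_nhds_inter_orbit_subset hG hcl hN
  refine ⟨_, inter_mem hO (setOf_inner_ne_zero_mem_nhds v), ?_⟩
  rintro y ⟨hyO, w, hw, rfl⟩ hyM hcrit
  obtain ⟨g, hg, hgN, hgy⟩ := hON _ hyO hyM
  obtain ⟨n, m, -, -, hnm⟩ := hfac g hgN hg
  rw [hnm, smul_projPi] at hgy
  obtain ⟨c, hc, hcw⟩ := exists_smul_of_projPi_eq hgy.symm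
  obtain ⟨b, hb⟩ := (isCriticalPoint_iff X w).1 hcrit
  have hba : b = a := by
    have h := inner_self_adjoint_comm hX v.1 w.1
    rw [hv, hb, ← Complex.coe_smul, inner_smul_left, inner_smul_right, Complex.conj_ofReal] at h
    exact (mul_right_cancel₀ hw h).symm
  have hx : X (c • w.1) = a • c • w.1 := by
    refine smul_eigenvector ?_ c
    rw [hb, hba, Complex.coe_smul]
  -- The critical point is exactly the line of `exp(σ n) exp(τ m) v`, so the lower remainder in the
  -- hypothesis is zero.
  have h := exp_raising_apply_eq hX (hσ n).1 (hτ m).1 hv hx (by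
    rw [← hcw]
    simp only [Units.val_mul, mul_apply_eq_comp, sub_self, zero_mem])
  exact (projPi_eq_of_smul h.2.symm).symm

include hG h𝔤 hX hX𝔤 hZ hv hcl in
/-- The local structure of a closed orbit at a fixed point of the flow of `X`. -/
theorem closedOrbit_local_structure :
    IsSliceAt (ProjModel V) (MulAction.orbit G (projPi v)) (projPi v) ∧
    IsSliceAt (ProjModel V) (stableManifold (projFlow X) {projPi v} ∩
      MulAction.orbit G (projPi v)) (projPi v) ∧
    ∀ (w : ℝ → V) (w' : V) (hw : ∀ t, w t ≠ 0), w 0 = v.1 → HasDerivAt w w' 0 →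
      (∀ᶠ t in 𝓝 0, projPi ⟨w t, hw t⟩ ∈ MulAction.orbit G (projPi v)) →
      ∃ Y ∈ 𝔤, ∃ c : ℂ, w' = Y v.1 + c • v.1 := by
  have hfdV : FiniteDimensional ℝ V := FiniteDimensional.complexToReal V
  have hfdE := finiteDimensional_real_clm (V := V)
  let N₁ := (adSubspace X 𝔤 (Iio 0)).map (evalAt v.1 : (V →L[ℂ] V) →ₗ[ℝ] V)
  let N₂ := (adSubspace X 𝔤 (Ioi 0)).map (evalAt v.1 : (V →L[ℂ] V) →ₗ[ℝ] V)
  obtain ⟨σ, hσ⟩ : ∃ σ : N₁ →L[ℝ] (V →L[ℂ] V),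
    ∀ n, σ n ∈ adSubspace X 𝔤 (Iio 0) ∧ σ n v.1 = n := exists_section_evalAt _ v.1
  obtain ⟨τ, hτ⟩ : ∃ τ : N₂ →L[ℝ] (V →L[ℂ] V),
    ∀ n, τ n ∈ adSubspace X 𝔤 (Ioi 0) ∧ τ n v.1 = n := exists_section_evalAt _ v.1
  have hve : v.1 ∈ realEigenspace X a := mem_realEigenspace.2 hv
  have hN₁s : ∀ n : N₁, (n : V) ∈ spectralSubspace X (Iio a) := fun n => by
    rw [← (hσ n).2]
    exact lowering_apply_mem (hσ n).1 (realEigenspace_le_spectralSubspace X self_mem_Iic hve)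
  have hN₂s : ∀ n : N₂, (n : V) ∈ spectralSubspace X (Ioi a) := fun n => by
    rw [← (hτ n).2]
    exact raising_apply_mem (hτ n).1 (realEigenspace_le_spectralSubspace X self_mem_Ici hve)
  -- `N₁` and `N₂` are the tangent directions of the orbit. `W` supplies the transverse directions
  -- needed for a full chart of `ℙ(V)`.
  obtain ⟨W, hW⟩ := (complexLine v.1 ⊔ N₁ ⊔ N₂).exists_isCompl
  have hv0 : v.1 ≠ 0 := v.2
  have hvl : ∀ c : ℂ, c • v.1 ∈ complexLine v.1 := fun c => mem_complexLine.2 ⟨c, rfl⟩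
  have hne0 : ∀ w : W, v.1 + w ≠ 0 := fun w h => by
    have h1 : v.1 ∈ complexLine v.1 ⊔ N₁ ⊔ N₂ :=
      le_sup_left (a := complexLine v.1 ⊔ N₁) (le_sup_left (a := complexLine v.1)
        (by simpa using hvl 1))
    have h2 : v.1 ∈ W := by
      rw [eq_neg_of_add_eq_zero_left h]
      exact neg_mem w.2
    exact hv0 (Submodule.disjoint_def.1 hW.disjoint _ h1 h2)
  let E := N₁ × N₂ × W
  let l₁ : E →L[ℝ] (V →L[ℂ] V) := σ.comp (ContinuousLinearMap.fst ℝ _ _)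
  let l₂ : E →L[ℝ] (V →L[ℂ] V) := τ.comp ((ContinuousLinearMap.fst ℝ _ _).comp
    (ContinuousLinearMap.snd ℝ _ _))
  let l₃ : E →L[ℝ] V := W.subtypeL.comp ((ContinuousLinearMap.snd ℝ _ _).comp
    (ContinuousLinearMap.snd ℝ _ _))
  let L : E →L[ℝ] V := (N₁.subtypeL.comp (ContinuousLinearMap.fst ℝ _ _) +
    N₂.subtypeL.comp ((ContinuousLinearMap.fst ℝ _ _).comp (ContinuousLinearMap.snd ℝ _ _))) + l₃
  let R : (V →L[ℂ] V) →L[ℝ] (V →L[ℝ] V) := ContinuousLinearMap.restrictScalarsL ℂ V V ℝ ℝ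
  -- The parametrization `(n, m, w) ↦ exp(σ n) exp(τ m) (v + w)`: the orbit will be `w = 0`, the
  -- stable manifold `m = 0, w = 0`.
  let γ : E → V := fun x => R (NormedSpace.exp (l₁ x) * NormedSpace.exp (l₂ x)) (v.1 + l₃ x)
  have hγe : ∀ x : E, γ x = ((expUnit (l₁ x) * expUnit (l₂ x) : (V →L[ℂ] V)ˣ) : V →L[ℂ] V)
      (v.1 + l₃ x) := fun x => rfl
  have hne : ∀ x, γ x ≠ 0 := fun x => by
    rw [hγe]
    exact units_apply_ne_zero _ (hne0 x.2.2)
  have hγ : ContDiff ℝ ∞ γ := (R.contDiff.comp ((contDiff_exp_clm.comp l₁.contDiff).mul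
    (contDiff_exp_clm.comp l₂.contDiff))).clm_apply (contDiff_const.add l₃.contDiff)
  have he : ∀ l : E →L[ℝ] (V →L[ℂ] V), NormedSpace.exp (l 0) = 1 := fun l => by
    rw [map_zero, NormedSpace.exp_zero]
  have hγ0 : γ 0 = v.1 := by
    change (NormedSpace.exp (l₁ 0) * NormedSpace.exp (l₂ 0)) (v.1 + l₃ 0) = v.1
    rw [he, he, map_zero, add_zero, one_mul, one_apply_eq_self]
  have hL : HasFDerivAt γ L 0 := by
    have h1 := (hasStrictFDerivAt_mul_of_eq_one (hasStrictFDerivAt_exp_comp l₁)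
      (hasStrictFDerivAt_exp_comp l₂) (he _) (he _)).hasFDerivAt
    have h2 := (R.hasFDerivAt.comp (0 : E) h1).clm_apply (l₃.hasFDerivAt.const_add v.1)
    refine h2.congr_fderiv (ContinuousLinearMap.ext fun x => ?_)
    change (NormedSpace.exp (l₁ 0) * NormedSpace.exp (l₂ 0)) (l₃ x) +
      (σ x.1 + τ x.2.1) (v.1 + l₃ 0) = (x.1 + x.2.1) + l₃ x
    rw [he, he, map_zero, add_zero, one_mul, one_apply_eq_self, add_apply, (hσ _).2, (hτ _).2,
      add_comm]
  have hp : projPi ⟨γ 0, hne 0⟩ = projPi v := congrArg projPi (Subtype.ext hγ0)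
  have hdp : ∀ u, (affineDeriv (adaptedCoord (projPi ⟨γ 0, hne 0⟩)) (γ 0) u) =
      (dProjPi ⟨γ 0, hne 0⟩ u : ProjModel V) := fun u =>
    (dProjPi_eq_affineDeriv ⟨γ 0, hne 0⟩ u).symm
  -- `V = ℂv ⊕ N₁ ⊕ N₂ ⊕ W`, and the derivative kills exactly `ℂv`. The first three summands are
  -- independent because their eigenvalues are equal to, below and above `a`.
  have hbij : Function.Bijective fun x => affineDeriv (adaptedCoord (projPi ⟨γ 0, hne 0⟩)) (γ 0)
      (L x) := by
    constructor
    · refine (injective_iff_map_eq_zero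
        ((affineDeriv (adaptedCoord (projPi ⟨γ 0, hne 0⟩)) (γ 0)).comp L)).2 fun x hx => ?_
      have hx' : dProjPi ⟨γ 0, hne 0⟩ (L x) = 0 := (hdp (L x)).symm.trans hx
      obtain ⟨c, hc⟩ := (dProjPi_eq_zero_iff _ _).1 hx'
      simp only [hγ0] at hc
      have hLx : L x = (x.1 + x.2.1) + x.2.2 := rfl
      rw [hLx] at hc
      have h1 : (x.2.2 : V) ∈ complexLine v.1 ⊔ N₁ ⊔ N₂ := by
        have h2 : (x.2.2 : V) = (c • v.1 + -(x.1 : V)) + -(x.2.1 : V) := by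
          rw [← hc]
          abel
        rw [h2]
        exact Submodule.add_mem_sup (Submodule.add_mem_sup (hvl c) (neg_mem x.1.2))
          (neg_mem x.2.1.2)
      have h3 : (x.2.2 : V) = 0 := Submodule.disjoint_def.1 hW.disjoint _ h1 x.2.2.2
      rw [h3, add_zero] at hc
      obtain ⟨-, h4, h5⟩ := eq_zero_of_add_eq hX (x := -(c • v.1)) (l := x.1) (h := -(x.2.1 : V))
        (neg_mem (mem_realEigenspace.2 (smul_eigenvector hv c))) (hN₁s x.1)
        (neg_mem (hN₂s x.2.1)) (by rw [← hc]; abel)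
      exact Prod.ext (Subtype.ext h4) (Prod.ext (Subtype.ext (neg_eq_zero.1 h5)) (Subtype.ext h3))
    · intro ξ
      obtain ⟨u, -, hu⟩ := exists_dProjPi_eq ⟨γ 0, hne 0⟩ ξ
      obtain ⟨y, hy, w, hw, hyw⟩ := Submodule.mem_sup.1
        (show u ∈ (complexLine v.1 ⊔ N₁ ⊔ N₂) ⊔ W by rw [hW.sup_eq_top]; trivial)
      obtain ⟨z, hz, m, hm, rfl⟩ := Submodule.mem_sup.1 hy
      obtain ⟨z', hz', n, hn, rfl⟩ := Submodule.mem_sup.1 hz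
      obtain ⟨c, rfl⟩ := mem_complexLine.1 hz'
      refine ⟨(⟨n, hn⟩, ⟨m, hm⟩, ⟨w, hw⟩), (hdp _).trans ?_⟩
      have h1 : L (⟨n, hn⟩, ⟨m, hm⟩, ⟨w, hw⟩) = u - c • γ 0 := by
        change (n + m) + w = u - c • γ 0
        rw [← hyw, hγ0]
        abel
      rw [h1, map_sub, dProjPi_self_smul, sub_zero]
      exact hu
  obtain ⟨r, hr, hinj, -, hslice⟩ := exists_radius_slice hγ hne hL hbij
  rw [hp] at hslice
  obtain ⟨N, hN, hfac⟩ : ∃ N ∈ 𝓝 (1 : (V →L[ℂ] V)ˣ), ∀ g ∈ N, g ∈ G → ∃ (n : N₁) (m : N₂),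
      ‖n‖ < r ∧ ‖m‖ < r ∧ g • projPi v = (expUnit (σ n) * expUnit (τ m)) • projPi v :=
    exists_nhds_one_factorization hG h𝔤 hX hX𝔤 hZ v hv hσ hτ hr
  obtain ⟨O, hO, hON⟩ := exists_nhds_inter_orbit_subset hG hcl hN
  have hγnm : ∀ (n : N₁) (m : N₂), projPi ⟨γ (n, m, 0), hne _⟩ =
      (expUnit (σ n) * expUnit (τ m)) • projPi v := fun n m => by
    rw [smul_projPi]
    refine congrArg projPi (Subtype.ext ?_)
    simp only [hγe]
    congr 1
    exact add_zero v.1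
  have hmemM : ∀ (n : N₁) (m : N₂), projPi ⟨γ (n, m, 0), hne _⟩ ∈ MulAction.orbit G (projPi v) :=
    fun n m => ⟨⟨_, G.mul_mem (expUnit_mem h𝔤 (adSubspace_le _ _ _ (hσ n).1))
      (expUnit_mem h𝔤 (adSubspace_le _ _ _ (hτ m).1))⟩, (hγnm n m).symm⟩
  let F : Submodule ℝ E := LinearMap.ker l₃.toLinearMap
  -- A point of the orbit near `[v]` is `g • [v]` with `g` near `1`, hence of the form `[γ (n, m,
  -- 0)]` with small `n`, `m`. Injectivity of the parametrization on the ball then gives `w = 0`.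
  have hFM : ∀ x ∈ Metric.ball 0 r, projPi ⟨γ x, hne x⟩ ∈ O →
      (projPi ⟨γ x, hne x⟩ ∈ MulAction.orbit G (projPi v) ↔ x ∈ F) := by
    intro x hx hxO
    constructor
    · intro hxM
      obtain ⟨g, hg, hgN, hgx⟩ := hON _ hxO hxM
      obtain ⟨n, m, hn, hm, hnm⟩ := hfac g hgN hg
      rw [hnm] at hgx
      replace hgx := hgx.trans (hγnm n m).symm
      have hball : ((n, m, 0) : E) ∈ Metric.ball 0 r := by
        rw [mem_ball_zero_iff, Prod.norm_mk, Prod.norm_mk, norm_zero]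
        exact max_lt hn (max_lt hm hr)
      rw [hinj hx hball hgx]
      exact LinearMap.mem_ker.2 rfl
    · intro hxF
      have h0 : x.2.2 = 0 := Subtype.ext (LinearMap.mem_ker.1 hxF)
      have := hmemM x.1 x.2.1
      rwa [← h0] at this
  obtain ⟨hS, hcurve⟩ := hslice _ F O hO hFM
  refine ⟨hS, ?_, ?_⟩
  · let F' : Submodule ℝ E := LinearMap.ker (ContinuousLinearMap.snd ℝ N₁ (N₂ × W)).toLinearMap
    refine (hslice _ F' O hO fun x hx hxO => ?_).1
    constructor
    · rintro ⟨hst, hxM⟩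
      have hxF := (hFM x hx hxO).1 hxM
      have h0 : x.2.2 = 0 := Subtype.ext (LinearMap.mem_ker.1 hxF)
      obtain ⟨c, -, hc⟩ := (projPi_mem_stableManifold_iff hX hv).1 hst
      have hγx : γ x = (expUnit (σ x.1) : V →L[ℂ] V) ((expUnit (τ x.2.1) : V →L[ℂ] V) v.1) := by
        rw [hγe]
        change (expUnit (σ x.1) : V →L[ℂ] V) ((expUnit (τ x.2.1) : V →L[ℂ] V) (v.1 + x.2.2)) = _
        rw [h0, ZeroMemClass.coe_zero, add_zero]
      simp only [hγx] at hc
      -- On the stable manifold `exp(τ m)` fixes `v`, so setting `m = 0` does not change the point;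
      -- injectivity then yields `m = 0`.
      have h1 := (exp_raising_apply_eq hX (hσ x.1).1 (hτ x.2.1).1 hv (smul_eigenvector hv c) hc).1
      have hball : ((x.1, 0, 0) : E) ∈ Metric.ball 0 r := by
        rw [mem_ball_zero_iff] at hx ⊢
        rw [Prod.norm_mk, Prod.norm_mk, norm_zero, norm_zero]
        exact max_lt ((norm_fst_le x).trans_lt hx) (max_lt hr hr)
      have h2 : projPi ⟨γ x, hne x⟩ = projPi ⟨γ (x.1, 0, 0), hne _⟩ := by
        refine congrArg projPi (Subtype.ext ?_)
        simp only
        rw [hγx, h1, hγe]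
        change _ = (expUnit (σ x.1) : V →L[ℂ] V) ((expUnit (τ 0) : V →L[ℂ] V) (v.1 + (0 : V)))
        rw [map_zero, expUnit_zero, Units.val_one, one_apply_eq_self, add_zero]
      rw [hinj hx hball h2]
      exact LinearMap.mem_ker.2 rfl
    · intro hxF
      have h0 : x.2 = 0 := LinearMap.mem_ker.1 hxF
      have hxe : x = (x.1, 0, 0) := Prod.ext rfl h0
      have hγx : projPi ⟨γ x, hne x⟩ = projPi ⟨(expUnit (σ x.1) : V →L[ℂ] V) v.1,
          units_apply_ne_zero _ v.2⟩ := by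
        have h1 := hγnm x.1 0
        rw [map_zero, expUnit_zero, mul_one, smul_projPi] at h1
        rw [← h1]
        exact congrArg projPi (Subtype.ext (congrArg γ hxe))
      refine ⟨?_, (hFM x hx hxO).2 (LinearMap.mem_ker.2 ?_)⟩
      · rw [hγx]
        refine (projPi_mem_stableManifold_iff hX hv).2 ⟨1, one_ne_zero, ?_⟩
        rw [one_smul]
        exact exp_lowering_sub_mem (hσ x.1).1
          (realEigenspace_le_spectralSubspace X self_mem_Iic hve)
      · exact congrArg (fun y : N₂ × W => (y.2 : V)) h0
  · intro w w' hw hw0 hwd hwM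
    obtain ⟨x, hxF, c, hc⟩ := hcurve w w' hw (hw0.trans hγ0.symm) hwd hwM
    refine ⟨σ x.1 + τ x.2.1, 𝔤.add_mem (adSubspace_le _ _ _ (hσ x.1).1)
      (adSubspace_le _ _ _ (hτ x.2.1).1), c, ?_⟩
    have h0 : (x.2.2 : V) = 0 := LinearMap.mem_ker.1 hxF
    have hLx : L x = (x.1 + x.2.1) + x.2.2 := rfl
    rw [hc, hγ0, hLx, h0, add_zero, add_apply, (hσ _).2, (hτ _).2]

end FixedPointStructure

/-! ### The centralizer of `X` acts by scalars on the eigenspaces of `X`. -/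

section Centralizer

variable {V : Type*} [NormedAddCommGroup V] [InnerProductSpace ℂ V] [FiniteDimensional ℂ V]
  [CompleteSpace V]

theorem cartanInvolution_expUnit (A : V →L[ℂ] V) :
    cartanInvolution (expUnit A) = expUnit (-star A) := by
  ext1
  rw [cartanInvolution, ← expUnit_neg, Units.coe_star, coe_expUnit, coe_expUnit,
    NormedSpace.star_exp, star_neg]

theorem star_mem_lieAlgebra {G : Subgroup (V →L[ℂ] V)ˣ} (hGθ : ∀ g ∈ G, cartanInvolution g ∈ G)
    {Y : V →L[ℂ] V} (hY : Y ∈ lieAlgebraOf G) : star Y ∈ lieAlgebraOf G := by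
  rw [mem_lieAlgebraOf_iff] at hY ⊢
  intro t
  have h := hGθ _ (hY (-t))
  rwa [cartanInvolution_expUnit, star_smul, star_trivial, neg_smul, neg_neg] at h

variable {𝔞 : Submodule ℝ (V →L[ℂ] V)}

omit [FiniteDimensional ℂ V] in
-- Eigenvalues of self-adjoint operators are real, and on a fixed nonzero vector they depend
-- linearly on the operator.
theorem exists_mem_weights (h𝔞 : ∀ H ∈ 𝔞, star H = H) {u : V} (hu : u ≠ 0) {χ : 𝔞 → ℂ}
    (h : ∀ H : 𝔞, (H : V →L[ℂ] V) u = χ H • u) : ∃ μ ∈ weights 𝔞, ∀ H, χ H = μ H := by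
  have hre : ∀ H : 𝔞, χ H = ((χ H).re : ℂ) := fun H => by
    have h1 := inner_self_adjoint_comm (h𝔞 H H.2) u u
    rw [h, inner_smul_left, inner_smul_right] at h1
    exact (Complex.conj_eq_iff_re.1 (mul_right_cancel₀ (inner_self_ne_zero.2 hu) h1)).symm
  refine ⟨⟨⟨fun H => (χ H).re, fun H K => ?_⟩, fun r H => ?_⟩, ⟨u, hu, fun H => ?_⟩, hre⟩
  · have h1 : χ (H + K) = χ H + χ K := smul_left_injective ℂ hu (by
      simp only
      rw [← h, add_smul, ← h, ← h]
      rfl)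
    rw [h1, Complex.add_re]
  · have h1 : χ (r • H) = r * χ H := smul_left_injective ℂ hu (by
      simp only
      rw [← h, mul_smul, ← h, Complex.coe_smul]
      rfl)
    simp only [h1, Complex.re_ofReal_mul, RingHom.id_apply, smul_eq_mul]
  · change _ = (χ H).re • u
    rw [h, ← Complex.coe_smul, ← hre]

/-- The joint eigenvectors of the commuting symmetric family span `V`. Those whose `X`-eigenvalue is
not `a` are automatically orthogonal to `u`, so `u` is orthogonal to all of `V`. -/
theorem eq_zero_of_orthogonal_joint_eigenvectors (h𝔞 : ∀ H ∈ 𝔞, star H = H)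
    (hc : ∀ H ∈ 𝔞, ∀ K ∈ 𝔞, H * K = K * H) (X : 𝔞) {a : ℝ} {u : V}
    (hu : (X : V →L[ℂ] V) u = a • u)
    (h : ∀ (χ : 𝔞 → ℂ) (w : V), (∀ H : 𝔞, (H : V →L[ℂ] V) w = χ H • w) → χ X = a →
      ⟪w, u⟫_ℂ = 0) : u = 0 := by
  have hT : ∀ H : 𝔞, ((H : V →L[ℂ] V) : V →ₗ[ℂ] V).IsSymmetric := fun H u w =>
    inner_self_adjoint_comm (h𝔞 H H.2) u w
  have htop := LinearMap.IsSymmetric.iSup_iInf_eq_top_of_commute hT fun H K _ =>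
    LinearMap.ext fun w => congrArg (fun A : V →L[ℂ] V => A w) (hc H H.2 K K.2)
  suffices hs : (⊤ : Submodule ℂ V) ≤ (ℂ ∙ u)ᗮ by
    have h1 := Submodule.mem_orthogonal_singleton_iff_inner_right.1 (hs (Submodule.mem_top (x := u)))
    exact inner_self_eq_zero.1 h1
  rw [← htop]
  refine iSup_le fun χ w hw => ?_
  rw [Submodule.mem_orthogonal_singleton_iff_inner_left]
  have hw' : ∀ H : 𝔞, (H : V →L[ℂ] V) w = χ H • w := fun H =>
    Module.End.mem_eigenspace_iff.1 ((Submodule.mem_iInf _).1 hw H)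
  by_cases hχ : χ X = a
  · exact h χ w hw' hχ
  · have h1 := inner_self_adjoint_comm (h𝔞 X X.2) u w
    rw [hu, hw', ← Complex.coe_smul, inner_smul_left, inner_smul_right, Complex.conj_ofReal,
      ← sub_eq_zero, ← sub_mul, mul_eq_zero, sub_eq_zero] at h1
    rw [← inner_conj_symm, h1.resolve_left (Ne.symm hχ), map_zero]

/-- If `X` separates the weights, then `𝔞` acts by scalars on the eigenspaces of `X`. -/
theorem exists_scalar_on_eigenspace (h𝔞 : ∀ H ∈ 𝔞, star H = H)
    (hc : ∀ H ∈ 𝔞, ∀ K ∈ 𝔞, H * K = K * H) (X : 𝔞)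
    (hX : ∀ μ ∈ weights 𝔞, ∀ ν ∈ weights 𝔞, μ ≠ ν → μ X ≠ ν X) (a : ℝ) :
    ∃ χ : 𝔞 → ℂ, ∀ u : V, (X : V →L[ℂ] V) u = a • u → ∀ H : 𝔞, (H : V →L[ℂ] V) u = χ H • u := by
  by_cases hex : ∃ (χ : 𝔞 → ℂ) (w : V), w ≠ 0 ∧ (∀ H : 𝔞, (H : V →L[ℂ] V) w = χ H • w) ∧ χ X = a
  · obtain ⟨χ, w, hw0, hw, hχ⟩ := hex
    obtain ⟨μ, hμ, hμχ⟩ := exists_mem_weights h𝔞 hw0 hw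
    refine ⟨χ, fun u hu => ?_⟩
    let J : Submodule ℂ V := ⨅ H : 𝔞, Module.End.eigenspace ((H : V →L[ℂ] V) : V →ₗ[ℂ] V) (χ H)
    have hJ : ∀ x, x ∈ J ↔ ∀ H : 𝔞, (H : V →L[ℂ] V) x = χ H • x := fun x => by
      simp only [J, Submodule.mem_iInf, Module.End.mem_eigenspace_iff]
      rfl
    -- A joint eigenvector with `X`-eigenvalue `a` has weight `μ`, since `X` separates weights, and
    -- so lies in `J`. The component of `u` orthogonal to `J` is thus orthogonal to all of them.
    have hz : u - J.starProjection u = 0 := by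
      refine eq_zero_of_orthogonal_joint_eigenvectors h𝔞 hc X (a := a) ?_ ?_
      · have h1 := (hJ _).1 (J.starProjection_apply_mem u) X
        rw [map_sub, hu, h1, hχ, smul_sub, Complex.coe_smul]
      · intro χ' x hx hχ'
        by_cases hx0 : x = 0
        · rw [hx0, inner_zero_left]
        obtain ⟨ν, hν, hνχ⟩ := exists_mem_weights h𝔞 hx0 hx
        have hμν : μ = ν := by
          by_contra hne
          refine hX μ hμ ν hν hne ?_
          have h2 : (μ X : ℂ) = ν X := by rw [← hμχ, ← hνχ, hχ, hχ']
          exact_mod_cast h2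
        have hxJ : x ∈ J := (hJ x).2 fun H => by rw [hx, hνχ, ← hμν, ← hμχ]
        exact Submodule.inner_right_of_mem_orthogonal hxJ (J.sub_starProjection_mem_orthogonal u)
    rw [sub_eq_zero.1 hz]
    exact (hJ _).1 (J.starProjection_apply_mem u)
  -- Without a joint eigenvector of `X`-eigenvalue `a` the eigenspace is zero, and any `χ` serves.
  · refine ⟨0, fun u hu H => ?_⟩
    have h0 : u = 0 := eq_zero_of_orthogonal_joint_eigenvectors h𝔞 hc X hu fun χ w hw hχ => by
      by_cases hw0 : w = 0
      · rw [hw0, inner_zero_left]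
      · exact absurd ⟨χ, w, hw0, hw, hχ⟩ hex
    rw [h0, map_zero, smul_zero]

omit [FiniteDimensional ℂ V] in
-- `𝔞 + ℝS` is still an abelian subspace of `𝔭`, so maximality applies.
theorem mem_of_isMaximalAbelianIn {𝔤 : Submodule ℂ (V →L[ℂ] V)}
    (h𝔞 : IsMaximalAbelianIn (cartanP 𝔤) 𝔞) {S : V →L[ℂ] V} (hS : S ∈ cartanP 𝔤)
    (hc : ∀ H ∈ 𝔞, S * H = H * S) : S ∈ 𝔞 := by
  have h1 : ∀ Y ∈ 𝔞 ⊔ ℝ ∙ S, ∃ H ∈ 𝔞, ∃ t : ℝ, H + t • S = Y := fun Y hY => by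
    obtain ⟨H, hH, Z, hZ, h⟩ := Submodule.mem_sup.1 hY
    obtain ⟨t, rfl⟩ := Submodule.mem_span_singleton.1 hZ
    exact ⟨H, hH, t, h⟩
  refine h𝔞.le_of_ge (y := 𝔞 ⊔ ℝ ∙ S) ⟨fun Y hY => ?_, fun Y hY Z hZ => ?_⟩ le_sup_left
    (le_sup_right (a := 𝔞) (Submodule.mem_span_singleton_self S))
  · obtain ⟨H, hH, t, rfl⟩ := h1 Y hY
    obtain ⟨hH1, hH2⟩ := h𝔞.prop.1 hH
    refine ⟨𝔤.add_mem hH1 (𝔤.smul_of_tower_mem t hS.1), ?_⟩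
    rw [star_add, star_smul, hH2, hS.2, star_trivial]
  · obtain ⟨H, hH, t, rfl⟩ := h1 Y hY
    obtain ⟨K, hK, s, rfl⟩ := h1 Z hZ
    have h2 := h𝔞.prop.2 H hH K hK
    rw [Ring.lie_def, sub_eq_zero] at h2
    rw [Ring.lie_def, sub_eq_zero]
    simp only [add_mul, mul_add, smul_mul_assoc, mul_smul_comm, h2, hc H hH, hc K hK]
    rw [smul_add, smul_add, smul_smul, smul_smul, mul_comm t s]
    abel

theorem eq_of_eq_on_eigenvectors {X A B : V →L[ℂ] V} (hX : star X = X)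
    (h : ∀ (a : ℝ) (u : V), X u = a • u → A u = B u) : A = B := by
  ext v
  have hv : v ∈ spectralSubspace X univ := by
    rw [spectralSubspace_univ hX]
    trivial
  refine spectralSubspace_induction (P := fun v => A v = B v) (fun a _ u hu => h a u hu)
    (by simp) (fun u w hu hw => by rw [map_add, map_add, hu, hw]) hv

/-- The centralizer in `𝔤` of an element of `𝔞` that separates the weights acts by scalars on its
eigenspaces. -/
theorem exists_scalar_of_commute {G : Subgroup (V →L[ℂ] V)ˣ}
    (hGθ : ∀ g ∈ G, cartanInvolution g ∈ G) {𝔤 : Submodule ℂ (V →L[ℂ] V)}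
    (h𝔤 : (𝔤 : Set (V →L[ℂ] V)) = lieAlgebraOf G) (h𝔞 : IsMaximalAbelianIn (cartanP 𝔤) 𝔞) (X : 𝔞)
    (hX : ∀ μ ∈ weights 𝔞, ∀ ν ∈ weights 𝔞, μ ≠ ν → μ X ≠ ν X) {Y : V →L[ℂ] V} (hY : Y ∈ 𝔤)
    (hXY : (X : V →L[ℂ] V) * Y = Y * X) {u : V} {a : ℝ} (hu : (X : V →L[ℂ] V) u = a • u) :
    ∃ c : ℂ, Y u = c • u := by
  have hsa : ∀ H ∈ 𝔞, star H = H := fun H hH => (h𝔞.prop.1 hH).2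
  have hcomm : ∀ H ∈ 𝔞, ∀ K ∈ 𝔞, H * K = K * H := fun H hH K hK => by
    have h := h𝔞.prop.2 H hH K hK
    rwa [Ring.lie_def, sub_eq_zero] at h
  have hscal := exists_scalar_on_eigenspace hsa hcomm X hX
  have hYstar : star Y ∈ 𝔤 := by
    rw [← SetLike.mem_coe, h𝔤] at hY ⊢
    exact star_mem_lieAlgebra hGθ hY
  -- Such a `Z` preserves the eigenspaces of `X`, on which `𝔞` acts by scalars. Hence `Z` commutes
  -- with `𝔞`, belongs to it, and is itself scalar there.
  have key : ∀ Z : V →L[ℂ] V, Z ∈ cartanP 𝔤 → (X : V →L[ℂ] V) * Z = Z * X →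
      ∃ c : ℂ, Z u = c • u := by
    intro Z hZ hXZ
    have hZ𝔞 : Z ∈ 𝔞 := mem_of_isMaximalAbelianIn h𝔞 hZ fun H hH => by
      refine eq_of_eq_on_eigenvectors (hsa X X.2) fun b w hw => ?_
      obtain ⟨χ, hχ⟩ := hscal b
      have h1 : (X : V →L[ℂ] V) (Z w) = b • Z w := by
        rw [← mul_apply_eq_comp, hXZ, mul_apply_eq_comp, hw, Z.map_smul_of_tower]
      have h2 := hχ w hw ⟨H, hH⟩
      have h3 := hχ (Z w) h1 ⟨H, hH⟩
      simp only at h2 h3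
      rw [mul_apply_eq_comp, mul_apply_eq_comp, h2, h3, map_smul]
    obtain ⟨χ, hχ⟩ := hscal a
    exact ⟨_, hχ u hu ⟨Z, hZ𝔞⟩⟩
  have hXY' : (X : V →L[ℂ] V) * star Y = star Y * X := by
    have h := congrArg star hXY
    rw [star_mul, star_mul, hsa X X.2] at h
    exact h.symm
  obtain ⟨c, hc⟩ := key (Y + star Y) ⟨𝔤.add_mem hY hYstar, by rw [star_add, star_star, add_comm]⟩
    (by rw [mul_add, add_mul, hXY, hXY'])
  -- Here `𝔤` must be a complex subspace: multiplication by `i` turns the skew-adjoint part of `Y`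
  -- into an element of `𝔭`.
  obtain ⟨d, hd⟩ := key (Complex.I • (Y - star Y))
    ⟨𝔤.smul_mem _ (𝔤.sub_mem hY hYstar), by
      rw [star_smul, star_sub, star_star, Complex.star_def, Complex.conj_I, neg_smul, ← smul_neg,
        neg_sub]⟩
    (by rw [mul_smul_comm, smul_mul_assoc, mul_sub, sub_mul, hXY, hXY'])
  have hsum : Y = (1 / 2 : ℂ) • (Y + star Y) +
      (-Complex.I / 2) • (Complex.I • (Y - star Y)) := by
    rw [smul_smul, div_mul_eq_mul_div, neg_mul, Complex.I_mul_I, neg_neg, ← smul_add,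
      add_add_sub_cancel, ← two_smul ℂ Y, smul_smul]
    norm_num
  refine ⟨1 / 2 * c + -Complex.I / 2 * d, ?_⟩
  rw [hsum, add_apply, smul_apply, hc, smul_apply, hd, smul_smul, smul_smul, add_smul]

end Centralizer

/-! ### The abstract setting `IsFlagFlow`: homogeneity and tangent spaces of `ℳ`. -/

section FlagFlow

variable {V : Type*} [NormedAddCommGroup V] [InnerProductSpace ℂ V] [FiniteDimensional ℂ V]
  [CompleteSpace V]

/-- A closed orbit `ℳ` of a closed group `G` with Lie algebra `𝔤`, with the flow of a self-adjoint
`X ∈ 𝔤` whose centralizer in `𝔤` acts by scalars on the eigenspaces of `X`. -/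
structure IsFlagFlow (G : Subgroup (V →L[ℂ] V)ˣ) (𝔤 : Submodule ℝ (V →L[ℂ] V)) (X : V →L[ℂ] V)
    (ℳ : Set (ℙ ℂ V)) : Prop where
  isClosed_group : IsClosed (G : Set (V →L[ℂ] V)ˣ)
  coe_lieAlgebra : (𝔤 : Set (V →L[ℂ] V)) = lieAlgebraOf G
  star_eq : star X = X
  mem_lieAlgebra : X ∈ 𝔤
  exists_scalar : ∀ Y ∈ 𝔤, X * Y = Y * X → ∀ (u : V) (a : ℝ), X u = a • u → ∃ c : ℂ, Y u = c • u
  exists_eq_orbit : ∃ x, ℳ = MulAction.orbit G x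
  isClosed_orbit : IsClosed ℳ

theorem exists_real_eigenvalue {X : V →L[ℂ] V} (hX : star X = X) {v : PuncturedSpace V}
    (h : IsCriticalPoint (projField X) (projPi v)) : ∃ a : ℝ, X v.1 = a • v.1 := by
  obtain ⟨c, hc⟩ := (isCriticalPoint_iff X v).1 h
  have h1 := inner_self_adjoint_comm hX v.1 v.1
  rw [hc, inner_smul_left, inner_smul_right] at h1
  have h2 := Complex.conj_eq_iff_re.1 (mul_right_cancel₀ (inner_self_ne_zero.2 v.2) h1)
  exact ⟨c.re, by rw [hc, ← Complex.coe_smul, h2]⟩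

omit [CompleteSpace V] in
theorem isCriticalPoint_of_eigenvector {X : V →L[ℂ] V} {v : PuncturedSpace V} {a : ℝ}
    (h : X v.1 = a • v.1) : IsCriticalPoint (projField X) (projPi v) :=
  (isCriticalPoint_iff X v).2 ⟨a, by rw [h, Complex.coe_smul]⟩

theorem tangentSpaceOf_mono {E : Type*} [NormedAddCommGroup E] [NormedSpace ℝ E] {P : Type*}
    [TopologicalSpace P] [ChartedSpace E P] {S T : Set P} (h : S ⊆ T) (p : P) :
    tangentSpaceOf (E := E) S p ≤ tangentSpaceOf T p :=
  Submodule.span_mono fun _ ⟨γ, h0, hγ, hS, hξ⟩ => ⟨γ, h0, hγ, hS.mono fun _ ht => h ht, hξ⟩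

namespace IsFlagFlow

variable {G : Subgroup (V →L[ℂ] V)ˣ} {𝔤 : Submodule ℝ (V →L[ℂ] V)} {X : V →L[ℂ] V}
  {ℳ : Set (ℙ ℂ V)}

omit [FiniteDimensional ℂ V] in
theorem neg (h : IsFlagFlow G 𝔤 X ℳ) : IsFlagFlow G 𝔤 (-X) ℳ where
  isClosed_group := h.isClosed_group
  coe_lieAlgebra := h.coe_lieAlgebra
  star_eq := by rw [star_neg, h.star_eq]
  mem_lieAlgebra := neg_mem h.mem_lieAlgebra
  exists_scalar Y hY hXY u a hu := h.exists_scalar Y hY (by simpa using hXY) u (-a) (by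
    rw [neg_smul, ← hu, neg_apply, neg_neg])
  exists_eq_orbit := h.exists_eq_orbit
  isClosed_orbit := h.isClosed_orbit

omit [FiniteDimensional ℂ V] in
theorem eq_orbit (h : IsFlagFlow G 𝔤 X ℳ) {p : ℙ ℂ V} (hp : p ∈ ℳ) : ℳ = MulAction.orbit G p := by
  obtain ⟨x, rfl⟩ := h.exists_eq_orbit
  exact (MulAction.orbit_eq_iff.2 hp).symm

omit [FiniteDimensional ℂ V] in
theorem smul_mem_iff (h : IsFlagFlow G 𝔤 X ℳ) {g : (V →L[ℂ] V)ˣ} (hg : g ∈ G) (q : ℙ ℂ V) :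
    g • q ∈ ℳ ↔ q ∈ ℳ := by
  obtain ⟨x, rfl⟩ := h.exists_eq_orbit
  constructor
  · rintro ⟨k, hk⟩
    refine ⟨⟨g, hg⟩⁻¹ * k, ?_⟩
    change (⟨g, hg⟩⁻¹ * k : G) • x = q
    rw [mul_smul, show k • x = (⟨g, hg⟩ : G) • q from hk, inv_smul_smul]
  · rintro ⟨k, rfl⟩
    exact ⟨⟨g, hg⟩ * k, mul_smul (⟨g, hg⟩ : G) k x⟩

theorem expUnit_smul_mem (h : IsFlagFlow G 𝔤 X ℳ) {Y : V →L[ℂ] V} (hY : Y ∈ 𝔤) {q : ℙ ℂ V}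
    (hq : q ∈ ℳ) : expUnit Y • q ∈ ℳ :=
  (h.smul_mem_iff (expUnit_mem h.coe_lieAlgebra hY) q).2 hq

theorem projFlow_mem (h : IsFlagFlow G 𝔤 X ℳ) (t : ℝ) {q : ℙ ℂ V} (hq : q ∈ ℳ) :
    projFlow X t q ∈ ℳ :=
  h.expUnit_smul_mem (𝔤.smul_mem t h.mem_lieAlgebra) hq

/-- The limit of any trajectory in the closed invariant set `ℳ` is an eigenline in `ℳ`. -/
theorem exists_eigenvector (h : IsFlagFlow G 𝔤 X ℳ) :
    ∃ (a : ℝ) (v : PuncturedSpace V), X v.1 = a • v.1 ∧ projPi v ∈ ℳ := by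
  obtain ⟨x, hx⟩ := h.exists_eq_orbit
  have hxM : x ∈ ℳ := hx ▸ MulAction.mem_orbit_self x
  obtain ⟨a, v, hv, ht⟩ := exists_tendsto_projFlow h.star_eq x
  exact ⟨a, v, hv, h.isClosed_orbit.mem_of_tendsto ht
    (Eventually.of_forall fun t => h.projFlow_mem t hxM)⟩

/-- Every point of `ℳ` is moved by `G` to a fixed point of the flow. -/
theorem exists_smul_eigenvector (h : IsFlagFlow G 𝔤 X ℳ) {u : PuncturedSpace V}
    (hu : projPi u ∈ ℳ) : ∃ g ∈ G, ∃ a : ℝ,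
      X ((g : V →L[ℂ] V) u.1) = a • (g : V →L[ℂ] V) u.1 := by
  obtain ⟨a, v, hv, hvM⟩ := h.exists_eigenvector
  rw [h.eq_orbit hu] at hvM
  obtain ⟨⟨g, hg⟩, hgv⟩ := hvM
  have h1 : projPi ⟨(g : V →L[ℂ] V) u.1, units_apply_ne_zero g u.2⟩ = projPi v :=
    (smul_projPi g u).symm.trans hgv
  obtain ⟨c, -, hc⟩ := exists_smul_of_projPi_eq h1
  refine ⟨g, hg, a, ?_⟩
  simp only at hc
  rw [hc]
  exact smul_eigenvector hv c

theorem local_structure (h : IsFlagFlow G 𝔤 X ℳ) {v : PuncturedSpace V} {a : ℝ}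
    (hv : X v.1 = a • v.1) (hvM : projPi v ∈ ℳ) :
    IsSliceAt (ProjModel V) ℳ (projPi v) ∧
    IsSliceAt (ProjModel V) (stableManifold (projFlow X) {projPi v} ∩ ℳ) (projPi v) ∧
    ∀ (w : ℝ → V) (w' : V) (hw : ∀ t, w t ≠ 0), w 0 = v.1 → HasDerivAt w w' 0 →
      (∀ᶠ t in 𝓝 0, projPi ⟨w t, hw t⟩ ∈ ℳ) → ∃ Y ∈ 𝔤, ∃ c : ℂ, w' = Y v.1 + c • v.1 := by
  have hcl := h.isClosed_orbit
  rw [h.eq_orbit hvM] at hcl ⊢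
  exact closedOrbit_local_structure h.isClosed_group h.coe_lieAlgebra h.star_eq h.mem_lieAlgebra
    h.exists_scalar v hv hcl

theorem isEmbeddedSubmanifold (h : IsFlagFlow G 𝔤 X ℳ) :
    IsEmbeddedSubmanifold (ProjModel V) ℳ := by
  intro p hp
  obtain ⟨u, rfl⟩ := projPi_surjective p
  obtain ⟨g, hg, a, ha⟩ := h.exists_smul_eigenvector hp
  refine IsSliceAt.of_smul (g := g) (h.smul_mem_iff hg) ?_
  rw [smul_projPi]
  refine (h.local_structure ha ?_).1
  rw [← smul_projPi, h.smul_mem_iff hg]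
  exact hp

/-- This is `T_z ℳ = 𝔤 · z` in the nontrivial direction. A curve is lifted to `V` and moved by `g`
to a critical point, where the local structure expresses its velocity through some `Y ∈ 𝔤`;
conjugation by `g⁻¹` brings the result back. -/
theorem exists_projField_eq (h : IsFlagFlow G 𝔤 X ℳ) {u : PuncturedSpace V} (hu : projPi u ∈ ℳ)
    {ξ : TangentSpace 𝓘(ℝ, ProjModel V) (projPi u)} (hξ : ξ ∈ tangentSpaceOf ℳ (projPi u)) :
    ∃ Y ∈ 𝔤, ξ = dProjPi u (Y u.1) := by
  suffices hle : tangentSpaceOf ℳ (projPi u) ≤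
      𝔤.map ((dProjPi u).comp (evalAt u.1)).toLinearMap by
    obtain ⟨Y, hY, h1⟩ := hle hξ
    exact ⟨Y, hY, (show dProjPi u (Y u.1) = ξ from h1).symm⟩
  refine Submodule.span_le.2 ?_
  rintro _ ⟨γ, h0, hγ, hγM, rfl⟩
  obtain ⟨w, w', hw, hwd, hγw, hw0, h1⟩ := exists_lift_curve h0 (hγ.mdifferentiableAt (by simp))
  obtain ⟨g, hg, a, ha⟩ := h.exists_smul_eigenvector hu
  have hgM : projPi ⟨(g : V →L[ℂ] V) u.1, units_apply_ne_zero g u.2⟩ ∈ ℳ := by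
    rw [← smul_projPi, h.smul_mem_iff hg]
    exact hu
  obtain ⟨Y, hY, c, hc⟩ := (h.local_structure ha hgM).2.2
    (fun t => (g : V →L[ℂ] V) (w t)) ((g : V →L[ℂ] V) w') (fun t => units_apply_ne_zero g (hw t))
    (congrArg (g : V →L[ℂ] V) hw0)
    (((g : V →L[ℂ] V).restrictScalars ℝ).hasFDerivAt.comp_hasDerivAt 0 hwd) (by
      filter_upwards [hγw, hγM] with t ht htM
      rw [ht] at htM
      exact (h.smul_mem_iff hg _).2 htM)
  have hgY := conj_mem_lieAlgebra h.coe_lieAlgebra (G.inv_mem hg) hY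
  rw [inv_inv] at hgY
  have hinv : ∀ x : V, ((g⁻¹ : (V →L[ℂ] V)ˣ) : V →L[ℂ] V) ((g : V →L[ℂ] V) x) = x := fun x => by
    rw [← mul_apply_eq_comp, Units.inv_mul, one_apply_eq_self]
  have hw' : w' = (((g⁻¹ : (V →L[ℂ] V)ˣ) : V →L[ℂ] V) * Y * g) u.1 + c • u.1 := by
    rw [← hinv w', hc, map_add, map_smul, hinv]
    rfl
  refine ⟨_, hgY, ?_⟩
  change dProjPi u ((((g⁻¹ : (V →L[ℂ] V)ˣ) : V →L[ℂ] V) * Y * g) u.1) = _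
  rw [h1, hw', map_add, dProjPi_self_smul, add_zero]

omit [CompleteSpace V] in
theorem projFlow_mem_stableManifold_iff (A : V →L[ℂ] V) (p q : ℙ ℂ V) (t : ℝ) :
    projFlow A t q ∈ stableManifold (projFlow A) {p} ↔ q ∈ stableManifold (projFlow A) {p} := by
  rw [mem_stableManifold_singleton, mem_stableManifold_singleton]
  simp only [← projFlow_add]
  have h := tendsto_map'_iff (f := fun s => projFlow A s q) (g := fun s => s + t) (x := atTop)
    (y := 𝓝 p)
  rw [map_add_atTop_eq] at h
  exact h.symm

end IsFlagFlow

end FlagFlow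

/-! ### The Morse–Smale properties of a flag flow. -/

section FlagFlowMorseSmale

variable {V : Type*} [NormedAddCommGroup V] [InnerProductSpace ℂ V] [FiniteDimensional ℂ V]
  [CompleteSpace V]

namespace IsFlagFlow

variable {G : Subgroup (V →L[ℂ] V)ˣ} {𝔤 : Submodule ℝ (V →L[ℂ] V)} {X : V →L[ℂ] V}
  {ℳ : Set (ℙ ℂ V)}

/-- The limit `p` lies in `ℳ`, so a slice chart exists there. The flow brings `q` into its domain
and preserves the stable manifold, so the chart pulls back to `q`. -/
theorem isEmbeddedSubmanifold_stable (h : IsFlagFlow G 𝔤 X ℳ) {p : ℙ ℂ V}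
    (hp : IsCriticalPoint (projField X) p) :
    IsEmbeddedSubmanifold (ProjModel V) (stableManifold (projFlow X) {p} ∩ ℳ) := by
  rintro q ⟨hq, hqM⟩
  obtain ⟨v, rfl⟩ := projPi_surjective p
  obtain ⟨a, ha⟩ := exists_real_eigenvalue h.star_eq hp
  have hlim := mem_stableManifold_singleton.1 hq
  have hpM : projPi v ∈ ℳ := h.isClosed_orbit.mem_of_tendsto hlim
    (Eventually.of_forall fun t => h.projFlow_mem t hqM)
  obtain ⟨e, he, F, hpe, heF⟩ := (h.local_structure ha hpM).2.1
  obtain ⟨t, ht⟩ := (hlim.eventually (e.open_source.mem_nhds hpe)).exists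
  refine IsSliceAt.of_smul (g := expUnit (t • X)) (fun y => ?_) ⟨e, he, F, ht, heF⟩
  exact and_congr (projFlow_mem_stableManifold_iff X _ y t)
    (h.smul_mem_iff (expUnit_mem h.coe_lieAlgebra (𝔤.smul_mem t h.mem_lieAlgebra)) y)

theorem isEmbeddedSubmanifold_unstable (h : IsFlagFlow G 𝔤 X ℳ) {p : ℙ ℂ V}
    (hp : IsCriticalPoint (projField X) p) :
    IsEmbeddedSubmanifold (ProjModel V) (unstableManifold (projFlow X) {p} ∩ ℳ) := by
  rw [unstableManifold_projFlow]
  refine h.neg.isEmbeddedSubmanifold_stable ?_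
  obtain ⟨v, rfl⟩ := projPi_surjective p
  obtain ⟨a, ha⟩ := exists_real_eigenvalue h.star_eq hp
  refine isCriticalPoint_of_eigenvector (a := -a) ?_
  rw [neg_apply, ha, neg_smul]

/-- Lowering elements of `𝔤`, and elements commuting with `X`, are tangent to stable manifolds. -/
theorem projField_mem_tangentSpaceOf_stable (h : IsFlagFlow G 𝔤 X ℳ) {p q : ℙ ℂ V}
    (hp : IsCriticalPoint (projField X) p) (hq : q ∈ stableManifold (projFlow X) {p} ∩ ℳ)
    {Y : V →L[ℂ] V} (hY : (Y ∈ 𝔤 ∧ X * Y = Y * X) ∨ Y ∈ adSubspace X 𝔤 (Iio 0)) :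
    projField Y q ∈ tangentSpaceOf (stableManifold (projFlow X) {p} ∩ ℳ) q := by
  have hY𝔤 : Y ∈ 𝔤 := hY.elim And.left fun h => adSubspace_le X 𝔤 _ h
  refine projField_mem_tangentSpaceOf fun t => ⟨?_, h.expUnit_smul_mem (𝔤.smul_mem t hY𝔤) hq.2⟩
  obtain ⟨v, rfl⟩ := projPi_surjective p
  obtain ⟨a, ha⟩ := exists_real_eigenvalue h.star_eq hp
  rcases hY with ⟨-, hXY⟩ | hY
  · have h1 := mem_stableManifold_singleton.1 hq.1
    rw [mem_stableManifold_singleton]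
    obtain ⟨c, hc⟩ := h.exists_scalar Y hY𝔤 hXY v.1 a ha
    -- The exponential fixes the limit `[v]` and commutes with the flow, so it maps trajectories
    -- tending to `[v]` to such trajectories.
    have h2 : expUnit (t • Y) • projPi v = projPi v := by
      rw [smul_projPi]
      refine projPi_eq_of_smul (expUnit_apply_eigenvector (c := t • c) ?_)
      rw [smul_apply, hc, smul_assoc]
    have h3 := h1.const_smul (expUnit (t • Y))
    rw [h2] at h3
    refine h3.congr fun s => ?_
    have hcomm : Commute (s • X) (t • Y) := (Commute.smul_left (Commute.smul_right hXY t) s)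
    rw [projFlow, projFlow, ← mul_smul, ← mul_smul, ← expUnit_add_of_commute hcomm,
      ← expUnit_add_of_commute hcomm.symm, add_comm]
  · obtain ⟨u, rfl⟩ := projPi_surjective q
    obtain ⟨c, hc, hu⟩ := (projPi_mem_stableManifold_iff h.star_eq ha).1 hq.1
    rw [smul_projPi, projPi_mem_stableManifold_iff h.star_eq ha]
    refine ⟨c, hc, ?_⟩
    -- The exponential of a lowering operator leaves the leading component `c • v` unchanged and
    -- adds only lower terms.
    have hY' := (adSubspace X 𝔤 (Iio 0)).smul_mem t hY
    have h1 := expUnit_lowering_apply_mem hY' hu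
    have h2 := exp_lowering_sub_mem hY' (realEigenspace_le_spectralSubspace X self_mem_Iic
      (mem_realEigenspace.2 (smul_eigenvector ha c)))
    rw [map_sub] at h1
    simpa using add_mem h1 h2

/-- Each vector of `T_z ℳ` is `Y · z` with `Y = Y₀ + Y₁ + Y₂`. The commuting part and the lowering
part are tangent to the stable manifold through `z`; the raising part, lowering for `-X`, is tangent
to the unstable one. -/
theorem intersectTransversally (h : IsFlagFlow G 𝔤 X ℳ) {p q : ℙ ℂ V}
    (hp : IsCriticalPoint (projField X) p) (hq : IsCriticalPoint (projField X) q) :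
    IntersectTransversally (ProjModel V) ℳ (unstableManifold (projFlow X) {p} ∩ ℳ)
      (stableManifold (projFlow X) {q} ∩ ℳ) := by
  refine ⟨inter_subset_right, inter_subset_right, h.isEmbeddedSubmanifold_unstable hp,
    h.isEmbeddedSubmanifold_stable hq, fun z hz => le_antisymm
    (sup_le (tangentSpaceOf_mono inter_subset_right z) (tangentSpaceOf_mono inter_subset_right z))
    fun ξ hξ => ?_⟩
  have hp' : IsCriticalPoint (projField (-X)) p := by
    obtain ⟨v, rfl⟩ := projPi_surjective p
    obtain ⟨a, ha⟩ := exists_real_eigenvalue h.star_eq hp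
    refine isCriticalPoint_of_eigenvector (a := -a) ?_
    rw [neg_apply, ha, neg_smul]
  obtain ⟨hz1, hz2⟩ := hz
  rw [unstableManifold_projFlow] at hz1 ⊢
  obtain ⟨u, rfl⟩ := projPi_surjective z
  obtain ⟨Y, hY, rfl⟩ := h.exists_projField_eq hz1.2 hξ
  obtain ⟨Y₀, h0, Y₁, h1, Y₂, h2, hc, rfl⟩ :=
    adSubspace_decomposition h.coe_lieAlgebra h.star_eq h.mem_lieAlgebra hY
  have h3 := h.projField_mem_tangentSpaceOf_stable hq hz2 (Or.inl ⟨h0, hc⟩)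
  have h4 := h.projField_mem_tangentSpaceOf_stable hq hz2 (Or.inr h1)
  have h5 := h.neg.projField_mem_tangentSpaceOf_stable hp' hz1 (Y := Y₂)
    (Or.inr (by rwa [adSubspace_neg_Iio]))
  rw [projField_projPi] at h3 h4 h5
  rw [add_apply, add_apply, map_add, map_add, add_comm]
  exact Submodule.add_mem_sup h5 (add_mem h3 h4)

/-- `T_p ℳ` is spanned by images of eigenvectors of `X` with eigenvalue `b ≠ a`, because the
commuting part of `𝔤` only rescales `v`. On them the linearization is multiplication by the nonzero
real number `b - a`. -/
theorem isHyperbolicCriticalPoint (h : IsFlagFlow G 𝔤 X ℳ) {p : ℙ ℂ V} (hpM : p ∈ ℳ)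
    (hp : IsCriticalPoint (projField X) p) : IsHyperbolicCriticalPoint (projField X) ℳ p := by
  obtain ⟨v, rfl⟩ := projPi_surjective p
  obtain ⟨a, ha⟩ := exists_real_eigenvalue h.star_eq hp
  have haC : X v.1 = (a : ℂ) • v.1 := by rw [ha, Complex.coe_smul]
  have hve : v.1 ∈ realEigenspace X a := mem_realEigenspace.2 ha
  intro μ ζ hζ hζ0 hμ hre
  set D := (linearization (projField X) (projPi v)).toLinearMap.baseChange ℂ with hD
  -- For `μ` with real part zero, the complexified tangent space lies in the sum of the eigenspaces
  -- for the other eigenvalues, which meets the `μ`-eigenspace only in `0`.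
  let K : Submodule ℂ (ℂ ⊗[ℝ] TangentSpace 𝓘(ℝ, ProjModel V) (projPi v)) :=
    ⨆ ν : ℂ, ⨆ _ : ν ≠ μ, Module.End.eigenspace D ν
  have heig : ∀ (b : ℝ) (u : V), b ≠ a → X u = b • u →
      (1 : ℂ) ⊗ₜ[ℝ] (dProjPi v u) ∈ K := by
    intro b u hba hu
    refine Submodule.mem_iSup_of_mem ((b - a : ℝ) : ℂ) (Submodule.mem_iSup_of_mem ?_ ?_)
    · rintro rfl
      rw [Complex.ofReal_re, sub_eq_zero] at hre
      exact hba hre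
    · have hlin : linearization (projField X) (projPi v) (dProjPi v u) = (b - a) • dProjPi v u := by
        refine (linearization_dProjPi X v haC u).trans ?_
        rw [hu, Complex.coe_smul, ← sub_smul]
        exact map_smul (dProjPi v) (b - a) u
      rw [Module.End.mem_eigenspace_iff, hD, LinearMap.baseChange_tmul]
      refine (congrArg ((1 : ℂ) ⊗ₜ[ℝ] ·) hlin).trans ?_
      rw [Complex.coe_smul]
      exact TensorProduct.tmul_smul (b - a) (1 : ℂ) (dProjPi v u)
  have hspec : ∀ (s : Set ℝ) (u : V), a ∉ s → u ∈ spectralSubspace X s →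
      (1 : ℂ) ⊗ₜ[ℝ] (dProjPi v u) ∈ K := by
    intro s u has hu
    refine spectralSubspace_induction (P := fun u => (1 : ℂ) ⊗ₜ[ℝ] (dProjPi v u) ∈ K)
      (fun b hb u hu => heig b u (ne_of_mem_of_not_mem hb has) hu) ?_ (fun u w hu hw => ?_) hu
    · rw [map_zero, TensorProduct.tmul_zero]
      exact K.zero_mem
    · rw [map_add, TensorProduct.tmul_add]
      exact K.add_mem hu hw
  have hK : complexTangentSpaceOf ℳ (projPi v) ≤ K := by
    rw [complexTangentSpaceOf, Submodule.baseChange_eq_span, Submodule.span_le]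
    rintro _ ⟨ξ, hξ, rfl⟩
    obtain ⟨Y, hY, rfl⟩ := h.exists_projField_eq hpM hξ
    obtain ⟨Y₀, h0, Y₁, h1, Y₂, h2, hc, rfl⟩ :=
      adSubspace_decomposition h.coe_lieAlgebra h.star_eq h.mem_lieAlgebra hY
    obtain ⟨c, hc⟩ := h.exists_scalar Y₀ h0 hc v.1 a ha
    change (1 : ℂ) ⊗ₜ[ℝ] (dProjPi v ((Y₀ + Y₁ + Y₂) v.1)) ∈ K
    rw [add_apply, add_apply, hc, map_add, map_add, dProjPi_self_smul, zero_add,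
      TensorProduct.tmul_add]
    exact K.add_mem
      (hspec _ _ self_notMem_Iio
        (lowering_apply_mem h1 (realEigenspace_le_spectralSubspace X self_mem_Iic hve)))
      (hspec _ _ self_notMem_Ioi
        (raising_apply_mem h2 (realEigenspace_le_spectralSubspace X self_mem_Ici hve)))
  exact hζ0 (Submodule.disjoint_def.1 (Module.End.eigenspaces_iSupIndep D μ) ζ
    (Module.End.mem_eigenspace_iff.2 hμ) (hK hζ))

/-- The critical points form a compact set whose points are isolated. -/
theorem finite_setOf_isCriticalPoint (h : IsFlagFlow G 𝔤 X ℳ) :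
    {p ∈ ℳ | IsCriticalPoint (projField X) p}.Finite := by
  -- Without periodic orbits the critical points are the fixed points of the time-one map, which
  -- visibly form a closed set.
  have heq : {p ∈ ℳ | IsCriticalPoint (projField X) p} = ℳ ∩ {p | projFlow X 1 p = p} := by
    ext p
    exact and_congr_right fun _ => ⟨fun hp => projFlow_eq_of_isCriticalPoint hp 1,
      fun hp => isCriticalPoint_of_projFlow_eq h.star_eq one_pos hp⟩
  have hcomp : IsCompact {p ∈ ℳ | IsCriticalPoint (projField X) p} := by
    rw [heq]
    exact (h.isClosed_orbit.inter (isClosed_eq (continuous_projFlow X 1) continuous_id)).isCompact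
  rw [← inter_self {p ∈ ℳ | IsCriticalPoint (projField X) p}]
  refine hcomp.induction_on (p := fun s => (s ∩ {p ∈ ℳ | IsCriticalPoint (projField X) p}).Finite)
    (by simp) (fun s t hst ht => ht.subset (inter_subset_inter_left _ hst))
    (fun s t hs ht => by rw [union_inter_distrib_right]; exact hs.union ht) ?_
  rintro p ⟨hpM, hp⟩
  obtain ⟨v, rfl⟩ := projPi_surjective p
  obtain ⟨a, ha⟩ := exists_real_eigenvalue h.star_eq hp
  have horb := h.eq_orbit hpM
  obtain ⟨O, hO, hOp⟩ := exists_nhds_isCriticalPoint_eq h.isClosed_group h.coe_lieAlgebra h.star_eq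
    h.mem_lieAlgebra h.exists_scalar v ha (horb ▸ h.isClosed_orbit)
  refine ⟨O, mem_nhdsWithin_of_mem_nhds hO, (finite_singleton (projPi v)).subset ?_⟩
  rintro y ⟨hyO, hyM, hy⟩
  exact hOp y hyO (horb ▸ hyM) hy

theorem isMorseSmaleOn (h : IsFlagFlow G 𝔤 X ℳ) :
    IsMorseSmaleOn (projField X) (projFlow X) ℳ where
  smooth := contMDiff_projField X
  isFlow := isFlowOf_projFlow X
  isCompact := h.isClosed_orbit.isCompact
  isSubmanifold := h.isEmbeddedSubmanifold
  tangent _ hp := projField_mem_tangentSpaceOf fun t => h.projFlow_mem t hp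
  invariant t _ hp := h.projFlow_mem t hp
  finite := by
    rw [criticalElements_projFlow h.star_eq]
    exact h.finite_setOf_isCriticalPoint.image _
  hyperbolicPoint _ hpM hp := h.isHyperbolicCriticalPoint hpM hp
  hyperbolicOrbit p _ T hT := absurd hT (not_hasClosedOrbit_projFlow h.star_eq p T)
  transversal := by
    rw [criticalElements_projFlow h.star_eq]
    rintro _ ⟨p, ⟨-, hp⟩, rfl⟩ _ ⟨q, ⟨-, hq⟩, rfl⟩
    exact h.intersectTransversally hp hq
  nonwandering := by
    rw [nonwanderingSet_projFlow h.star_eq, criticalElements_projFlow h.star_eq, sUnion_image,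
      biUnion_of_singleton]

end IsFlagFlow

end FlagFlowMorseSmale

/-! ### The main theorem. -/

theorem lemma5p4 {V : Type*} [NormedAddCommGroup V] [InnerProductSpace ℂ V]
    [FiniteDimensional ℂ V] [CompleteSpace V]
    -- a closed connected subgroup of `GL(V)`, stable under the Cartan involution,
    -- whose Lie algebra `𝔤` is a complex subspace of `𝔤𝔩(V)`
    (G : Subgroup (V →L[ℂ] V)ˣ)
    (hGclosed : IsClosed (G : Set (V →L[ℂ] V)ˣ))
    (hGconn : IsConnected (G : Set (V →L[ℂ] V)ˣ))
    (hGθ : ∀ g ∈ G, cartanInvolution g ∈ G)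
    (𝔤 : Submodule ℂ (V →L[ℂ] V)) (h𝔤 : (𝔤 : Set (V →L[ℂ] V)) = lieAlgebraOf G)
    -- a maximal abelian subspace of `𝔭` and a regular element that defines the positive roots
    (𝔞 : Submodule ℝ (V →L[ℂ] V)) (h𝔞 : IsMaximalAbelianIn (cartanP 𝔤) 𝔞)
    (X₀ : 𝔞) (hX₀ : ∀ α ∈ restrictedRoots 𝔤 𝔞, α X₀ ≠ 0)
    -- the flag manifold `ℳ`, a closed `G`-orbit in `ℙ(V)`
    (ℳ : Set (ℙ ℂ V)) (hℳ : ∃ x : ℙ ℂ V, ℳ = MulAction.orbit G x) (hℳclosed : IsClosed ℳ)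
    -- an element of `𝔞` with special flow
    (X : 𝔞) (hX : IsSpecial 𝔤 𝔞 X₀ X) :
    IsMorseSmaleOn (projField (X : V →L[ℂ] V)) (projFlow (X : V →L[ℂ] V)) ℳ ∧
    IsFubiniStudyGradient (heightFunction (X : V →L[ℂ] V))
      (fun p => -projField (X : V →L[ℂ] V) p) ∧
    (∀ x ∈ fixedPointsIn (projFlow (X : V →L[ℂ] V)) ℳ,
      ∀ y ∈ fixedPointsIn (projFlow (X : V →L[ℂ] V)) ℳ,
      IntersectTransversally (ProjModel V) ℳ
        (unstableManifold (projFlow (X : V →L[ℂ] V)) {x} ∩ ℳ)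
        (stableManifold (projFlow (X : V →L[ℂ] V)) {y} ∩ ℳ)) ∧
    (∀ p ∈ ℳ, IsCriticalPoint (projField (X : V →L[ℂ] V)) p →
      IsHyperbolicCriticalPoint (projField (X : V →L[ℂ] V)) ℳ p) := by
  have hp := h𝔞.prop.1 X.2
  -- The complex structure of `𝔤` has served its purpose in `exists_scalar_of_commute`; from here on
  -- only the underlying real Lie algebra is needed.
  have h : IsFlagFlow G (𝔤.restrictScalars ℝ) X ℳ :=
    { isClosed_group := hGclosed
      coe_lieAlgebra := h𝔤
      star_eq := hp.2
      mem_lieAlgebra := hp.1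
      exists_scalar := fun Y hY hXY u a hu =>
        exists_scalar_of_commute hGθ h𝔤 h𝔞 X hX.2 hY hXY hu
      exists_eq_orbit := hℳ
      isClosed_orbit := hℳclosed }
  refine ⟨h.isMorseSmaleOn, isFubiniStudyGradient_heightFunction hp.2, fun x hx y hy => ?_,
    fun p hpM hpc => h.isHyperbolicCriticalPoint hpM hpc⟩
  exact h.intersectTransversally (isCriticalPoint_of_projFlow_eq hp.2 one_pos (hx.2 1))
    (isCriticalPoint_of_projFlow_eq hp.2 one_pos (hy.2 1))
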